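/- Let $a,b\in\mathbb R$, $a\neq 0$, let $\hbar$ be a formal parameter and $K=\mathbb R[[\hbar]]$. In $gl(2)$ (with $[J_3,J_\pm]=\pm2J_\pm$, $[J_+,J_-]=J_3$, $I$ central) write $x\wedge y=x\otimes y-y\otimes x$ and put $\delta(J_3)=\delta(I)=0$, $\delta(J_+)=a\,J_3\wedge J_++b\,J_+\wedge I$, $\delta(J_-)=a\,J_3\wedge J_--b\,J_-\wedge I$. Let $U$ be the $K$-algebra topologically generated (in the $\hbar$-adic topology) by $J_3,J_+,J_-,I$ subject to $$[J_3,J_\pm]=\pm2J_\pm,\qquad [J_+,J_-]=\frac{\sinh(a\hbar J_3)}{a\hbar},\qquad [I,\cdot\,]=0 ,$$ that is, the power series in $\hbar$ over the free algebra on these generators modulo the $\hbar$-adic closure of the ideal of relations; $\hat\otimes$ denotes the $\hbar$-adically completed tensor product. Then: 1. $(gl(2),\delta)$ is a Lie bialgebra, and $\delta(x)=[1\otimes x+x\otimes1,r]$ for $r=-\tfrac12 b\,J_3\wedge I-a\,J_+\wedge J_-$, where the Schouten bracket $[[r,r]]=[r_{12},r_{13}]+[r_{12},r_{23}]+[r_{13},r_{23}]$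 is ad-invariant and non-zero (the bialgebra is standard). 2. There is exactly one $\hbar$-adic Hopf algebra structure $U_{a,b}(gl(2))$ on $U$ with counit vanishing on the generators and $$\Delta(I)=1\otimes I+I\otimes1,\qquad \Delta(J_3)=1\otimes J_3+J_3\otimes 1,$$ $$\Delta(J_\pm)=e^{\hbar(aJ_3\mp bI)/2}\otimes J_\pm+J_\pm\otimes e^{-\hbar(aJ_3\mp bI)/2}.$$ 3. It is a quantization of $(gl(2),\delta)$: $U$ is a topologically free $K$-module; there is an isomorphism $U/\hbar U\cong U(gl(2))$ of Hopf algebras that sends each generator to the generator of the same name; and $\hbar^{-1}(\Delta-\Delta^{op})\equiv\delta \pmod\hbar$ on $gl(2)$. 4. The element $$\mathcal C=\cosh(a\hbar)\Big(\frac{\sinh(a\hbar J_3/2)}{a\hbar/2}\Big)^2+2\,\frac{\sinh(a\hbar)}{a\hbar}\,(J_+J_-+J_-J_+)$$ is central in $U$, and it reduces modulo $\hbar$ to the Casimir $J_3^2+2J_+J_-+2J_-J_+$. 5. $U_{a,b}(gl(2))$ is a Reshetikhin twist of the standard deformation $U_{a,0}(gl(2))$: the element $F=\exp(\tfrac{b\hbar}{4}J_3\wedge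 I)\in U\hat\otimes U$ is invertible, satisfies $F_{12}(\Delta_{a,0}\otimes\mathrm{id})(F)=F_{23}(\mathrm{id}\otimes\Delta_{a,0})(F)$ and $(\varepsilon\otimes\mathrm{id})(F)=1=(\mathrm{id}\otimes\varepsilon)(F)$, and $F_{21}=F\exp(-\tfrac{b\hbar}{2}J_3\wedge I)$; moreover $\Delta_{a,b}(x)=F\Delta_{a,0}(x)F^{-1}$ for all $x\in U$, and the counits of $U_{a,b}(gl(2))$ and $U_{a,0}(gl(2))$ coincide. 6. $U_{a,b}(gl(2))$ is the symmetry algebra of the twisted spin-$\tfrac12$ XXZ chain, in the following sense. There is a unique $K$-algebra homomorphism $D:U\to M_2(K)$ with $D(J_3)=\sigma_3$, $D(I)=1$, $D(J_+)=\cosh(\tfrac{a\hbar}{2})\,\sigma_+$, $D(J_-)=\frac{\sinh(a\hbar/2)}{a\hbar/2}\,\sigma_-$, where $\sigma_3=\mathrm{diag}(1,-1)$, $\sigma_+=E_{12}$, $\sigma_-=E_{21}$. The coproduct of the Casimir gives the two-site twisted XXZ Hamiltonian $$h:=(D\otimes D)\Delta(\mathcal C)=2\Big(\frac{\sinh a\hbar}{a\hbar}\Big)^2\Big(3\cosh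 a\hbar+\cosh(a\hbar)\,\sigma_3\otimes\sigma_3+\sinh(a\hbar)(\sigma_3\otimes1-1\otimes\sigma_3)+2e^{b\hbar}\sigma_+\otimes\sigma_-+2e^{-b\hbar}\sigma_-\otimes\sigma_+\Big).$$ For every $N\ge0$ the open chain Hamiltonian $\sum_{i=1}^N h_{i,i+1}$ commutes with $D^{\otimes(N+1)}(\Delta^{(N+1)}(x))$ for all $x\in U$, where $\Delta^{(N+1)}$ is the iterated coproduct with $N+1$ tensor factors. For every $N\ge2$ the closed chain $\sum_{i=1}^N h_{i,i+1}$ (site $N+1$ being site $1$) is conjugate, by an invertible operator, to the XXZ Hamiltonian $$2\Big(\frac{\sinh a\hbar}{a\hbar}\Big)^2\sum_{i=1}^N\Big(3\cosh a\hbar+\cosh(a\hbar)\,\sigma_3^i\sigma_3^{i+1}+2\sigma_+^i\sigma_-^{i+1}+2\sigma_-^i\sigma_+^{i+1}\Big)$$ with the twisted boundary conditions $\sigma_3^{N+1}=\sigma_3^1$, $\sigma_\pm^{N+1}=e^{\mp Nb\hbar}\sigma_\pm^1$. -/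

import Mathlib

open scoped TensorProduct PowerSeries

namespace QuantumGL2

/-! ### `ℏ`-adic completions of `ℝ⟦ℏ⟧`-algebras -/

/-- The ground ring `ℝ⟦ℏ⟧` of formal power series. -/
abbrev K : Type := ℝ⟦X⟧

/-- The formal deformation parameter `ℏ`. -/
noncomputable abbrev hbar : K := PowerSeries.X

/-- Congruence modulo `ℏ ^ n`. -/
def modPow (A : Type*) [Ring A] [Algebra K A] (n : ℕ) : RingCon A where
  r x y := ∃ z : A, x - y = hbar ^ n • z
  iseqv :=
    { refl := fun x => ⟨0, by simp⟩
      symm := fun {x y} ⟨z, hz⟩ => ⟨-z, by rw [smul_neg, ← hz, neg_sub]⟩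
      trans := fun {x y w} ⟨z, hz⟩ ⟨z', hz'⟩ => ⟨z + z', by rw [smul_add, ← hz, ← hz']; abel⟩ }
  add' := fun {w x y z} ⟨u, hu⟩ ⟨v, hv⟩ => ⟨u + v, by rw [smul_add, ← hu, ← hv]; abel⟩
  mul' := fun {w x y z} ⟨u, hu⟩ ⟨v, hv⟩ => ⟨u * y + x * v, by
    rw [smul_add, ← smul_mul_assoc, ← mul_smul_comm, ← hu, ← hv]
    noncomm_ring⟩

/-- The `ℏ`-adic completion `lim A / ℏⁿ A`, realised as the algebra of coherent sequences in
`∏ A / ℏⁿ A`: for each `n` one element of `A` represents all the components up to `n`. -/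
def hadicSubalgebra (A : Type*) [Ring A] [Algebra K A] :
    Subalgebra K (∀ n : ℕ, (modPow A n).Quotient) where
  carrier := {x | ∀ n : ℕ, ∃ a : A, ∀ m ≤ n, x m = (a : (modPow A m).Quotient)}
  add_mem' := fun {x y} hx hy n => by
    obtain ⟨a, ha⟩ := hx n
    obtain ⟨b, hb⟩ := hy n
    exact ⟨a + b, fun m hm => by rw [Pi.add_apply, ha m hm, hb m hm, RingCon.coe_add]⟩
  mul_mem' := fun {x y} hx hy n => by
    obtain ⟨a, ha⟩ := hx n
    obtain ⟨b, hb⟩ := hy n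
    exact ⟨a * b, fun m hm => by rw [Pi.mul_apply, ha m hm, hb m hm, RingCon.coe_mul]⟩
  algebraMap_mem' := fun c n => ⟨algebraMap K A c, fun m _ => rfl⟩

/-- The `ℏ`-adic completion of a `K`-algebra. -/
abbrev HAdic (A : Type*) [Ring A] [Algebra K A] : Type _ := hadicSubalgebra A

namespace HAdic

variable {A B P Q : Type*} [Ring A] [Algebra K A] [Ring B] [Algebra K B]
  [Ring P] [Algebra K P] [Ring Q] [Algebra K Q]

/-- The canonical map from an algebra to its completion. -/
noncomputable def of : A →ₐ[K] HAdic A where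
  toFun a := ⟨fun _ => a, fun _ => ⟨a, fun _ _ => rfl⟩⟩
  map_one' := rfl
  map_mul' _ _ := rfl
  map_zero' := rfl
  map_add' _ _ := rfl
  commutes' _ := rfl

theorem apply_hbar_pow_smul (n : ℕ) (x : HAdic B) : (hbar ^ n • x).1 n = 0 := by
  obtain ⟨b, hb⟩ := x.2 n
  change hbar ^ n • x.1 n = 0
  rw [hb n le_rfl, ← RingCon.coe_smul, ← RingCon.coe_zero, RingCon.eq]
  exact ⟨b, by simp⟩

/-- The map induced modulo `ℏ ^ n` by a linear map. -/
noncomputable def levelFun (f : A →ₗ[K] HAdic B) (n : ℕ) :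
    (modPow A n).Quotient → (modPow B n).Quotient :=
  Quotient.lift (fun a => (f a).1 n) (by
    rintro x y ⟨z, hz⟩
    have h : f x = f y + hbar ^ n • f z := by
      rw [← map_smul, ← hz, map_sub]; abel
    change (f x).1 n = (f y).1 n
    rw [h]
    change (f y).1 n + (hbar ^ n • f z).1 n = _
    rw [apply_hbar_pow_smul, add_zero])

/-- The unique extension to the completion of a linear map into a complete target. -/
noncomputable def extend (f : A →ₗ[K] HAdic B) : HAdic A →ₗ[K] HAdic B where
  toFun x := ⟨fun n => levelFun f n (x.1 n), fun n => by
    obtain ⟨a, ha⟩ := x.2 n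
    obtain ⟨b, hb⟩ := (f a).2 n
    exact ⟨b, fun m hm => by beta_reduce; rw [ha m hm, ← hb m hm]; rfl⟩⟩
  map_add' x y := by
    ext n
    obtain ⟨a, ha⟩ := x.2 n
    obtain ⟨b, hb⟩ := y.2 n
    change levelFun f n (x.1 n + y.1 n) = levelFun f n (x.1 n) + levelFun f n (y.1 n)
    rw [ha n le_rfl, hb n le_rfl, ← RingCon.coe_add]
    change (f (a + b)).1 n = (f a).1 n + (f b).1 n
    rw [map_add]; rfl
  map_smul' c x := by
    ext n
    obtain ⟨a, ha⟩ := x.2 n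
    change levelFun f n (c • x.1 n) = c • levelFun f n (x.1 n)
    rw [ha n le_rfl, ← RingCon.coe_smul]
    change (f (c • a)).1 n = c • (f a).1 n
    rw [map_smul]; rfl

/-- Functoriality of the completion for linear maps. -/
noncomputable def map (f : A →ₗ[K] B) : HAdic A →ₗ[K] HAdic B :=
  extend (of.toLinearMap ∘ₗ f)

/-- The product `x ⊗ y` of elements of two completions, modulo `ℏ ^ n`. -/
noncomputable def tmulLevel (n : ℕ) :
    (modPow P n).Quotient → (modPow Q n).Quotient → (modPow (P ⊗[K] Q) n).Quotient :=
  Quotient.lift₂ (fun p q => ((p ⊗ₜ[K] q : P ⊗[K] Q) : (modPow (P ⊗[K] Q) n).Quotient)) (by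
    rintro p q p' q' ⟨u, hu⟩ ⟨v, hv⟩
    refine (RingCon.eq _).2 ⟨u ⊗ₜ q + p' ⊗ₜ v, ?_⟩
    rw [smul_add, TensorProduct.smul_tmul', ← TensorProduct.tmul_smul, ← hu, ← hv,
      TensorProduct.sub_tmul, TensorProduct.tmul_sub]
    abel)

/-- The bilinear map `(x, y) ↦ x ⊗ y` on completions. -/
noncomputable def tmul : HAdic P →ₗ[K] HAdic Q →ₗ[K] HAdic (P ⊗[K] Q) :=
  LinearMap.mk₂ K
    (fun x y => ⟨fun n => tmulLevel n (x.1 n) (y.1 n), fun n => by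
      obtain ⟨p, hp⟩ := x.2 n
      obtain ⟨q, hq⟩ := y.2 n
      exact ⟨p ⊗ₜ q, fun m hm => by beta_reduce; rw [hp m hm, hq m hm]; rfl⟩⟩)
    (fun x x' y => by
      ext n
      obtain ⟨p, hp⟩ := x.2 n
      obtain ⟨p', hp'⟩ := x'.2 n
      obtain ⟨q, hq⟩ := y.2 n
      change tmulLevel n (x.1 n + x'.1 n) (y.1 n) =
        tmulLevel n (x.1 n) (y.1 n) + tmulLevel n (x'.1 n) (y.1 n)
      rw [hp n le_rfl, hp' n le_rfl, hq n le_rfl]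
      exact congrArg _ (TensorProduct.add_tmul p p' q))
    (fun c x y => by
      ext n
      obtain ⟨p, hp⟩ := x.2 n
      obtain ⟨q, hq⟩ := y.2 n
      change tmulLevel n (c • x.1 n) (y.1 n) = c • tmulLevel n (x.1 n) (y.1 n)
      rw [hp n le_rfl, hq n le_rfl]
      exact congrArg _ (TensorProduct.smul_tmul' c p q).symm)
    (fun x y y' => by
      ext n
      obtain ⟨p, hp⟩ := x.2 n
      obtain ⟨q, hq⟩ := y.2 n
      obtain ⟨q', hq'⟩ := y'.2 n
      change tmulLevel n (x.1 n) (y.1 n + y'.1 n) =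
        tmulLevel n (x.1 n) (y.1 n) + tmulLevel n (x.1 n) (y'.1 n)
      rw [hp n le_rfl, hq n le_rfl, hq' n le_rfl]
      exact congrArg _ (TensorProduct.tmul_add p q q'))
    (fun c x y => by
      ext n
      obtain ⟨p, hp⟩ := x.2 n
      obtain ⟨q, hq⟩ := y.2 n
      change tmulLevel n (x.1 n) (c • y.1 n) = c • tmulLevel n (x.1 n) (y.1 n)
      rw [hp n le_rfl, hq n le_rfl]
      exact congrArg _ (TensorProduct.tmul_smul c p q))

/-- The completed tensor product `f ⊗ g` of two linear maps with complete targets. -/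
noncomputable def tensorMap (f : A →ₗ[K] HAdic P) (g : B →ₗ[K] HAdic Q) :
    HAdic (A ⊗[K] B) →ₗ[K] HAdic (P ⊗[K] Q) :=
  extend (TensorProduct.lift (tmul.compl₁₂ f g))

/-- The convergent sum `∑ ℏⁿ cₙ`. -/
noncomputable def hsum (c : ℕ → A) : HAdic A :=
  ⟨fun n => ((∑ i ∈ Finset.range n, hbar ^ i • c i : A) : (modPow A n).Quotient), fun n =>
    ⟨∑ i ∈ Finset.range n, hbar ^ i • c i, fun m hm => by
      obtain ⟨k, rfl⟩ := Nat.exists_eq_add_of_le hm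
      refine Eq.symm ((RingCon.eq _).2 ⟨∑ i ∈ Finset.range k, hbar ^ i • c (m + i), ?_⟩)
      rw [Finset.sum_range_add, add_sub_cancel_left, Finset.smul_sum]
      exact Finset.sum_congr rfl fun i _ => by rw [pow_add, mul_smul]⟩⟩

/-- The exponential `exp (ℏ x)` in the completion. -/
noncomputable def hexp (x : A) : HAdic A :=
  hsum fun n => PowerSeries.C ((n.factorial : ℝ)⁻¹) • x ^ n

end HAdic

/-! ### Topological Hopf algebras and quantization of Lie bialgebras -/

/-- A topological (`ℏ`-adic) Hopf algebra structure on a `K`-algebra `U`: the coproduct takes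
values in the completed tensor square. -/
structure HAdicHopf (U : Type*) [Ring U] [Algebra K U] where
  comul : U →ₐ[K] HAdic (U ⊗[K] U)
  counit : U →ₐ[K] K
  antipode : U →ₗ[K] U
  coassoc : ∀ x : U,
    HAdic.map (TensorProduct.assoc K U U U).toLinearMap
        (HAdic.tensorMap comul.toLinearMap HAdic.of.toLinearMap (comul x)) =
      HAdic.tensorMap HAdic.of.toLinearMap comul.toLinearMap (comul x)
  counit_left : ∀ x : U,
    HAdic.map ((TensorProduct.lid K U).toLinearMap ∘ₗ
      TensorProduct.map counit.toLinearMap LinearMap.id) (comul x) = HAdic.of x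
  counit_right : ∀ x : U,
    HAdic.map ((TensorProduct.rid K U).toLinearMap ∘ₗ
      TensorProduct.map LinearMap.id counit.toLinearMap) (comul x) = HAdic.of x
  antipode_left : ∀ x : U,
    HAdic.map (LinearMap.mul' K U ∘ₗ TensorProduct.map antipode LinearMap.id) (comul x) =
      HAdic.of (algebraMap K U (counit x))
  antipode_right : ∀ x : U,
    HAdic.map (LinearMap.mul' K U ∘ₗ TensorProduct.map LinearMap.id antipode) (comul x) =
      HAdic.of (algebraMap K U (counit x))

/-- The bracket on the dual space of `g` dual to `δ : g → g ⊗ g`. -/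
noncomputable def dualBracket {g : Type*} [AddCommGroup g] [Module ℝ g] (δ : g →ₗ[ℝ] g ⊗[ℝ] g)
    (φ ψ : Module.Dual ℝ g) : Module.Dual ℝ g :=
  TensorProduct.dualDistrib ℝ g g (φ ⊗ₜ[ℝ] ψ) ∘ₗ δ

/-- `(g, δ)` is a Lie bialgebra: `δ` is a 1-cocycle and the dual map is a Lie bracket. -/
structure IsLieBialgebra {g : Type*} [LieRing g] [LieAlgebra ℝ g]
    (δ : g →ₗ[ℝ] g ⊗[ℝ] g) : Prop where
  cocycle : ∀ x y : g, δ ⁅x, y⁆ = ⁅x, δ y⁆ - ⁅y, δ x⁆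
  dual_self : ∀ φ, dualBracket δ φ φ = 0
  dual_jacobi : ∀ φ ψ χ, dualBracket δ φ (dualBracket δ ψ χ) +
    dualBracket δ ψ (dualBracket δ χ φ) + dualBracket δ χ (dualBracket δ φ ψ) = 0

/-- The topological Hopf algebra `(U, H)` is a quantization of the Lie bialgebra `(g, δ)`, with
`π : U → U(g)` the classical limit: `U` is a topologically free `K`-module (complete, separated
and torsion free), `π` induces an isomorphism of Hopf algebras `U / ℏ U ≅ U(g)` (the elements of
`g` being primitive), and `δ(x) = ℏ⁻¹ (Δ(u) - Δᵒᵖ(u)) mod ℏ` for any lift `u` of `x ∈ g`. -/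
structure IsQuantization {U : Type*} [Ring U] [Algebra K U] (H : HAdicHopf U)
    {g : Type*} [LieRing g] [LieAlgebra ℝ g] (δ : g →ₗ[ℝ] g ⊗[ℝ] g)
    (π : U →+* UniversalEnvelopingAlgebra ℝ g) : Prop where
  complete : IsAdicComplete (Ideal.span {hbar}) U
  torsion_free : ∀ u : U, hbar • u = 0 → u = 0
  map_scalar : ∀ c : K, π (algebraMap K U c) =
    algebraMap ℝ (UniversalEnvelopingAlgebra ℝ g) (PowerSeries.constantCoeff c)
  surjective : Function.Surjective π
  ker : ∀ u : U, π u = 0 ↔ ∃ v : U, u = hbar • v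
  comul_mod : ∀ (x : g) (u : U), π u = UniversalEnvelopingAlgebra.ι ℝ x →
    ∃ t, H.comul u = HAdic.of (u ⊗ₜ 1 + 1 ⊗ₜ u) + hbar • t
  counit_mod : ∀ (x : g) (u : U), π u = UniversalEnvelopingAlgebra.ι ℝ x →
    ∃ c : K, H.counit u = hbar * c
  semiclassical : ∀ (x : g) (u : U) (n : ℕ) (y z : Fin n → g) (v w : Fin n → U),
    π u = UniversalEnvelopingAlgebra.ι ℝ x →
    (∀ i, π (v i) = UniversalEnvelopingAlgebra.ι ℝ (y i)) →
    (∀ i, π (w i) = UniversalEnvelopingAlgebra.ι ℝ (z i)) →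
    δ x = ∑ i, y i ⊗ₜ[ℝ] z i →
    ∃ t, H.comul u - HAdic.map (TensorProduct.comm K U U).toLinearMap (H.comul u) =
      hbar • HAdic.of (∑ i, v i ⊗ₜ[K] w i) + hbar ^ 2 • t

/-- `F` is a (Drinfeld) twist for the topological Hopf algebra `(U, H)`. -/
structure IsTwist {U : Type*} [Ring U] [Algebra K U] (H : HAdicHopf U)
    (F : HAdic (U ⊗[K] U)) : Prop where
  isUnit : IsUnit F
  cocycle : HAdic.map (TensorProduct.assoc K U U U).toLinearMap
      (HAdic.tmul F (1 : HAdic U) *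
        HAdic.tensorMap H.comul.toLinearMap HAdic.of.toLinearMap F) =
    HAdic.tmul (1 : HAdic U) F * HAdic.tensorMap HAdic.of.toLinearMap H.comul.toLinearMap F
  counit_left : HAdic.map ((TensorProduct.lid K U).toLinearMap ∘ₗ
      TensorProduct.map H.counit.toLinearMap LinearMap.id) F = 1
  counit_right : HAdic.map ((TensorProduct.rid K U).toLinearMap ∘ₗ
      TensorProduct.map LinearMap.id H.counit.toLinearMap) F = 1

/-! ### The Lie algebra `gl(2)` and its standard family II bialgebra structures -/

/-- The Lie algebra `gl(2)` over `ℝ`, with the commutator bracket. -/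
abbrev Gl2 : Type := Matrix (Fin 2) (Fin 2) ℝ

instance instLieRingGl2 : LieRing Gl2 := LieRing.ofAssociativeRing

instance instLieAlgebraGl2 : LieAlgebra ℝ Gl2 := LieAlgebra.ofAssociativeAlgebra

/-- Names of the four generators. -/
inductive Gen : Type
  | J3 | Jp | Jm | I

/-- The basis `J₃, J₊, J₋, I` as `2 × 2` matrices with entries in any commutative ring. -/
def Gen.mat (R : Type*) [CommRing R] : Gen → Matrix (Fin 2) (Fin 2) R
  | J3 => !![1, 0; 0, -1]
  | Jp => !![0, 1; 0, 0]
  | Jm => !![0, 0; 1, 0]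
  | I => 1

/-- `x ∧ y = x ⊗ y - y ⊗ x`. -/
def wedge {R M : Type*} [CommRing R] [AddCommGroup M] [Module R M] (x y : M) : M ⊗[R] M :=
  x ⊗ₜ y - y ⊗ₜ x

/-- The cocommutator `δ(J₃) = δ(I) = 0`, `δ(J₊) = a J₃ ∧ J₊ + b J₊ ∧ I`,
`δ(J₋) = a J₃ ∧ J₋ - b J₋ ∧ I`, extended linearly. -/
noncomputable def cocomm (a b : ℝ) : Gl2 →ₗ[ℝ] Gl2 ⊗[ℝ] Gl2 :=
  (Matrix.entryLinearMap ℝ ℝ 0 1).smulRight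
      (a • wedge (Gen.mat ℝ .J3) (Gen.mat ℝ .Jp) + b • wedge (Gen.mat ℝ .Jp) (Gen.mat ℝ .I)) +
    (Matrix.entryLinearMap ℝ ℝ 1 0).smulRight
      (a • wedge (Gen.mat ℝ .J3) (Gen.mat ℝ .Jm) - b • wedge (Gen.mat ℝ .Jm) (Gen.mat ℝ .I))

/-- The classical `r`-matrix `r = -½ b J₃ ∧ I - a J₊ ∧ J₋`. -/
noncomputable def rMatrix (a b : ℝ) : Gl2 ⊗[ℝ] Gl2 :=
  -(b / 2) • wedge (Gen.mat ℝ .J3) (Gen.mat ℝ .I) - a • wedge (Gen.mat ℝ .Jp) (Gen.mat ℝ .Jm)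

/-- The Schouten bracket `[[r, r]] = [r₁₂, r₁₃] + [r₁₂, r₂₃] + [r₁₃, r₂₃]` of `r ∈ gl(2) ⊗ gl(2)`,
computed with commutators in the associative algebra `M₂(ℝ) ⊗ M₂(ℝ) ⊗ M₂(ℝ)`. -/
noncomputable def schouten (r : Gl2 ⊗[ℝ] Gl2) : Gl2 ⊗[ℝ] (Gl2 ⊗[ℝ] Gl2) :=
  let r12 := TensorProduct.assoc ℝ Gl2 Gl2 Gl2 (r ⊗ₜ[ℝ] 1)
  let r23 := (1 : Gl2) ⊗ₜ[ℝ] r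
  let r13 := TensorProduct.leftComm ℝ Gl2 Gl2 Gl2 r23
  (r12 * r13 - r13 * r12) + (r12 * r23 - r23 * r12) + (r13 * r23 - r23 * r13)

/-! ### The algebra of `U_{a,b}(gl(2))` -/

/-- Power series in a central variable `ℏ` with coefficients in the free algebra
`ℝ⟨J₃, J₊, J₋, I⟩`. -/
abbrev FreeSeries : Type := (FreeAlgebra ℝ Gen)⟦X⟧

noncomputable instance instAlgebraFreeSeries : Algebra K FreeSeries :=
  RingHom.toAlgebra' (PowerSeries.map (algebraMap ℝ (FreeAlgebra ℝ Gen))) fun c x => by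
    ext n
    rw [PowerSeries.coeff_mul, PowerSeries.coeff_mul, ← Finset.Nat.sum_antidiagonal_swap]
    exact Finset.sum_congr rfl fun p _ => by
      simp only [PowerSeries.coeff_map, Prod.fst_swap, Prod.snd_swap]
      exact Algebra.commutes _ _

/-- `exp (ℏ x)`. -/
noncomputable def expSeries {B : Type*} [Ring B] [Algebra ℝ B] (x : B) : B⟦X⟧ :=
  PowerSeries.mk fun n => (n.factorial : ℝ)⁻¹ • x ^ n

/-- `cosh (c ℏ)`. -/
noncomputable def coshSeries (c : ℝ) : K :=
  PowerSeries.mk fun n => if Even n then (n.factorial : ℝ)⁻¹ * c ^ n else 0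

/-- `sinh (c ℏ)`. -/
noncomputable def sinhSeries (c : ℝ) : K :=
  PowerSeries.mk fun n => if Even n then 0 else (n.factorial : ℝ)⁻¹ * c ^ n

/-- `sinh (c ℏ x) / (c ℏ) = ∑ (c ℏ)ⁿ xⁿ⁺¹ / (n + 1)!`, the sum over even `n`. -/
noncomputable def sinhDiv {B : Type*} [Ring B] [Algebra ℝ B] (c : ℝ) (x : B) : B⟦X⟧ :=
  PowerSeries.mk fun n =>
    if Even n then (((n + 1).factorial : ℝ)⁻¹ * c ^ n) • x ^ (n + 1) else 0

/-- A generator of the free algebra. -/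
noncomputable abbrev fgen (g : Gen) : FreeAlgebra ℝ Gen := FreeAlgebra.ι ℝ g

/-- A generator as a constant power series. -/
noncomputable abbrev sgen (g : Gen) : FreeSeries := PowerSeries.C (fgen g)

/-- The commutation rules `[J₃, J₊] = 2 J₊`, `[J₃, J₋] = -2 J₋`,
`[J₊, J₋] = sinh (aℏ J₃) / (aℏ)`, `[I, ·] = 0`, in the form `lhs - rhs`. -/
def relations (a : ℝ) : Set FreeSeries :=
  {sgen .J3 * sgen .Jp - sgen .Jp * sgen .J3 - 2 * sgen .Jp,
    sgen .J3 * sgen .Jm - sgen .Jm * sgen .J3 + 2 * sgen .Jm,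
    sgen .Jp * sgen .Jm - sgen .Jm * sgen .Jp - sinhDiv a (fgen .J3)} ∪
  Set.range fun g => sgen .I * sgen g - sgen g * sgen .I

/-- Congruence modulo the `ℏ`-adic closure of a two-sided ideal. -/
def closureCon {A : Type*} [Ring A] [Algebra K A] (I : TwoSidedIdeal A) : RingCon A where
  r x y := ∀ n : ℕ, ∃ z : A, x - y - hbar ^ n • z ∈ I
  iseqv :=
    { refl := fun x n => ⟨0, by simp [I.zero_mem]⟩
      symm := fun {x y} h n => by
        obtain ⟨z, hz⟩ := h n
        refine ⟨-z, ?_⟩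
        have := I.neg_mem hz
        rwa [show -(x - y - hbar ^ n • z) = y - x - hbar ^ n • (-z) by
          rw [smul_neg]; abel] at this
      trans := fun {x y w} h h' n => by
        obtain ⟨z, hz⟩ := h n
        obtain ⟨z', hz'⟩ := h' n
        refine ⟨z + z', ?_⟩
        have := I.add_mem hz hz'
        rwa [show x - y - hbar ^ n • z + (y - w - hbar ^ n • z') =
          x - w - hbar ^ n • (z + z') by rw [smul_add]; abel] at this }
  add' := fun {w x y z} h h' n => by
    obtain ⟨u, hu⟩ := h n
    obtain ⟨v, hv⟩ := h' n
    refine ⟨u + v, ?_⟩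
    have := I.add_mem hu hv
    rwa [show w - x - hbar ^ n • u + (y - z - hbar ^ n • v) =
      w + y - (x + z) - hbar ^ n • (u + v) by rw [smul_add]; abel] at this
  mul' := fun {w x y z} h h' n => by
    obtain ⟨u, hu⟩ := h n
    obtain ⟨v, hv⟩ := h' n
    refine ⟨u * y + x * v, ?_⟩
    have := I.add_mem (I.mul_mem_right _ y hu) (I.mul_mem_left x _ hv)
    rwa [show (w - x - hbar ^ n • u) * y + x * (y - z - hbar ^ n • v) =
      w * y - x * z - hbar ^ n • (u * y + x * v) by
        rw [smul_add, ← smul_mul_assoc, ← mul_smul_comm]; noncomm_ring] at this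

/-- The algebra underlying `U_{a,b}(gl(2))`: the `ℝ⟦ℏ⟧`-algebra topologically generated by
`J₃, J₊, J₋, I` subject to the commutation rules (which do not involve `b`). -/
abbrev UqGl2 (a : ℝ) : Type := (closureCon (TwoSidedIdeal.span (relations a))).Quotient

/-- The class in `UqGl2 a` of a power series. -/
noncomputable def UqGl2.mk (a : ℝ) : FreeSeries →ₐ[K] UqGl2 a :=
  (closureCon (TwoSidedIdeal.span (relations a))).mkₐ (α := K)

/-- The generators of `UqGl2 a`. -/
noncomputable def UqGl2.gen (a : ℝ) (g : Gen) : UqGl2 a := UqGl2.mk a (sgen g)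

/-- The group-like element `exp (ℏ (s J₃ + t I) / 2)`. -/
noncomputable def UqGl2.cartanExp (a s t : ℝ) : UqGl2 a :=
  UqGl2.mk a (expSeries ((1 / 2 : ℝ) • (s • fgen .J3 + t • fgen .I)))

/-- The deformed Casimir
`cosh(aℏ) (sinh(aℏ J₃ / 2) / (aℏ / 2))² + 2 (sinh(aℏ) / (aℏ)) (J₊ J₋ + J₋ J₊)`. -/
noncomputable def casimir (a : ℝ) : UqGl2 a :=
  coshSeries a • UqGl2.mk a (sinhDiv (a / 2) (fgen .J3)) ^ 2 +
    (2 * sinhDiv a (1 : ℝ) : K) •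
      (UqGl2.gen a .Jp * UqGl2.gen a .Jm + UqGl2.gen a .Jm * UqGl2.gen a .Jp)

/-- The Hopf structure `H` has the coproduct of `U_{a,b}(gl(2))` and the trivial counit. -/
structure IsUab (a b : ℝ) (H : HAdicHopf (UqGl2 a)) : Prop where
  comul_I : H.comul (UqGl2.gen a .I) =
    HAdic.of (1 ⊗ₜ UqGl2.gen a .I + UqGl2.gen a .I ⊗ₜ 1)
  comul_J3 : H.comul (UqGl2.gen a .J3) =
    HAdic.of (1 ⊗ₜ UqGl2.gen a .J3 + UqGl2.gen a .J3 ⊗ₜ 1)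
  comul_Jp : H.comul (UqGl2.gen a .Jp) =
    HAdic.of (UqGl2.cartanExp a a (-b) ⊗ₜ UqGl2.gen a .Jp +
      UqGl2.gen a .Jp ⊗ₜ UqGl2.cartanExp a (-a) b)
  comul_Jm : H.comul (UqGl2.gen a .Jm) =
    HAdic.of (UqGl2.cartanExp a a b ⊗ₜ UqGl2.gen a .Jm +
      UqGl2.gen a .Jm ⊗ₜ UqGl2.cartanExp a (-a) (-b))
  counit_gen : ∀ g : Gen, H.counit (UqGl2.gen a g) = 0

/-- The Reshetikhin twist element `exp ((bℏ / 4) J₃ ∧ I)`. -/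
noncomputable def twistElement (a b : ℝ) : HAdic (UqGl2 a ⊗[K] UqGl2 a) :=
  HAdic.hexp ((PowerSeries.C (b / 4) : K) •
    (wedge (UqGl2.gen a .J3) (UqGl2.gen a .I) : UqGl2 a ⊗[K] UqGl2 a))

/-! ### Spin chains -/

/-- `2 × 2` matrices over `ℝ⟦ℏ⟧`. -/
abbrev M2 : Type := Matrix (Fin 2) (Fin 2) K

/-- Operators on a spin-½ chain of `n` sites. -/
abbrev ChainOp (n : ℕ) : Type := Matrix (Fin n → Fin 2) (Fin n → Fin 2) K

/-- The fundamental representation: `D(J₃) = σ₃`, `D(I) = 1`, `D(J₊) = cosh(aℏ/2) σ₊`,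
`D(J₋) = (sinh(aℏ/2) / (aℏ/2)) σ₋`. -/
structure IsFundamental (a : ℝ) (D : UqGl2 a →ₐ[K] M2) : Prop where
  map_J3 : D (UqGl2.gen a .J3) = Gen.mat K .J3
  map_I : D (UqGl2.gen a .I) = 1
  map_Jp : D (UqGl2.gen a .Jp) = coshSeries (a / 2) • Gen.mat K .Jp
  map_Jm : D (UqGl2.gen a .Jm) = sinhDiv (a / 2) (1 : ℝ) • Gen.mat K .Jm

/-- The operator acting as `A` on the site `i` and trivially elsewhere. -/
noncomputable def siteOp {n : ℕ} (i : Fin n) : M2 →ₗ[K] ChainOp n where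
  toFun A := Matrix.of fun s t => if ∀ j, j ≠ i → s j = t j then A (s i) (t i) else 0
  map_add' A B := by
    ext1 s t
    simp only [Matrix.of_apply, Matrix.add_apply]
    split_ifs <;> simp
  map_smul' c A := by
    ext1 s t
    simp only [Matrix.of_apply, Matrix.smul_apply, RingHom.id_apply]
    split_ifs <;> simp

/-- The two-site operator `A ⊗ B` placed as `A` on the site `i` and `B` on the site `j`. -/
noncomputable def bondOp {n : ℕ} (i j : Fin n) : M2 ⊗[K] M2 →ₗ[K] ChainOp n :=
  TensorProduct.lift ((LinearMap.mul K (ChainOp n)).compl₁₂ (siteOp i) (siteOp j))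

/-- The identification of an operator `A ⊗ B` on `n` sites and a last one with an operator on
`n + 1` sites. -/
noncomputable def appendSite (n : ℕ) : ChainOp n ⊗[K] M2 →ₗ[K] ChainOp (n + 1) :=
  TensorProduct.lift (LinearMap.mk₂ K
    (fun A B => Matrix.of fun s t =>
      A (fun i => s i.castSucc) (fun i => t i.castSucc) * B (s (Fin.last n)) (t (Fin.last n)))
    (fun A A' B => by ext s t; simp [add_mul])
    (fun c A B => by ext s t; simp [mul_assoc])
    (fun A B B' => by ext s t; simp [mul_add])
    (fun c A B => by ext s t; simp [mul_left_comm]))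

/-- `ρ n` is the representation of `(U, H)` on a chain of `n` sites carrying the representation
`D`, that is `D ⊗ ⋯ ⊗ D` composed with the `n`-th iterated coproduct. -/
structure IsChainRep {a : ℝ} (H : HAdicHopf (UqGl2 a)) (D : UqGl2 a →ₐ[K] M2)
    (ρ : ∀ n : ℕ, UqGl2 a →ₐ[K] ChainOp n) : Prop where
  zero : ∀ x, ρ 0 x = algebraMap K (ChainOp 0) (H.counit x)
  succ : ∀ n x, HAdic.of (ρ (n + 1) x) =
    HAdic.map (appendSite n ∘ₗ TensorProduct.map (ρ n).toLinearMap D.toLinearMap) (H.comul x)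

/-- The two-site twisted XXZ Hamiltonian
`2 (sinh(aℏ)/(aℏ))² (3 cosh(aℏ) + cosh(aℏ) σ₃ ⊗ σ₃ + sinh(aℏ) (σ₃ ⊗ 1 - 1 ⊗ σ₃)
  + 2 e^{bℏ} σ₊ ⊗ σ₋ + 2 e^{-bℏ} σ₋ ⊗ σ₊)`. -/
noncomputable def xxzBond (a b : ℝ) : M2 ⊗[K] M2 :=
  (2 * sinhDiv a (1 : ℝ) ^ 2 : K) •
    ((3 * coshSeries a) • (1 ⊗ₜ[K] 1) +
      coshSeries a • (Gen.mat K .J3 ⊗ₜ[K] Gen.mat K .J3) +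
      sinhSeries a • (Gen.mat K .J3 ⊗ₜ[K] 1 - 1 ⊗ₜ[K] Gen.mat K .J3) +
      (2 * expSeries b) • (Gen.mat K .Jp ⊗ₜ[K] Gen.mat K .Jm) +
      (2 * expSeries (-b)) • (Gen.mat K .Jm ⊗ₜ[K] Gen.mat K .Jp))

/-- The open chain `∑_{i=1}^{N} h_{i,i+1}` on `N + 1` sites with two-site Hamiltonian `h`. -/
noncomputable def openChain (N : ℕ) (h : M2 ⊗[K] M2) : ChainOp (N + 1) :=
  ∑ i : Fin N, bondOp i.castSucc i.succ h

/-- The periodic chain `∑_{i=1}^{N} h_{i,i+1}`, site `N + 1` being site `1`, for `N = n + 2`. -/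
noncomputable def periodicChain (n : ℕ) (h : M2 ⊗[K] M2) : ChainOp (n + 2) :=
  ∑ i : Fin (n + 2), bondOp i (i + 1) h

/-- The XXZ Heisenberg Hamiltonian with `N = n + 2` sites and anisotropy `cosh(aℏ)`,
`2 (sinh(aℏ)/(aℏ))² ∑_{i=1}^{N} (3 cosh(aℏ) + cosh(aℏ) σ₃ⁱ σ₃ⁱ⁺¹ + 2 σ₊ⁱ σ₋ⁱ⁺¹ + 2 σ₋ⁱ σ₊ⁱ⁺¹)`,
with the twisted boundary conditions `σ₃ᴺ⁺¹ = σ₃¹`, `σ_±ᴺ⁺¹ = exp (∓ φℏ) σ_±¹`. -/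
noncomputable def twistedXXZ (n : ℕ) (a φ : ℝ) : ChainOp (n + 2) :=
  ∑ i : Fin (n + 2), (2 * sinhDiv a (1 : ℝ) ^ 2 : K) •
    ((3 * coshSeries a) • (1 : ChainOp (n + 2)) +
      coshSeries a • (siteOp i (Gen.mat K .J3) * siteOp (i + 1) (Gen.mat K .J3)) +
      (2 * if i = Fin.last (n + 1) then expSeries φ else 1 : K) •
        (siteOp i (Gen.mat K .Jp) * siteOp (i + 1) (Gen.mat K .Jm)) +
      (2 * if i = Fin.last (n + 1) then expSeries (-φ) else 1 : K) •
        (siteOp i (Gen.mat K .Jm) * siteOp (i + 1) (Gen.mat K .Jp)))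

end QuantumGL2

open QuantumGL2

/-! Two principles carry the argument: automatic continuity and a universal property. A `K`-linear
map commutes with multiplication by `ℏⁿ`, so between complete modules it preserves convergent sums
(`map_hlim`). Identities in a completed tensor product may therefore be checked on pure tensors
(`HAdic.hom_ext_tensor`), and a homomorphism from `U` to a complete algebra amounts to four elements
satisfying the relations (`UqGl2.lift`, `UqGl2.algHom_ext`). The coproduct, the counit, the antipode
(with values in the opposite algebra), the classical limit, the spin-½ representation and the
faithful representation below all arise in this way.

The Hopf structure comes from one computation, `IsRep.coprod`: if `u` and `v` are commuting families
satisfying the relations, then so is the family given by the coproduct formulas. Coassociativity is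
the associativity of this operation on commuting families (`coprodGen_assoc`). The antipode axiom is
multiplicative, so it too reduces to generators, and uniqueness is the usual convolution-inverse
argument.

The quotients `sinh(aℏx)/(aℏ)` are handled by multiplying with `2aℏ`, which turns them into
differences of exponentials. Dividing back requires that `U` and its completed tensor square have no
torsion. This is the Poincaré-Birkhoff-Witt step. `U` acts on functions modelled on symbols `J₋ⁱ
f(J₃, I) J₊ˡ`; ordered monomials span `U` modulo `ℏ`, and their symbols are independent modulo `ℏ`.
An element with zero symbol is thus infinitely divisible by `ℏ`, hence zero
(`UqGl2.symb_injective`), and `U` embeds in a torsion-free module.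

Modulo `ℏ` the relations become those of `gl(2)`, and the universal properties of `U` and of
`U(gl(2))` give mutually inverse maps. Expanding the coproduct to first order and antisymmetrising
gives `δ`. Classically, `δ` is the coboundary of `r`, and the Schouten bracket of `r` is `a² J₃ ∧ J₊
∧ J₋`.

The Casimir, written with exponentials, commutes with `J₊` and `J₋` by a purely algebraic exchange
identity (`commute_of_exchange`). Conjugating by the twist multiplies an element of given
`J₃`-weight in one tensor factor by an exponential of `I` in the other, which is exactly how `b`
enters the coproduct.

For the open chain, the last bond is the image of `1 ⊗ Δ(C)`. Coassociativity turns its commutation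
with the symmetry into the fact that `1 ⊗ C` commutes with `Δ(x)`. The closed chain is treated by a
diagonal gauge transformation: it moves the phases `e^{±bℏ}` of all bonds to the boundary, while the
boundary terms `σ₃ⁱ - σ₃ⁱ⁺¹` telescope around the ring. -/

namespace QuantumGL2

/-! ### `ℏ`-adically complete modules -/

/-- `ℏ`-adically separated and complete `K`-modules. -/
class HComplete (M : Type*) [AddCommGroup M] [Module K M] : Prop where
  sep : ∀ x : M, (∀ n : ℕ, ∃ z : M, x = hbar ^ n • z) → x = 0
  compl : ∀ c : ℕ → M, ∃ s : M, ∀ n : ℕ, ∃ z : M,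
    s = ∑ i ∈ Finset.range n, hbar ^ i • c i + hbar ^ n • z

section HComplete

variable {M N : Type*} [AddCommGroup M] [Module K M] [AddCommGroup N] [Module K N]

theorem eq_of_sub_mem [HComplete M] {x y : M} (h : ∀ n : ℕ, ∃ z : M, x - y = hbar ^ n • z) :
    x = y :=
  sub_eq_zero.1 (HComplete.sep _ h)

/-- The sum `∑ ℏⁿ cₙ` in a complete module. -/
noncomputable def hlim [HComplete M] (c : ℕ → M) : M := (HComplete.compl c).choose

theorem hlim_spec [HComplete M] (c : ℕ → M) (n : ℕ) :
    ∃ z : M, hlim c = ∑ i ∈ Finset.range n, hbar ^ i • c i + hbar ^ n • z :=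
  (HComplete.compl c).choose_spec n

theorem eq_hlim [HComplete M] {c : ℕ → M} {s : M}
    (h : ∀ n : ℕ, ∃ z : M, s = ∑ i ∈ Finset.range n, hbar ^ i • c i + hbar ^ n • z) :
    s = hlim c :=
  eq_of_sub_mem fun n => by
    obtain ⟨z, hz⟩ := h n
    obtain ⟨w, hw⟩ := hlim_spec c n
    exact ⟨z - w, by rw [hz, hw, smul_sub]; abel⟩

/-- Automatic continuity: a linear map sends the remainder `ℏⁿ z` to `ℏⁿ f z`, so no topological
hypothesis on `f` is needed. -/
theorem map_hlim [HComplete M] [HComplete N] (f : M →ₗ[K] N) (c : ℕ → M) :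
    f (hlim c) = hlim fun n => f (c n) :=
  eq_hlim fun n => by
    obtain ⟨z, hz⟩ := hlim_spec c n
    exact ⟨f z, by rw [hz]; simp⟩

theorem hlim_add [HComplete M] (c d : ℕ → M) :
    hlim (fun n => c n + d n) = hlim c + hlim d :=
  (eq_hlim fun n => by
    obtain ⟨z, hz⟩ := hlim_spec c n
    obtain ⟨w, hw⟩ := hlim_spec d n
    exact ⟨z + w, by rw [hz, hw]; simp only [smul_add, Finset.sum_add_distrib]; abel⟩).symm

theorem hlim_smul [HComplete M] (k : K) (c : ℕ → M) :
    hlim (fun n => k • c n) = k • hlim c :=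
  (map_hlim (LinearMap.lsmul K M k) c).symm

theorem hlim_sub [HComplete M] (c d : ℕ → M) :
    hlim (fun n => c n - d n) = hlim c - hlim d := by
  rw [eq_sub_iff_add_eq, ← hlim_add]; simp

theorem hlim_succ [HComplete M] (c : ℕ → M) :
    hlim c = c 0 + hbar • hlim fun n => c (n + 1) :=
  (eq_hlim fun n => by
    cases n with
    | zero => exact ⟨c 0 + hbar • hlim fun n => c (n + 1), by simp⟩
    | succ n =>
      obtain ⟨z, hz⟩ := hlim_spec (fun n => c (n + 1)) n
      refine ⟨z, ?_⟩
      rw [hz, Finset.sum_range_succ', smul_add, Finset.smul_sum]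
      simp only [smul_smul, ← pow_succ', pow_zero, one_smul]
      abel).symm

theorem hlim_single [HComplete M] (x : M) : hlim (fun n => if n = 0 then x else 0) = x :=
  (eq_hlim fun n => by
    cases n with
    | zero => exact ⟨x, by simp⟩
    | succ n => exact ⟨0, by simp⟩).symm

/-- A convergent sum in the quotient is obtained by lifting its coefficients, so only separatedness
can fail for a quotient of a complete module. -/
theorem HComplete.of_surjective [HComplete M] (f : M →ₗ[K] N) (hf : Function.Surjective f)
    (hs : ∀ x : N, (∀ n : ℕ, ∃ z : N, x = hbar ^ n • z) → x = 0) : HComplete N where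
  sep := hs
  compl c := by
    choose d hd using fun n => hf (c n)
    refine ⟨f (hlim d), fun n => ?_⟩
    obtain ⟨z, hz⟩ := hlim_spec d n
    exact ⟨f z, by rw [hz]; simp [hd]⟩

theorem hlim_spec_self [HComplete M] (c : ℕ → M) (n : ℕ) :
    hlim c = ∑ i ∈ Finset.range n, hbar ^ i • c i + hbar ^ n • hlim fun i => c (n + i) := by
  induction n with
  | zero => simp
  | succ n ih =>
    conv_lhs => rw [ih, hlim_succ]
    rw [Finset.sum_range_succ, smul_add, smul_smul, ← pow_succ]
    simp only [add_zero, add_assoc, add_comm 1]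

/-- The Cauchy product, by induction on the precision `n`: splitting off `c 0` leaves `ℏ` times a
product with shifted `c` and the same `d`, which is why `c` alone is generalised in `key`. -/
theorem hlim_mul {C : Type*} [Ring C] [Algebra K C] [HComplete C] (c d : ℕ → C) :
    hlim c * hlim d = hlim fun n => ∑ p ∈ Finset.HasAntidiagonal.antidiagonal n, c p.1 * d p.2 := by
  have key : ∀ n : ℕ, ∀ c : ℕ → C, ∃ z, hlim c * hlim d =
      ∑ i ∈ Finset.range n, hbar ^ i • ∑ p ∈ Finset.HasAntidiagonal.antidiagonal i, c p.1 * d p.2 +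
        hbar ^ n • z := by
    intro n
    induction n with
    | zero => intro c; exact ⟨hlim c * hlim d, by simp⟩
    | succ n ih =>
      intro c
      obtain ⟨z, hz⟩ := ih fun n => c (n + 1)
      refine ⟨z + c 0 * hlim fun i => d (n + 1 + i), ?_⟩
      rw [hlim_succ c, add_mul, smul_mul_assoc, hz]
      conv_lhs => rw [hlim_spec_self d (n + 1)]
      rw [mul_add, mul_smul_comm, smul_add, smul_smul, ← pow_succ', smul_add]
      have : ∀ i, ∑ p ∈ Finset.HasAntidiagonal.antidiagonal (i + 1), c p.1 * d p.2 =
          c 0 * d (i + 1) +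
            ∑ p ∈ Finset.HasAntidiagonal.antidiagonal i, c (p.1 + 1) * d p.2 := fun i => by
        rw [Finset.Nat.sum_antidiagonal_succ]
      rw [Finset.sum_range_succ' (fun i =>
        hbar ^ i • ∑ p ∈ Finset.HasAntidiagonal.antidiagonal i, c p.1 * d p.2)]
      simp only [this, smul_add, Finset.sum_add_distrib]
      rw [Finset.sum_range_succ' (fun i => hbar ^ i • d i), mul_add, Finset.mul_sum,
        Finset.smul_sum]
      simp only [smul_smul, ← pow_succ', mul_smul_comm, Finset.HasAntidiagonal.antidiagonal_zero,
        Finset.sum_singleton]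
      abel
  exact eq_hlim fun n => key n c

end HComplete

/-! ### Examples of complete modules -/

/-- The coefficient of `Xⁿ` in `∑ Xⁱ cᵢ` only involves the indices `i ≤ n`, so the formal sum is
well defined. -/
theorem exists_sum_powerSeries {R : Type*} [Ring R] (c : ℕ → R⟦X⟧) : ∃ s : R⟦X⟧, ∀ n : ℕ,
    ∃ z : R⟦X⟧, s = ∑ i ∈ Finset.range n, PowerSeries.X ^ i * c i + PowerSeries.X ^ n * z := by
  refine ⟨PowerSeries.mk fun n => ∑ i ∈ Finset.range (n + 1), PowerSeries.coeff (n - i) (c i),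
    fun n => ?_⟩
  have : (PowerSeries.X : R⟦X⟧) ^ n ∣
      PowerSeries.mk (fun n => ∑ i ∈ Finset.range (n + 1), PowerSeries.coeff (n - i) (c i)) -
        ∑ i ∈ Finset.range n, PowerSeries.X ^ i * c i := by
    rw [PowerSeries.X_pow_dvd_iff]
    intro m hm
    rw [map_sub, map_sum, PowerSeries.coeff_mk, sub_eq_zero]
    simp only [PowerSeries.coeff_X_pow_mul']
    obtain ⟨k, rfl⟩ := Nat.exists_eq_add_of_lt hm
    rw [show m + k + 1 = m + 1 + k by ring, Finset.sum_range_add _ (m + 1) k]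
    rw [Finset.sum_eq_zero (s := Finset.range k), add_zero]
    · refine Finset.sum_congr rfl fun i hi => ?_
      rw [if_pos (by simp at hi; omega)]
    · intro i _
      rw [if_neg (by omega)]
  obtain ⟨z, hz⟩ := this
  exact ⟨z, by rw [← hz]; abel⟩

theorem powerSeries_eq_zero {R : Type*} [Ring R] (x : R⟦X⟧)
    (h : ∀ n : ℕ, ∃ z, x = PowerSeries.X ^ n * z) : x = 0 := by
  ext n
  obtain ⟨z, rfl⟩ := h (n + 1)
  rw [PowerSeries.coeff_X_pow_mul']
  simp

instance : HComplete K where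
  sep x h := powerSeries_eq_zero x h
  compl c := exists_sum_powerSeries c

theorem coeff_hlim (c : ℕ → ℝ) : hlim (fun n => (PowerSeries.C (c n) : K)) = PowerSeries.mk c := by
  refine (eq_hlim fun n => ?_).symm
  have : (PowerSeries.X : K) ^ n ∣ PowerSeries.mk c -
      ∑ i ∈ Finset.range n, PowerSeries.X ^ i * PowerSeries.C (c i) := by
    rw [PowerSeries.X_pow_dvd_iff]
    intro m hm
    simp [PowerSeries.coeff_X_pow, hm]
  obtain ⟨z, hz⟩ := this
  exact ⟨z, by simp only [smul_eq_mul]; rw [← hz]; abel⟩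

theorem FreeSeries.algebraMap_eq (k : K) :
    algebraMap K FreeSeries k = PowerSeries.map (algebraMap ℝ (FreeAlgebra ℝ Gen)) k := rfl

theorem FreeSeries.hbar_pow_smul (n : ℕ) (z : FreeSeries) :
    hbar ^ n • z = PowerSeries.X ^ n * z := by
  rw [Algebra.smul_def, FreeSeries.algebraMap_eq, map_pow, PowerSeries.map_X]

instance : HComplete FreeSeries where
  sep x h := powerSeries_eq_zero x (by simpa only [FreeSeries.hbar_pow_smul] using h)
  compl c := by simpa only [FreeSeries.hbar_pow_smul] using exists_sum_powerSeries c

theorem FreeSeries.eq_hlim_coeff (F : FreeSeries) :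
    F = hlim fun n => (PowerSeries.C (PowerSeries.coeff n F) : FreeSeries) := by
  refine (eq_hlim fun n => ?_)
  have : (PowerSeries.X : FreeSeries) ^ n ∣ F -
      ∑ i ∈ Finset.range n, PowerSeries.X ^ i * PowerSeries.C (PowerSeries.coeff i F) := by
    rw [PowerSeries.X_pow_dvd_iff]
    intro m hm
    simp only [map_sub, map_sum, PowerSeries.coeff_X_pow_mul', PowerSeries.coeff_C]
    rw [Finset.sum_eq_single m]
    · simp
    · intro i _ hi
      split_ifs <;> first | rfl | omega
    · simp [hm]
  obtain ⟨z, hz⟩ := this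
  exact ⟨z, by simp only [FreeSeries.hbar_pow_smul]; rw [← hz]; abel⟩

instance {ι : Type*} {M : ι → Type*} [∀ i, AddCommGroup (M i)] [∀ i, Module K (M i)]
    [∀ i, HComplete (M i)] : HComplete (∀ i, M i) where
  sep x h := funext fun i => HComplete.sep _ fun n => by
    obtain ⟨z, hz⟩ := h n
    exact ⟨z i, by rw [hz]; rfl⟩
  compl c := by
    refine ⟨fun i => hlim fun n => c n i, fun n => ?_⟩
    choose z hz using fun i => hlim_spec (fun n => c n i) n
    exact ⟨z, funext fun i => by simp [hz i]⟩

instance {m n : Type*} [Fintype m] [Fintype n] : HComplete (Matrix m n K) :=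
  inferInstanceAs (HComplete (m → n → K))

/-- Limits are taken pointwise, and only the target has to be complete. In particular `Module.End K
(Idx → K)` is complete, so the universal property of `UqGl2` applies to the operators `regOp`. -/
instance {M N : Type*} [AddCommGroup M] [Module K M] [AddCommGroup N] [Module K N]
    [HComplete N] : HComplete (M →ₗ[K] N) where
  sep x h := LinearMap.ext fun m => HComplete.sep _ fun n => by
    obtain ⟨z, hz⟩ := h n
    exact ⟨z m, by rw [hz]; rfl⟩
  compl c := by
    let L (c : ℕ → M →ₗ[K] N) : M →ₗ[K] N :=
      { toFun := fun m => hlim fun n => c n m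
        map_add' := fun x y => by simp only [map_add, hlim_add]
        map_smul' := fun k x => by simp only [map_smul, hlim_smul, RingHom.id_apply] }
    refine ⟨L c, fun n => ⟨L fun i => c (n + i), LinearMap.ext fun m => ?_⟩⟩
    change hlim _ = _
    rw [hlim_spec_self _ n]
    simp [L]

instance {C : Type*} [Ring C] [Algebra K C] [HComplete C] : HComplete Cᵐᵒᵖ :=
  HComplete.of_surjective (MulOpposite.opLinearEquiv K (M := C)).toLinearMap
    (MulOpposite.opLinearEquiv K (M := C)).surjective fun x h => by
      apply MulOpposite.unop_injective
      refine HComplete.sep _ fun n => ?_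
      obtain ⟨z, hz⟩ := h n
      exact ⟨z.unop, by rw [hz]; rfl⟩

/-! ### The completion as a complete module -/

namespace HAdic

variable {A B P Q R C D : Type*} [Ring A] [Algebra K A] [Ring B] [Algebra K B]
  [Ring P] [Algebra K P] [Ring Q] [Algebra K Q] [Ring R] [Algebra K R] [Ring C] [Algebra K C]
  [Ring D] [Algebra K D]

theorem ext_apply {x y : HAdic A} (h : ∀ n, x.1 n = y.1 n) : x = y := Subtype.ext (funext h)

theorem of_apply (a : A) (n : ℕ) : (of a).1 n = (a : (modPow A n).Quotient) := rfl

theorem eq_zero_iff {a : A} {n : ℕ} :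
    (a : (modPow A n).Quotient) = 0 ↔ ∃ z : A, a = hbar ^ n • z := by
  rw [← RingCon.coe_zero, RingCon.eq]
  exact exists_congr fun z => by rw [sub_zero]

theorem coe_eq_iff {a b : A} {n : ℕ} :
    (a : (modPow A n).Quotient) = (b : (modPow A n).Quotient) ↔ ∃ z : A, a - b = hbar ^ n • z :=
  RingCon.eq _

theorem exists_hsum (x : HAdic A) : ∃ c : ℕ → A, x = hsum c := by
  choose a ha using x.2
  have h : ∀ n, ∃ z, a (n + 1) - a n = hbar ^ n • z := fun n => by
    rw [← coe_eq_iff, ← ha n n le_rfl, ← ha (n + 1) n (Nat.le_succ n)]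
  choose z hz using h
  -- The differences of successive representatives telescope; the first coefficient also absorbs the
  -- starting value `a 0`.
  refine ⟨fun n => if n = 0 then z 0 + a 0 else z n, ext_apply fun n => ?_⟩
  cases n with
  | zero =>
    rw [ha 0 0 le_rfl]
    exact coe_eq_iff.2 ⟨a 0, by simp⟩
  | succ n =>
    rw [ha (n + 1) (n + 1) le_rfl]
    refine congrArg _ ?_
    induction n with
    | zero => simp [← sub_eq_iff_eq_add, hz]
    | succ n ih =>
      rw [Finset.sum_range_succ, ← ih]
      simp [← hz]

theorem hsum_eq (c : ℕ → A) (n : ℕ) :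
    hsum c = of (∑ i ∈ Finset.range n, hbar ^ i • c i) + hbar ^ n • hsum fun i => c (n + i) := by
  refine ext_apply fun m => ?_
  change ((∑ i ∈ Finset.range m, hbar ^ i • c i : A) : (modPow A m).Quotient) =
    ((∑ i ∈ Finset.range n, hbar ^ i • c i + hbar ^ n •
      ∑ i ∈ Finset.range m, hbar ^ i • c (n + i) : A) : (modPow A m).Quotient)
  rw [eq_comm, coe_eq_iff]
  refine ⟨∑ i ∈ Finset.range n, hbar ^ i • c (m + i), ?_⟩
  have h1 := Finset.sum_range_add (fun i => hbar ^ i • c i) n m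
  have h2 := Finset.sum_range_add (fun i => hbar ^ i • c i) m n
  rw [add_comm m n] at h2
  simp only [Finset.smul_sum, smul_smul, ← pow_add]
  rw [← h1, h2, add_sub_cancel_left]

theorem exists_of (x : HAdic A) (n : ℕ) : ∃ a z, x = of a + hbar ^ n • z := by
  obtain ⟨c, rfl⟩ := exists_hsum x
  exact ⟨_, _, hsum_eq c n⟩

theorem exists_smul_of_apply_eq_zero {x : HAdic A} {n : ℕ} (h : x.1 n = 0) :
    ∃ z, x = hbar ^ n • z := by
  obtain ⟨a, z, rfl⟩ := exists_of x n
  have h' : (of a).1 n + (hbar ^ n • z).1 n = 0 := h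
  rw [apply_hbar_pow_smul, add_zero, of_apply, eq_zero_iff] at h'
  obtain ⟨w, rfl⟩ := h'
  exact ⟨of w + z, by rw [map_smul, smul_add]⟩

instance : HComplete (HAdic A) where
  sep x h := ext_apply fun n => by
    obtain ⟨z, rfl⟩ := h n
    exact apply_hbar_pow_smul n z
  compl c := by
    have key : ∀ m n, m ≤ n → (∑ i ∈ Finset.range n, hbar ^ i • c i : HAdic A).1 m =
        (∑ i ∈ Finset.range m, hbar ^ i • c i : HAdic A).1 m := by
      intro m n hmn
      induction n, hmn using Nat.le_induction with
      | base => rfl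
      | succ n hn ih =>
        rw [Finset.sum_range_succ, ← ih]
        change _ + (hbar ^ n • c n).1 m = _
        obtain ⟨k, rfl⟩ := Nat.exists_eq_add_of_le hn
        rw [pow_add, mul_smul, apply_hbar_pow_smul, add_zero]
    refine ⟨⟨fun n => (∑ i ∈ Finset.range n, hbar ^ i • c i : HAdic A).1 n, fun n => ?_⟩,
      fun n => ?_⟩
    · obtain ⟨a, ha⟩ := (∑ i ∈ Finset.range n, hbar ^ i • c i : HAdic A).2 n
      exact ⟨a, fun m hm => by rw [← ha m hm, key m n hm]⟩
    · set s : HAdic A := ⟨fun n => (∑ i ∈ Finset.range n, hbar ^ i • c i : HAdic A).1 n, _⟩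
      have : (s - ∑ i ∈ Finset.range n, hbar ^ i • c i).1 n = 0 := sub_self _
      obtain ⟨z, hz⟩ := exists_smul_of_apply_eq_zero this
      exact ⟨z, by rw [← hz]; abel⟩

theorem hsum_eq_hlim (c : ℕ → A) : hsum c = hlim fun n => of (c n) :=
  eq_hlim fun n => ⟨hsum fun i => c (n + i), by rw [hsum_eq c n]; simp⟩

theorem of_injective [HComplete A] : Function.Injective (of : A → HAdic A) := by
  rw [injective_iff_map_eq_zero]
  intro a ha
  refine HComplete.sep a fun n => ?_
  rw [← eq_zero_iff, ← of_apply, ha]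
  rfl

theorem of_surjective [HComplete A] : Function.Surjective (of : A → HAdic A) := fun x => by
  obtain ⟨c, rfl⟩ := exists_hsum x
  exact ⟨hlim c, by rw [hsum_eq_hlim]; exact map_hlim of.toLinearMap c⟩

/-- A complete algebra is its own completion. -/
noncomputable def ofEquiv (A : Type*) [Ring A] [Algebra K A] [HComplete A] : A ≃ₐ[K] HAdic A :=
  AlgEquiv.ofBijective of ⟨of_injective, of_surjective⟩

@[simp] theorem of_ofEquiv_symm [HComplete A] (x : HAdic A) : of ((ofEquiv A).symm x) = x :=
  (ofEquiv A).apply_symm_apply x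

/-- Linear maps on the completion are determined by their values on the algebra. -/
theorem hom_ext {M : Type*} [AddCommGroup M] [Module K M] [HComplete M] {f g : HAdic A →ₗ[K] M}
    (h : ∀ a, f (of a) = g (of a)) : f = g :=
  LinearMap.ext fun x => eq_of_sub_mem fun n => by
    obtain ⟨a, z, rfl⟩ := exists_of x n
    exact ⟨f z - g z, by rw [map_add, map_add, h, map_smul, map_smul, smul_sub]; abel⟩

/-- The working tool for all identities in completed tensor products: linear maps are continuous and
pure tensors span a dense submodule. -/
theorem hom_ext_tensor {M : Type*} [AddCommGroup M] [Module K M] [HComplete M]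
    {f g : HAdic (A ⊗[K] B) →ₗ[K] M} (h : ∀ a b, f (of (a ⊗ₜ b)) = g (of (a ⊗ₜ b))) : f = g := by
  refine hom_ext fun t => ?_
  induction t using TensorProduct.induction_on with
  | zero => simp
  | tmul a b => exact h a b
  | add x y hx hy => simp only [map_add, hx, hy]

@[simp] theorem extend_of (f : A →ₗ[K] HAdic B) (a : A) : extend f (of a) = f a := rfl

@[simp] theorem map_of (f : A →ₗ[K] B) (a : A) : map f (of a) = of (f a) := rfl

@[simp] theorem tmul_of (p : P) (q : Q) : tmul (of p) (of q) = of (p ⊗ₜ[K] q) := rfl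

@[simp] theorem tensorMap_of (f : A →ₗ[K] HAdic P) (g : B →ₗ[K] HAdic Q) (a : A) (b : B) :
    tensorMap f g (of (a ⊗ₜ b)) = tmul (f a) (g b) := rfl

/-- Density is applied to one argument at a time, with the other one fixed, first in the uncompleted
algebra and then in the completion. -/
theorem map_mul_of_forall {f : HAdic A →ₗ[K] C} [HComplete C]
    (h : ∀ a b, f (of (a * b)) = f (of a) * f (of b)) (x y : HAdic A) :
    f (x * y) = f x * f y := by
  have h1 : ∀ b, f ∘ₗ LinearMap.mulRight K (of b) = LinearMap.mulRight K (f (of b)) ∘ₗ f :=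
    fun b => hom_ext fun a => by simp [h, ← map_mul]
  have h2 : f ∘ₗ LinearMap.mulLeft K x = LinearMap.mulLeft K (f x) ∘ₗ f :=
    hom_ext fun b => by simpa using LinearMap.congr_fun (h1 b) x
  simpa using LinearMap.congr_fun h2 y

/-- The extension to the completion of an algebra homomorphism. -/
noncomputable def extendAlg (f : A →ₐ[K] HAdic B) : HAdic A →ₐ[K] HAdic B :=
  AlgHom.ofLinearMap (extend f.toLinearMap)
    (by rw [← map_one of, extend_of]; exact map_one f)
    (map_mul_of_forall fun a b => map_mul f a b)

@[simp] theorem extendAlg_of (f : A →ₐ[K] HAdic B) (a : A) : extendAlg f (of a) = f a := rfl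

/-- Functoriality of the completion for algebra homomorphisms. -/
noncomputable def mapAlg (f : A →ₐ[K] B) : HAdic A →ₐ[K] HAdic B := extendAlg (of.comp f)

@[simp] theorem mapAlg_of (f : A →ₐ[K] B) (a : A) : mapAlg f (of a) = of (f a) := rfl

theorem tmul_mul (x x' : HAdic P) (y y' : HAdic Q) :
    tmul (x * x') (y * y') = tmul x y * tmul x' y' := by
  refine ext_apply fun n => ?_
  obtain ⟨p, hp⟩ := x.2 n
  obtain ⟨p', hp'⟩ := x'.2 n
  obtain ⟨q, hq⟩ := y.2 n
  obtain ⟨q', hq'⟩ := y'.2 n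
  change tmulLevel n (x.1 n * x'.1 n) (y.1 n * y'.1 n) =
    tmulLevel n (x.1 n) (y.1 n) * tmulLevel n (x'.1 n) (y'.1 n)
  rw [hp n le_rfl, hq n le_rfl, hp' n le_rfl, hq' n le_rfl]
  exact congrArg _ (Algebra.TensorProduct.tmul_mul_tmul p p' q q').symm

/-- The embedding `x ↦ x ⊗ 1`. -/
noncomputable def inl (P Q : Type*) [Ring P] [Algebra K P] [Ring Q] [Algebra K Q] :
    HAdic P →ₐ[K] HAdic (P ⊗[K] Q) :=
  AlgHom.ofLinearMap (tmul.flip (1 : HAdic Q)) rfl fun x y =>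
    (congrArg (tmul (x * y)) (mul_one (1 : HAdic Q)).symm).trans (tmul_mul x y 1 1)

/-- The embedding `y ↦ 1 ⊗ y`. -/
noncomputable def inr (P Q : Type*) [Ring P] [Algebra K P] [Ring Q] [Algebra K Q] :
    HAdic Q →ₐ[K] HAdic (P ⊗[K] Q) :=
  AlgHom.ofLinearMap (tmul (1 : HAdic P)) rfl fun x y =>
    (congrArg (fun z : HAdic P => tmul z (x * y)) (mul_one (1 : HAdic P)).symm).trans
      (tmul_mul 1 1 x y)

theorem inl_apply (x : HAdic P) : inl P Q x = tmul x 1 := rfl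

theorem inr_apply (y : HAdic Q) : inr P Q y = tmul 1 y := rfl

theorem inr_of (y : Q) : inr P Q (of y) = of (1 ⊗ₜ y) := rfl

theorem inl_mul_inr (x : HAdic P) (y : HAdic Q) : inl P Q x * inr P Q y = tmul x y := by
  rw [inl_apply, inr_apply, ← tmul_mul, mul_one, one_mul]

theorem inr_mul_inl (x : HAdic P) (y : HAdic Q) : inr P Q y * inl P Q x = tmul x y := by
  rw [inl_apply, inr_apply, ← tmul_mul, mul_one, one_mul]

theorem commute_inl_inr (x : HAdic P) (y : HAdic Q) : Commute (inl P Q x) (inr P Q y) := by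
  rw [Commute, SemiconjBy, inl_mul_inr, inr_mul_inl]

/-- The completed tensor product of two algebra homomorphisms. -/
noncomputable def tensorAlg (f : A →ₐ[K] HAdic P) (g : B →ₐ[K] HAdic Q) :
    HAdic (A ⊗[K] B) →ₐ[K] HAdic (P ⊗[K] Q) :=
  extendAlg (Algebra.TensorProduct.lift ((inl P Q).comp f) ((inr P Q).comp g) fun a b =>
    commute_inl_inr (f a) (g b))

/-- Connects the multiplicative version of the completed tensor product of maps with the linear one
in which the Hopf and twist axioms are phrased. -/
theorem tensorAlg_apply (f : A →ₐ[K] HAdic P) (g : B →ₐ[K] HAdic Q) (x : HAdic (A ⊗[K] B)) :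
    tensorAlg f g x = tensorMap f.toLinearMap g.toLinearMap x := by
  change (tensorAlg f g).toLinearMap x = _
  congr 1
  exact hom_ext_tensor fun a b => inl_mul_inr (f a) (g b)

@[simp] theorem tensorAlg_of (f : A →ₐ[K] HAdic P) (g : B →ₐ[K] HAdic Q) (a : A) (b : B) :
    tensorAlg f g (of (a ⊗ₜ b)) = tmul (f a) (g b) := by
  rw [tensorAlg_apply]; rfl

theorem tensorAlg_inl (f : A →ₐ[K] HAdic P) (g : B →ₐ[K] HAdic Q) (x : HAdic A) :
    tensorAlg f g (inl A B x) = inl P Q (extendAlg f x) := by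
  have : (tensorAlg f g).toLinearMap ∘ₗ (inl A B).toLinearMap =
      (inl P Q).toLinearMap ∘ₗ (extendAlg f).toLinearMap :=
    hom_ext fun a => (tensorAlg_of f g a 1).trans
      (congrArg (tmul (f a)) (map_one g))
  exact LinearMap.congr_fun this x

theorem tensorAlg_inr (f : A →ₐ[K] HAdic P) (g : B →ₐ[K] HAdic Q) (x : HAdic B) :
    tensorAlg f g (inr A B x) = inr P Q (extendAlg g x) := by
  have : (tensorAlg f g).toLinearMap ∘ₗ (inr A B).toLinearMap =
      (inr P Q).toLinearMap ∘ₗ (extendAlg g).toLinearMap :=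
    hom_ext fun a => (tensorAlg_of f g 1 a).trans
      (congrArg (fun z : HAdic P => tmul z (g a)) (map_one f))
  exact LinearMap.congr_fun this x

/-- Approximating `x` by `a` to order `n + 1` gives `ℏ a ∈ ℏⁿ⁺¹ A`. Cancelling one `ℏ` costs one
order of precision, which still leaves `x` divisible by `ℏⁿ`. -/
theorem torsionFree (hA : ∀ x : A, hbar • x = 0 → x = 0) (x : HAdic A) (hx : hbar • x = 0) :
    x = 0 := by
  refine HComplete.sep x fun n => ?_
  obtain ⟨a, z, rfl⟩ := exists_of x (n + 1)
  have h : (of (hbar • a) : HAdic A).1 (n + 1) = 0 := by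
    rw [smul_add, smul_comm, ← map_smul] at hx
    rw [eq_neg_of_add_eq_zero_left hx, ← smul_neg, apply_hbar_pow_smul]
  rw [of_apply, eq_zero_iff] at h
  obtain ⟨w, hw⟩ := h
  have : a - hbar ^ n • w = 0 := hA _ (by rw [smul_sub, hw, smul_smul, ← pow_succ', sub_self])
  exact ⟨of w + hbar • z, by
    rw [sub_eq_zero.1 this, map_smul, smul_add, smul_smul, ← pow_succ]⟩

end HAdic

/-- A nonzero power series is a unit times a power of `ℏ`, so `ℏ` is the only scalar to be tested.
-/
theorem isTorsionFree {M : Type*} [AddCommGroup M] [Module K M]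
    (hM : ∀ x : M, hbar • x = 0 → x = 0) : Module.IsTorsionFree K M :=
  .of_smul_eq_zero fun k x hkx => by
    by_cases hk : k = 0
    · exact .inl hk
    refine .inr ?_
    have hpow : ∀ (n : ℕ) (x : M), hbar ^ n • x = 0 → x = 0 := fun n => by
      induction n with
      | zero => simp
      | succ n ih => exact fun x hx => ih x (hM _ (by rwa [smul_smul, ← pow_succ']))
    refine hpow k.order.toNat x ?_
    obtain ⟨u, hu⟩ := PowerSeries.isUnit_divided_by_X_pow_order hk
    rw [← PowerSeries.X_pow_order_mul_divXPowOrder (f := k), ← hu, mul_comm, mul_smul] at hkx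
    exact (u.isUnit.smul_eq_zero).1 hkx

/-- Over the principal ideal domain `K` torsion-free modules are flat, and flatness is inherited by
tensor products. -/
theorem tensor_torsionFree {M N : Type*} [AddCommGroup M] [Module K M] [AddCommGroup N]
    [Module K N] (hM : ∀ x : M, hbar • x = 0 → x = 0) (hN : ∀ x : N, hbar • x = 0 → x = 0)
    (x : M ⊗[K] N) (hx : hbar • x = 0) : x = 0 := by
  have := isTorsionFree hM
  have := isTorsionFree hN
  have : Module.IsTorsionFree K (M ⊗[K] N) := inferInstance
  exact (smul_eq_zero.1 hx).resolve_left PowerSeries.X_ne_zero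

/-! ### Exponentials in complete algebras -/

section Exp

variable {C D : Type*} [Ring C] [Algebra K C] [HComplete C] [Ring D] [Algebra K D] [HComplete D]

/-- `exp (ℏ x)`. -/
noncomputable def hExp (x : C) : C :=
  hlim fun n => PowerSeries.C ((n.factorial : ℝ)⁻¹) • x ^ n

/-- `sinh (c ℏ x) / (c ℏ)`. -/
noncomputable def hSinhDiv (c : ℝ) (x : C) : C :=
  hlim fun n => if Even n then
    (PowerSeries.C (((n + 1).factorial : ℝ)⁻¹ * c ^ n) : K) • x ^ (n + 1) else 0

theorem HAdic.hexp_eq {A : Type*} [Ring A] [Algebra K A] (x : A) :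
    HAdic.hexp x = hExp (HAdic.of x) := by
  rw [HAdic.hexp, HAdic.hsum_eq_hlim, hExp]
  simp only [map_smul, map_pow]

theorem map_hExp (f : C →ₐ[K] D) (x : C) : f (hExp x) = hExp (f x) :=
  (map_hlim f.toLinearMap _).trans (by simp [hExp])

theorem map_hSinhDiv (f : C →ₐ[K] D) (c : ℝ) (x : C) :
    f (hSinhDiv c x) = hSinhDiv c (f x) :=
  (map_hlim f.toLinearMap _).trans (by simp [hSinhDiv, apply_ite f])

theorem hExp_zero : hExp (0 : C) = 1 := by
  rw [hExp, ← hlim_single (1 : C)]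
  congr 1
  ext n
  cases n <;> simp

/-- Compare the Cauchy product with the binomial theorem, which needs `x` and `y` to commute. -/
theorem hExp_add {x y : C} (h : Commute x y) : hExp (x + y) = hExp x * hExp y := by
  rw [hExp, hExp, hExp, hlim_mul]
  congr 1
  ext n
  rw [h.add_pow', Finset.smul_sum]
  refine Finset.sum_congr rfl fun p hp => ?_
  rw [smul_mul_smul_comm, ← map_mul, ← Nat.cast_smul_eq_nsmul K, smul_smul,
    ← map_natCast (PowerSeries.C : ℝ →+* K), ← map_mul]
  congr 2
  rw [Finset.HasAntidiagonal.mem_antidiagonal] at hp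
  subst hp
  rw [Nat.cast_add_choose]
  have := Nat.factorial_ne_zero (p.1 + p.2)
  field_simp

theorem hExp_mul_neg (x : C) : hExp x * hExp (-x) = 1 := by
  rw [← hExp_add (Commute.neg_right (Commute.refl x)), add_neg_cancel, hExp_zero]

theorem hExp_neg_mul (x : C) : hExp (-x) * hExp x = 1 := by
  simpa using hExp_mul_neg (-x)

theorem isUnit_hExp (x : C) : IsUnit (hExp x) :=
  ⟨⟨hExp x, hExp (-x), hExp_mul_neg x, hExp_neg_mul x⟩, rfl⟩

/-- The source of all exchange relations: if `j` moves past the exponent at the price of a shift, it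
moves past the exponential at the price of the exponential of that shift. -/
theorem semiconj_hExp {j x y : C} (h : SemiconjBy j x y) : SemiconjBy j (hExp x) (hExp y) := by
  have h1 := map_hlim (LinearMap.mulLeft K j)
    fun n => (PowerSeries.C ((n.factorial : ℝ)⁻¹) : K) • x ^ n
  have h2 := map_hlim (LinearMap.mulRight K j)
    fun n => (PowerSeries.C ((n.factorial : ℝ)⁻¹) : K) • y ^ n
  refine h1.trans (Eq.trans ?_ h2.symm)
  simp [(h.pow_right _).eq]

theorem commute_hExp {x y : C} (h : Commute x y) : Commute x (hExp y) := semiconj_hExp h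

theorem expSeries_eq (r : ℝ) : expSeries r = hExp (PowerSeries.C r : K) := by
  rw [hExp, expSeries, ← coeff_hlim]
  simp

theorem expSeries_add (r s : ℝ) : expSeries (r + s) = expSeries r * expSeries s := by
  rw [expSeries_eq, expSeries_eq, expSeries_eq, map_add, hExp_add (Commute.all _ _)]

theorem expSeries_zero : expSeries (0 : ℝ) = 1 := by rw [expSeries_eq, map_zero, hExp_zero]

theorem hExp_algebraMap (k : K) : hExp (algebraMap K C k) = algebraMap K C (hExp k) :=
  (map_hExp (Algebra.ofId K C) k).symm

theorem hExp_smul_one (r : ℝ) :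
    hExp ((PowerSeries.C r : K) • (1 : C)) = expSeries r • (1 : C) := by
  rw [← Algebra.algebraMap_eq_smul_one, hExp_algebraMap, ← expSeries_eq,
    Algebra.algebraMap_eq_smul_one]

theorem hExp_add_smul_one (r : ℝ) (x : C) :
    hExp (x + (PowerSeries.C r : K) • (1 : C)) = expSeries r • hExp x := by
  rw [hExp_add (by simp [Commute, SemiconjBy]), hExp_smul_one, mul_smul_comm, mul_one]

/-- The constant terms of the two exponentials cancel, so coefficient `n` on the left faces
coefficient `n + 1` on the right. Most identities for `sinh(cℏx)/(cℏ)` below are proved by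
multiplying with `2cℏ`, using this formula, and cancelling in a torsion-free module. -/
theorem hbar_smul_hSinhDiv (c : ℝ) (x : C) :
    ((PowerSeries.C (2 * c) : K) * hbar) • hSinhDiv c x =
      hExp ((PowerSeries.C c : K) • x) - hExp (-((PowerSeries.C c : K) • x)) := by
  rw [hExp, hExp, ← hlim_sub, hlim_succ, hSinhDiv, mul_comm, mul_smul, ← hlim_smul]
  simp only [Nat.factorial_zero, Nat.cast_one, inv_one, map_one, pow_zero, sub_self, zero_add]
  congr 2
  ext n
  rw [← smul_sub, smul_pow, neg_pow, smul_pow]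
  split_ifs with h
  · rw [Odd.neg_one_pow h.add_one, neg_one_mul, sub_neg_eq_add, ← two_smul K, smul_smul,
      smul_smul, smul_smul, ← map_pow, ← map_mul,
      show (2 : K) = PowerSeries.C 2 from (map_ofNat _ 2).symm, ← map_mul, ← map_mul]
    congr 2
    ring
  · rw [Even.neg_one_pow (Nat.not_even_iff_odd.1 h).add_one, one_mul, sub_self]
    simp

theorem two_mul_coshSeries (c : ℝ) : 2 * coshSeries c = expSeries c + expSeries (-c) := by
  ext n
  rw [show (2 : K) = PowerSeries.C 2 from (map_ofNat _ 2).symm, PowerSeries.coeff_C_mul]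
  simp only [coshSeries, expSeries, map_add, PowerSeries.coeff_mk, smul_eq_mul]
  split_ifs with h
  · rw [h.neg_pow]; ring
  · rw [(Nat.not_even_iff_odd.1 h).neg_pow]; ring

theorem two_mul_sinhSeries (c : ℝ) : 2 * sinhSeries c = expSeries c - expSeries (-c) := by
  ext n
  rw [show (2 : K) = PowerSeries.C 2 from (map_ofNat _ 2).symm, PowerSeries.coeff_C_mul]
  simp only [sinhSeries, expSeries, map_sub, PowerSeries.coeff_mk, smul_eq_mul]
  split_ifs with h
  · rw [h.neg_pow]; ring
  · rw [(Nat.not_even_iff_odd.1 h).neg_pow]; ring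

theorem sinhDiv_eq (c r : ℝ) : sinhDiv c r = hSinhDiv c (PowerSeries.C r : K) := by
  rw [hSinhDiv, sinhDiv, ← coeff_hlim]
  congr 1
  ext1 n
  split_ifs <;> simp

theorem hbar_mul_sinhDiv (c : ℝ) :
    (PowerSeries.C (2 * c) : K) * hbar * sinhDiv c (1 : ℝ) = expSeries c - expSeries (-c) := by
  rw [sinhDiv_eq, ← smul_eq_mul, hbar_smul_hSinhDiv, expSeries_eq, expSeries_eq]
  simp

theorem C_mul_hbar_ne_zero {c : ℝ} (hc : c ≠ 0) : (PowerSeries.C c : K) * hbar ≠ 0 :=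
  mul_ne_zero (by simpa using hc) PowerSeries.X_ne_zero

theorem smul_cancel {M : Type*} [AddCommGroup M] [Module K M] [Module.IsTorsionFree K M] {k : K}
    (hk : k ≠ 0) {x y : M} (h : k • x = k • y) : x = y := smul_right_injective M hk h

/-- After multiplication by `2cℏ` the mixed products of exponentials telescope. In this asymmetric
form the addition theorem is exactly what the commutator of the coproducts of `J₊` and `J₋`
produces. -/
theorem hSinhDiv_add [Module.IsTorsionFree K C] {c : ℝ} (hc : c ≠ 0) {x y : C} (h : Commute x y) :
    hExp ((PowerSeries.C c : K) • x) * hSinhDiv c y +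
      hSinhDiv c x * hExp (-((PowerSeries.C c : K) • y)) = hSinhDiv c (x + y) := by
  have hxy : Commute ((PowerSeries.C c : K) • x) ((PowerSeries.C c : K) • y) :=
    (h.smul_left _).smul_right _
  refine smul_cancel (C_mul_hbar_ne_zero (mul_ne_zero two_ne_zero hc)) ?_
  rw [smul_add, ← mul_smul_comm, ← smul_mul_assoc, hbar_smul_hSinhDiv, hbar_smul_hSinhDiv,
    hbar_smul_hSinhDiv, smul_add, neg_add, hExp_add hxy, hExp_add hxy.neg_left.neg_right]
  noncomm_ring

theorem hSinhDiv_neg (c : ℝ) (x : C) : hSinhDiv c (-x) = -hSinhDiv c x := by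
  rw [← neg_one_smul K (hSinhDiv c x), hSinhDiv, hSinhDiv, ← hlim_smul]
  congr 1
  ext n
  split_ifs with h
  · rw [h.add_one.neg_pow]; simp
  · simp

theorem hSinhDiv_eq_add (c : ℝ) (x : C) : ∃ z, hSinhDiv c x = x + hbar • z := by
  rw [hSinhDiv, hlim_succ]
  exact ⟨_, by simp only [Even.zero, if_true]; simp; rfl⟩

theorem hExp_eq_add (x : C) : ∃ z, hExp x = 1 + hbar • x + hbar ^ 2 • z := by
  rw [hExp, hlim_succ, hlim_succ]
  exact ⟨_, by rw [smul_add, smul_smul hbar hbar, ← pow_two, ← add_assoc]; simp; rfl⟩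

end Exp

/-- By automatic continuity a homomorphism on power series is determined by its values on constant
series. -/
theorem map_series {C : Type*} [Ring C] [Algebra K C] [HComplete C] (f : FreeSeries →ₐ[K] C)
    (F : FreeSeries) : f F = hlim fun n => f (PowerSeries.C (PowerSeries.coeff n F)) := by
  conv_lhs => rw [FreeSeries.eq_hlim_coeff F]
  exact map_hlim f.toLinearMap _

theorem FreeSeries.C_smul (r : ℝ) (x : FreeAlgebra ℝ Gen) :
    (PowerSeries.C (r • x) : FreeSeries) = (PowerSeries.C r : K) • PowerSeries.C x := by
  rw [Algebra.smul_def, Algebra.smul_def, FreeSeries.algebraMap_eq, PowerSeries.map_C, map_mul]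

theorem map_expSeries {C : Type*} [Ring C] [Algebra K C] [HComplete C] (f : FreeSeries →ₐ[K] C)
    (x : FreeAlgebra ℝ Gen) : f (expSeries x) = hExp (f (PowerSeries.C x)) := by
  rw [map_series, hExp]
  simp [expSeries, FreeSeries.C_smul]

theorem map_sinhDiv {C : Type*} [Ring C] [Algebra K C] [HComplete C] (f : FreeSeries →ₐ[K] C)
    (c : ℝ) (x : FreeAlgebra ℝ Gen) :
    f (sinhDiv c x) = hSinhDiv c (f (PowerSeries.C x)) := by
  rw [map_series, hSinhDiv]
  congr 1
  ext1 n
  rw [sinhDiv, PowerSeries.coeff_mk]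
  split_ifs
  · rw [FreeSeries.C_smul, map_smul, map_pow, map_pow]
  · simp

/-! ### The universal property of `UqGl2` -/

section Universal

variable {C : Type*} [Ring C] [Algebra K C]

/-- The homomorphism from the free algebra given by the images of the generators. -/
noncomputable def freeHom (v : Gen → C) : FreeAlgebra ℝ Gen →+* C :=
  letI : Algebra ℝ C := Algebra.compHom C (PowerSeries.C : ℝ →+* K)
  (FreeAlgebra.lift ℝ v).toRingHom

theorem freeHom_ι (v : Gen → C) (g : Gen) : freeHom v (fgen g) = v g :=
  letI : Algebra ℝ C := Algebra.compHom C (PowerSeries.C : ℝ →+* K)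
  FreeAlgebra.lift_ι_apply v g

theorem freeHom_algebraMap (v : Gen → C) (r : ℝ) :
    freeHom v (algebraMap ℝ _ r) = algebraMap K C (PowerSeries.C r) :=
  letI : Algebra ℝ C := Algebra.compHom C (PowerSeries.C : ℝ →+* K)
  (FreeAlgebra.lift ℝ v).commutes r

variable [HComplete C]

/-- The continuous extension to power series. -/
noncomputable def seriesHom (v : Gen → C) : FreeSeries →ₐ[K] C where
  toFun F := hlim fun n => freeHom v (PowerSeries.coeff n F)
  map_one' := by
    rw [← hlim_single (1 : C)]
    congr 1
    ext n
    rw [PowerSeries.coeff_one]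
    split_ifs <;> simp
  map_zero' := by
    rw [← hlim_single (0 : C)]
    congr 1
    ext n
    simp
  map_add' F G := by simp only [map_add, hlim_add]
  map_mul' F G := by
    rw [hlim_mul]
    simp only [PowerSeries.coeff_mul, map_sum, map_mul]
  commutes' k := by
    simp only [FreeSeries.algebraMap_eq, PowerSeries.coeff_map, freeHom_algebraMap]
    have : k = hlim fun n => PowerSeries.C (PowerSeries.coeff n k) := by
      rw [coeff_hlim]; ext; simp
    conv_rhs => rw [this]
    exact (map_hlim (Algebra.linearMap K C) _).symm

theorem seriesHom_C (v : Gen → C) (x : FreeAlgebra ℝ Gen) :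
    seriesHom v (PowerSeries.C x) = freeHom v x := by
  change hlim _ = _
  rw [← hlim_single (freeHom v x)]
  congr 1
  ext n
  rw [PowerSeries.coeff_C]
  split_ifs <;> simp

theorem seriesHom_sgen (v : Gen → C) (g : Gen) : seriesHom v (sgen g) = v g := by
  rw [seriesHom_C, freeHom_ι]

/-- The defining relations of `UqGl2 a` for a family of elements of a complete algebra. -/
structure IsRep (a : ℝ) (v : Gen → C) : Prop where
  J3_Jp : v .J3 * v .Jp - v .Jp * v .J3 = 2 * v .Jp
  J3_Jm : v .J3 * v .Jm - v .Jm * v .J3 = -(2 * v .Jm)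
  Jp_Jm : v .Jp * v .Jm - v .Jm * v .Jp = hSinhDiv a (v .J3)
  I_comm : ∀ g, v .I * v g = v g * v .I

theorem seriesHom_eq_zero {a : ℝ} {v : Gen → C} (h : IsRep a v) :
    ∀ F ∈ relations a, seriesHom v F = 0 := by
  rintro F ((rfl | rfl | rfl) | ⟨g, rfl⟩)
  · simp only [map_sub, map_mul, seriesHom_sgen, map_ofNat, h.J3_Jp, sub_self]
  · simp only [map_add, map_sub, map_mul, seriesHom_sgen, map_ofNat, h.J3_Jm, neg_add_cancel]
  · simp only [map_sub, map_mul, seriesHom_sgen, map_sinhDiv, h.Jp_Jm, sub_self]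
  · simp only [map_sub, map_mul, seriesHom_sgen, h.I_comm, sub_self]

/-- The kernel contains the ideal, and it contains the closure of the ideal because the target is
separated. -/
theorem closureCon_le_ker {a : ℝ} (f : FreeSeries →ₐ[K] C) (h : ∀ F ∈ relations a, f F = 0) :
    closureCon (TwoSidedIdeal.span (relations a)) ≤ RingCon.ker (f : FreeSeries →+* C) := by
  intro x y hxy
  have hspan : TwoSidedIdeal.span (relations a) ≤ TwoSidedIdeal.ker f :=
    TwoSidedIdeal.span_le.2 fun F hF => (TwoSidedIdeal.mem_ker f).2 (h F hF)
  refine eq_of_sub_mem fun n => ?_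
  obtain ⟨z, hz⟩ := hxy n
  refine ⟨f z, ?_⟩
  have := (TwoSidedIdeal.mem_ker f).1 (hspan hz)
  rwa [map_sub, map_sub, map_smul, sub_eq_zero] at this

end Universal

namespace UqGl2

section Lift

variable {C : Type*} [Ring C] [Algebra K C]

theorem mk_surjective (a : ℝ) : Function.Surjective (mk a) := RingCon.mkₐ_surjective _

theorem mk_eq_mk {a : ℝ} {F G : FreeSeries} : mk a F = mk a G ↔
    ∀ n : ℕ, ∃ z, F - G - hbar ^ n • z ∈ TwoSidedIdeal.span (relations a) :=
  RingCon.eq _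

instance (a : ℝ) : HComplete (UqGl2 a) :=
  HComplete.of_surjective (mk a).toLinearMap (mk_surjective a) fun x h => by
    obtain ⟨F, rfl⟩ := mk_surjective a x
    rw [← map_zero (mk a), mk_eq_mk]
    intro n
    obtain ⟨z, hz⟩ := h n
    obtain ⟨z, rfl⟩ := mk_surjective a z
    rw [← map_smul, mk_eq_mk] at hz
    obtain ⟨w, hw⟩ := hz n
    -- Passing to the closure makes the quotient separated: congruence to `ℏⁿ z` modulo the closure,
    -- read at precision `n`, leaves an element of the ideal after subtracting `ℏⁿ (z + w)`.
    exact ⟨z + w, by rwa [sub_zero, smul_add, ← sub_sub]⟩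

theorem mk_eq_zero {a : ℝ} {F : FreeSeries} (hF : F ∈ relations a) : mk a F = 0 := by
  rw [← map_zero (mk a), mk_eq_mk]
  exact fun n => ⟨0, by simpa using TwoSidedIdeal.subset_span hF⟩

theorem isRep_gen (a : ℝ) : IsRep a (gen a) where
  J3_Jp := by
    have := mk_eq_zero (a := a) (.inl (.inl rfl))
    simp only [map_sub, map_mul, map_ofNat, sub_eq_zero] at this
    exact this
  J3_Jm := by
    have := mk_eq_zero (a := a) (.inl (.inr (.inl rfl)))
    simp only [map_sub, map_add, map_mul, map_ofNat, add_eq_zero_iff_eq_neg] at this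
    exact this
  Jp_Jm := by
    have := mk_eq_zero (a := a) (.inl (.inr (.inr rfl)))
    simp only [map_sub, map_mul, map_sinhDiv, sub_eq_zero] at this
    exact this
  I_comm g := by
    have := mk_eq_zero (a := a) (.inr ⟨g, rfl⟩)
    simp only [map_sub, map_mul, sub_eq_zero] at this
    exact this

/-- The universal property of `UqGl2 a` for complete targets. -/
noncomputable def lift [HComplete C] {a : ℝ} {v : Gen → C} (h : IsRep a v) : UqGl2 a →ₐ[K] C :=
  { (closureCon (TwoSidedIdeal.span (relations a))).lift (seriesHom v : FreeSeries →+* C)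
      (closureCon_le_ker (seriesHom v) (seriesHom_eq_zero h)) with
    commutes' := fun k => (seriesHom v).commutes k }

@[simp] theorem lift_gen [HComplete C] {a : ℝ} {v : Gen → C} (h : IsRep a v) (g : Gen) :
    lift h (gen a g) = v g := seriesHom_sgen v g

theorem mk_C_mem_adjoin (a : ℝ) (x : FreeAlgebra ℝ Gen) :
    mk a (PowerSeries.C x) ∈ Algebra.adjoin K (Set.range (gen a)) := by
  induction x using FreeAlgebra.induction with
  | grade0 r =>
    have : (PowerSeries.C (algebraMap ℝ (FreeAlgebra ℝ Gen) r) : FreeSeries) =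
        algebraMap K FreeSeries (PowerSeries.C r) := by
      rw [FreeSeries.algebraMap_eq, PowerSeries.map_C]
    rw [this, AlgHom.commutes]
    exact Subalgebra.algebraMap_mem _ _
  | grade1 g => exact Algebra.subset_adjoin ⟨g, rfl⟩
  | mul x y hx hy => rw [map_mul, map_mul]; exact mul_mem hx hy
  | add x y hx hy => rw [map_add, map_add]; exact add_mem hx hy

theorem exists_mem_adjoin {a : ℝ} (x : UqGl2 a) (n : ℕ) :
    ∃ y ∈ Algebra.adjoin K (Set.range (gen a)), ∃ z, x = y + hbar ^ n • z := by
  obtain ⟨F, rfl⟩ := mk_surjective a x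
  rw [map_series, hlim_spec_self _ n]
  exact ⟨_, sum_mem fun i _ => Subalgebra.smul_mem _ (mk_C_mem_adjoin a _) _, _, rfl⟩

/-- The generators generate a dense subalgebra, so a property that holds on a subalgebra containing
them and passes to `ℏ`-adic limits holds everywhere. -/
theorem induction {a : ℝ} {P : UqGl2 a → Prop} (S : Subalgebra K (UqGl2 a)) (hS : ∀ x ∈ S, P x)
    (hgen : ∀ g, gen a g ∈ S)
    (hcl : ∀ x, (∀ n : ℕ, ∃ y, P y ∧ ∃ z, x = y + hbar ^ n • z) → P x) (x : UqGl2 a) : P x :=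
  hcl x fun n => by
    obtain ⟨y, hy, hz⟩ := exists_mem_adjoin x n
    refine ⟨y, hS y (Algebra.adjoin_le ?_ hy), hz⟩
    rintro _ ⟨g, rfl⟩
    exact hgen g

theorem algHom_ext [HComplete C] {a : ℝ} {f g : UqGl2 a →ₐ[K] C}
    (h : ∀ x, f (gen a x) = g (gen a x)) : f = g := by
  refine AlgHom.ext (induction (AlgHom.equalizer f g) (fun x hx => hx) h fun x hx => ?_)
  refine eq_of_sub_mem fun n => ?_
  obtain ⟨y, hy, z, rfl⟩ := hx n
  exact ⟨f z - g z, by rw [map_add, map_add, hy, map_smul, map_smul, smul_sub]; abel⟩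

theorem induction_eq [HComplete C] {a : ℝ} {f g : UqGl2 a →ₗ[K] C} (S : Subalgebra K (UqGl2 a))
    (hS : ∀ x ∈ S, f x = g x) (hgen : ∀ g, gen a g ∈ S) (x : UqGl2 a) : f x = g x := by
  refine induction S hS hgen (fun x hx => ?_) x
  refine eq_of_sub_mem fun n => ?_
  obtain ⟨y, hy, z, rfl⟩ := hx n
  exact ⟨f z - g z, by rw [map_add, map_add, hy, map_smul, map_smul, smul_sub]; abel⟩

theorem cartanExp_eq (a s t : ℝ) : cartanExp a s t =
    hExp ((PowerSeries.C (s / 2) : K) • gen a .J3 + (PowerSeries.C (t / 2) : K) • gen a .I) := by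
  rw [cartanExp, map_expSeries, smul_add, smul_smul, smul_smul, map_add, FreeSeries.C_smul,
    FreeSeries.C_smul, map_add, map_smul, map_smul]
  rw [one_div_mul_eq_div, one_div_mul_eq_div]
  rfl

end Lift

/-! ### A faithful representation and the absence of torsion -/

/-- The index set of the representation space. -/
abbrev Idx : Type := ℕ × ℕ × ℝ × ℝ

/-- The action of the generators on functions of `(i, l, x, y)`, the coefficient of
`J₋ⁱ f(J₃, I) J₊ˡ` at `J₃ = x`, `I = y`. -/
noncomputable def regOp (a : ℝ) : Gen → Module.End K (Idx → K)
  | .J3 => Algebra.lmul K (Idx → K) fun p => PowerSeries.C (p.2.2.1 - 2 * p.1)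
  | .I => Algebra.lmul K (Idx → K) fun p => PowerSeries.C p.2.2.2
  | .Jm =>
    { toFun := fun f p => match p with
        | (0, _) => 0
        | (i + 1, q) => f (i, q)
      map_add' := fun f g => by ext1 ⟨i, q⟩; cases i <;> simp
      map_smul' := fun c f => by ext1 ⟨i, q⟩; cases i <;> simp }
  -- The first term comes from `J₊ f(J₃) = f(J₃ - 2) J₊`. The sum is the commutator of `J₊` with
  -- `J₋ⁱ⁺¹`: moving each `sinh(aℏJ₃)/(aℏ)` to the right of the factors `J₋` shifts `J₃` by `-2k`,
  -- for `0 ≤ k ≤ i`.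
  | .Jp =>
    { toFun := fun f p => (match p with
        | (_, 0, _) => 0
        | (i, l + 1, x, y) => f (i, l, x - 2, y)) +
        (∑ k ∈ Finset.range (p.1 + 1), sinhDiv a (p.2.2.1 - 2 * k)) * f (p.1 + 1, p.2)
      map_add' := fun f g => by
        ext1 ⟨i, l, q⟩; cases l <;> simp [mul_add, add_add_add_comm]
      map_smul' := fun c f => by
        ext1 ⟨i, l, q⟩; cases l <;> simp [mul_left_comm, mul_add] }

section regOp

variable (a : ℝ) (f : Idx → K)

theorem regOp_J3_apply (p : Idx) :
    regOp a .J3 f p = PowerSeries.C (p.2.2.1 - 2 * p.1) * f p := rfl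

theorem regOp_I_apply (p : Idx) : regOp a .I f p = PowerSeries.C p.2.2.2 * f p := rfl

theorem regOp_Jm_zero (q : ℕ × ℝ × ℝ) : regOp a .Jm f (0, q) = 0 := rfl

theorem regOp_Jm_succ (i : ℕ) (q : ℕ × ℝ × ℝ) : regOp a .Jm f (i + 1, q) = f (i, q) := rfl

theorem regOp_Jp_zero (i : ℕ) (x y : ℝ) : regOp a .Jp f (i, 0, x, y) =
    (∑ k ∈ Finset.range (i + 1), sinhDiv a (x - 2 * k)) * f (i + 1, 0, x, y) :=
  zero_add _

theorem regOp_Jp_succ (i l : ℕ) (x y : ℝ) : regOp a .Jp f (i, l + 1, x, y) =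
    f (i, l, x - 2, y) +
      (∑ k ∈ Finset.range (i + 1), sinhDiv a (x - 2 * k)) * f (i + 1, l + 1, x, y) := rfl

theorem hSinhDiv_regOp_J3_apply (p : Idx) :
    hSinhDiv a (regOp a .J3) f p = sinhDiv a (p.2.2.1 - 2 * p.1 : ℝ) * f p := by
  rw [regOp, ← map_hSinhDiv, sinhDiv_eq]
  exact congrArg (· * f p) (map_hSinhDiv (Pi.evalAlgHom K (fun _ : Idx => K) p) a _)

end regOp

/-- The operators imitate left multiplication on symbols `J₋ⁱ f(J₃, I) J₊ˡ`, but the relations are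
verified directly, since that such symbols form a basis is what remains to be proved. In the
commutator of `J₊` and `J₋` the two sums differ by their last summand, at `k = i`. -/
theorem isRep_regOp (a : ℝ) : IsRep a (regOp a) where
  J3_Jp := by
    ext1 f
    rw [two_mul]
    ext1 ⟨i, l, x, y⟩
    simp only [LinearMap.sub_apply, LinearMap.add_apply, Module.End.mul_apply, Pi.sub_apply,
      Pi.add_apply]
    cases l <;>
      simp only [regOp_J3_apply, regOp_Jp_zero, regOp_Jp_succ, map_sub, map_mul, map_ofNat,
        map_natCast, Nat.cast_add, Nat.cast_one, map_add, map_one] <;>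
      ring
  J3_Jm := by
    ext1 f
    rw [two_mul]
    ext1 ⟨i, l, x, y⟩
    simp only [LinearMap.sub_apply, LinearMap.add_apply, LinearMap.neg_apply, Module.End.mul_apply,
      Pi.sub_apply, Pi.add_apply, Pi.neg_apply]
    cases i <;>
      simp only [regOp_J3_apply, regOp_Jm_zero, regOp_Jm_succ, map_sub, map_mul, map_ofNat,
        map_natCast, Nat.cast_add, Nat.cast_one, map_add, map_one] <;>
      ring
  Jp_Jm := by
    ext1 f
    ext1 ⟨i, l, x, y⟩
    rw [hSinhDiv_regOp_J3_apply]
    simp only [LinearMap.sub_apply, Module.End.mul_apply, Pi.sub_apply]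
    cases i <;> cases l <;>
      simp only [regOp_Jp_zero, regOp_Jp_succ, regOp_Jm_zero, regOp_Jm_succ,
        Finset.sum_range_succ, Finset.sum_range_zero] <;>
      ring
  I_comm g := by
    ext1 f
    ext1 ⟨i, l, x, y⟩
    simp only [Module.End.mul_apply]
    cases g
    · simp only [regOp_I_apply, regOp_J3_apply]; ring
    · cases l <;> simp only [regOp_I_apply, regOp_Jp_zero, regOp_Jp_succ] <;> ring
    · cases i <;> simp only [regOp_I_apply, regOp_Jm_zero, regOp_Jm_succ] <;> ring
    · rfl

/-- The ordered monomials `J₋ⁱ J₃ʲ Iᵏ J₊ˡ`. -/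
noncomputable def monom (a : ℝ) (q : ℕ × ℕ × ℕ × ℕ) : UqGl2 a :=
  gen a .Jm ^ q.1 * (gen a .J3 ^ q.2.1 * (gen a .I ^ q.2.2.1 * gen a .Jp ^ q.2.2.2))

/-- The action of `UqGl2 a` on the constant function `1` at `i = l = 0`. -/
noncomputable def symb (a : ℝ) : UqGl2 a →ₗ[K] Idx → K :=
  LinearMap.applyₗ (fun p : Idx => if p.1 = 0 ∧ p.2.1 = 0 then (1 : K) else 0) ∘ₗ
    (lift (isRep_regOp a)).toLinearMap

/-- Applied to the vacuum, powers of `J₊` stay supported at `i = 0`, so the commutator sums in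
`regOp` never contribute; then `I` and `J₃` multiply by the coordinates `y` and `x`, and `J₋` shifts
`i`. In `h3` the factor is `x - 2i`, but it acts before the shift, at `i = 0`. -/
theorem symb_monom (a : ℝ) (q : ℕ × ℕ × ℕ × ℕ) (p : Idx) : symb a (monom a q) p =
    if p.1 = q.1 ∧ p.2.1 = q.2.2.2 then
      PowerSeries.C (p.2.2.1 ^ q.2.1 * p.2.2.2 ^ q.2.2.1) else 0 := by
  obtain ⟨i, j, k, l⟩ := q
  have h1 : ∀ l, (regOp a .Jp ^ l) (fun p : Idx => if p.1 = 0 ∧ p.2.1 = 0 then (1 : K) else 0) =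
      fun p : Idx => if p.1 = 0 ∧ p.2.1 = l then (1 : K) else 0 := by
    intro l
    induction l with
    | zero => rfl
    | succ l ih =>
      rw [pow_succ', Module.End.mul_apply, ih]
      ext1 ⟨i, l', x, y⟩
      cases l' <;> simp [regOp_Jp_zero, regOp_Jp_succ]
  have h2 : ∀ k (f : Idx → K), (regOp a .I ^ k) f =
      fun p => PowerSeries.C (p.2.2.2 ^ k) * f p := by
    intro k f
    induction k with
    | zero => simp
    | succ k ih =>
      rw [pow_succ', Module.End.mul_apply, ih]
      ext1 p
      rw [regOp_I_apply, ← mul_assoc, ← map_mul, pow_succ']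
  have h3 : ∀ j (f : Idx → K), (regOp a .J3 ^ j) f =
      fun p => PowerSeries.C ((p.2.2.1 - 2 * (p.1 : ℝ)) ^ j) * f p := by
    intro k f
    induction k with
    | zero => simp
    | succ k ih =>
      rw [pow_succ', Module.End.mul_apply, ih]
      ext1 p
      rw [regOp_J3_apply, ← mul_assoc, ← map_mul, pow_succ']
  have h4 : ∀ i (f : Idx → K) (i' : ℕ) r, (regOp a .Jm ^ i) f (i', r) =
      if i ≤ i' then f (i' - i, r) else 0 := by
    intro i
    induction i with
    | zero => simp
    | succ i ih =>
      intro f i' r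
      rw [pow_succ, Module.End.mul_apply, ih]
      rcases Nat.lt_or_ge i i' with h | h
      · obtain ⟨m, rfl⟩ := Nat.exists_eq_add_of_lt h
        rw [if_pos (by omega), if_pos (by omega), show i + m + 1 - i = m + 1 by omega,
          show i + m + 1 - (i + 1) = m by omega, regOp_Jm_succ]
      · rw [if_neg (show ¬ i + 1 ≤ i' by omega)]
        split_ifs
        · rw [show i' - i = 0 by omega, regOp_Jm_zero]
        · rfl
  obtain ⟨i', l', x, y⟩ := p
  simp only [symb, monom, LinearMap.comp_apply, AlgHom.toLinearMap_apply, map_mul, map_pow,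
    lift_gen, LinearMap.applyₗ_apply_apply, Module.End.mul_apply, h1, h2, h3, h4]
  by_cases h : i' = i
  · subst h
    by_cases h' : l' = l <;> simp [h']
  · rw [if_neg (show ¬ (i' = i ∧ l' = l) from fun h' => h h'.1)]
    split_ifs <;> first | omega | simp

/-- The representation theoretic part of the Poincaré-Birkhoff-Witt theorem. -/
theorem coeff_eq_zero_of_symb (a : ℝ) (c : ℕ × ℕ × ℕ × ℕ →₀ K)
    (h : ∀ p, PowerSeries.constantCoeff (symb a (c.sum fun q k => k • monom a q) p) = 0)
    (q : ℕ × ℕ × ℕ × ℕ) : PowerSeries.constantCoeff (c q) = 0 := by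
  obtain ⟨i, j, k, l⟩ := q
  let e (j k : ℕ) : Fin 2 →₀ ℕ := Finsupp.single 0 j + Finsupp.single 1 k
  have he : ∀ j k j' k', e j k = e j' k' → j = j' ∧ k = k' := fun j k j' k' h =>
    ⟨by simpa [e] using DFunLike.congr_fun h 0, by simpa [e] using DFunLike.congr_fun h 1⟩
  let P : MvPolynomial (Fin 2) ℝ := ∑ q ∈ c.support, if i = q.1 ∧ l = q.2.2.2 then
    MvPolynomial.monomial (e q.2.1 q.2.2.1) (PowerSeries.constantCoeff (c q)) else 0
  -- The values of `P` at real points are the constant coefficients of the symbol at `(i, l, x, y)`,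
  -- and a real polynomial that vanishes at all real points is zero.
  have hP : P = 0 := by
    refine MvPolynomial.funext fun v => ?_
    have := h (i, l, v 0, v 1)
    simp only [Finsupp.sum, map_sum, map_smul, Finset.sum_apply, Pi.smul_apply, symb_monom] at this
    rw [map_zero, ← this, map_sum]
    refine Finset.sum_congr rfl fun q _ => ?_
    split_ifs
    · simp [e, MvPolynomial.eval_monomial, Finsupp.prod_add_index', pow_add]
    · simp
  have hc := congrArg (MvPolynomial.coeff (e j k)) hP
  simp only [P, MvPolynomial.coeff_sum, MvPolynomial.coeff_zero] at hc
  rw [Finset.sum_eq_single (i, j, k, l)] at hc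
  · simpa using hc
  · rintro ⟨i', j', k', l'⟩ _ hne
    split_ifs with hq
    · rw [MvPolynomial.coeff_monomial, if_neg]
      intro he'
      obtain ⟨rfl, rfl⟩ := he _ _ _ _ he'
      obtain ⟨rfl, rfl⟩ := hq
      exact hne rfl
    · simp
  · intro hq
    simp [Finsupp.notMem_support_iff.1 hq]

end UqGl2

/-! ### Spanning by ordered monomials modulo `ℏ`, and injectivity of the symbol -/

namespace UqGl2

/-- The elements that are combinations of ordered monomials modulo `ℏ`. -/
noncomputable def monomSpan (a : ℝ) : Submodule K (UqGl2 a) :=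
  Submodule.span K (Set.range (monom a)) ⊔ LinearMap.range (LinearMap.lsmul K (UqGl2 a) hbar)

theorem hbar_smul_mem_monomSpan {a : ℝ} (z : UqGl2 a) : hbar • z ∈ monomSpan a :=
  (le_sup_right : _ ≤ monomSpan a) ⟨z, rfl⟩

theorem monom_mem_monomSpan (a : ℝ) (q) : monom a q ∈ monomSpan a :=
  (le_sup_left : _ ≤ monomSpan a) (Submodule.subset_span ⟨q, rfl⟩)

theorem mul_mem_monomSpan {a : ℝ} {g : UqGl2 a} (h : ∀ q, g * monom a q ∈ monomSpan a)
    {w : UqGl2 a} (hw : w ∈ monomSpan a) : g * w ∈ monomSpan a := by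
  have : monomSpan a ≤ (monomSpan a).comap (LinearMap.mulLeft K g) := by
    refine sup_le (Submodule.span_le.2 ?_) ?_
    · rintro _ ⟨q, rfl⟩
      exact h q
    · rintro _ ⟨z, rfl⟩
      change g * (hbar • z) ∈ monomSpan a
      rw [mul_smul_comm]
      exact hbar_smul_mem_monomSpan _
  exact this hw

theorem semiconj_J3_Jp (a : ℝ) : SemiconjBy (gen a .Jp) (gen a .J3) (gen a .J3 - 2) := by
  have := (isRep_gen a).J3_Jp
  rw [SemiconjBy, sub_mul, ← this, sub_sub_cancel]

theorem semiconj_J3_Jm (a : ℝ) : SemiconjBy (gen a .Jm) (gen a .J3) (gen a .J3 + 2) := by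
  have := (isRep_gen a).J3_Jm
  rw [SemiconjBy, add_mul, ← sub_eq_iff_eq_add', ← neg_inj, neg_sub, this]

theorem J3_mul_Jm_pow (a : ℝ) (i : ℕ) :
    gen a .J3 * gen a .Jm ^ i = gen a .Jm ^ i * (gen a .J3 - (2 * i : ℕ)) := by
  induction i with
  | zero => simp
  | succ i ih =>
    have : gen a .J3 * gen a .Jm = gen a .Jm * (gen a .J3 - 2) := by
      rw [mul_sub, (semiconj_J3_Jm a).eq, add_mul, mul_two, two_mul]; abel
    rw [pow_succ, ← mul_assoc, ih, mul_assoc, sub_mul, this, mul_assoc, mul_sub, mul_sub, mul_sub,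
      (Nat.cast_commute _ _).eq]
    push_cast
    noncomm_ring

theorem I_mul (a : ℝ) (g : Gen) : gen a .I * gen a g = gen a g * gen a .I :=
  (isRep_gen a).I_comm g

theorem Jm_mul_mem {a : ℝ} {w : UqGl2 a} (hw : w ∈ monomSpan a) :
    gen a .Jm * w ∈ monomSpan a :=
  mul_mem_monomSpan (fun ⟨i, j, k, l⟩ => by
    have : gen a .Jm * monom a (i, j, k, l) = monom a (i + 1, j, k, l) := by
      simp only [monom, pow_succ', mul_assoc]
    rw [this]
    exact monom_mem_monomSpan a _) hw

theorem J3_mul_mem {a : ℝ} {w : UqGl2 a} (hw : w ∈ monomSpan a) :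
    gen a .J3 * w ∈ monomSpan a :=
  mul_mem_monomSpan (fun ⟨i, j, k, l⟩ => by
    have : gen a .J3 * monom a (i, j, k, l) =
        monom a (i, j + 1, k, l) - (2 * i : ℕ) • monom a (i, j, k, l) := by
      simp only [monom, pow_succ', mul_assoc]
      rw [← mul_assoc, J3_mul_Jm_pow, mul_assoc, sub_mul, mul_sub, ← nsmul_eq_mul, mul_smul_comm]
    rw [this]
    exact sub_mem (monom_mem_monomSpan a _) (nsmul_mem (monom_mem_monomSpan a _) _)) hw

theorem I_mul_mem {a : ℝ} {w : UqGl2 a} (hw : w ∈ monomSpan a) :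
    gen a .I * w ∈ monomSpan a :=
  mul_mem_monomSpan (fun ⟨i, j, k, l⟩ => by
    have : gen a .I * monom a (i, j, k, l) = monom a (i, j, k + 1, l) := by
      have h1 : Commute (gen a .I) (gen a .Jm ^ i) := (show Commute _ _ from I_mul a _).pow_right i
      have h2 : Commute (gen a .I) (gen a .J3 ^ j) := (show Commute _ _ from I_mul a _).pow_right j
      simp only [monom, pow_succ', mul_assoc]
      rw [h1.left_comm, h2.left_comm]
    rw [this]
    exact monom_mem_monomSpan a _) hw

/-- The one case where reordering needs the deformed relation. Induction on the power of `J₋`: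
without `J₋`, `J₊` passes `J₃ʲ` by shifting it to `(J₃ - 2)ʲ`; each factor `J₋` costs a `J₃` modulo
`ℏ`. -/
theorem Jp_mul_mem {a : ℝ} {w : UqGl2 a} (hw : w ∈ monomSpan a) :
    gen a .Jp * w ∈ monomSpan a :=
  mul_mem_monomSpan (fun ⟨i, j, k, l⟩ => by
    induction i with
    | zero =>
      have h : gen a .Jp * monom a (0, j, k, l) = (gen a .J3 - 2) ^ j * monom a (0, 0, k, l + 1) := by
        have h2 : Commute (gen a .Jp) (gen a .I ^ k) :=
          (show Commute _ _ from (I_mul a _).symm).pow_right k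
        simp only [monom, pow_zero, one_mul, pow_succ']
        rw [← mul_assoc, ((semiconj_J3_Jp a).pow_right j).eq, mul_assoc, h2.left_comm]
      rw [h]
      induction j with
      | zero => rw [pow_zero, one_mul]; exact monom_mem_monomSpan a _
      | succ j ih =>
        rw [pow_succ', mul_assoc, sub_mul, two_mul]
        have := ih (by
          have h2 : Commute (gen a .Jp) (gen a .I ^ k) :=
            (show Commute _ _ from (I_mul a _).symm).pow_right k
          simp only [monom, pow_zero, one_mul, pow_succ']
          rw [← mul_assoc, ((semiconj_J3_Jp a).pow_right j).eq, mul_assoc, h2.left_comm])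
        exact sub_mem (J3_mul_mem this) (add_mem this this)
    | succ i ih =>
      have h : monom a (i + 1, j, k, l) = gen a .Jm * monom a (i, j, k, l) := by
        simp only [monom, pow_succ', mul_assoc]
      -- Modulo `ℏ` the commutator of `J₊` and `J₋` is just `J₃`, and the remainder lies in the span
      -- by definition.
      obtain ⟨z, hz⟩ := hSinhDiv_eq_add a (gen a .J3)
      have hc := (isRep_gen a).Jp_Jm
      rw [sub_eq_iff_eq_add', hz] at hc
      rw [h, ← mul_assoc, hc, add_mul, add_mul, mul_assoc, smul_mul_assoc]
      exact add_mem (Jm_mul_mem ih)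
        (add_mem (J3_mul_mem (monom_mem_monomSpan a _)) (hbar_smul_mem_monomSpan _))) hw

/-- The elements whose left multiplication preserves the span form a subalgebra containing the
generators; apply them to the monomial `1`. Approximation to first order suffices, since the span
contains all multiples of `ℏ`. -/
theorem mem_monomSpan {a : ℝ} (x : UqGl2 a) : x ∈ monomSpan a := by
  let S : Subalgebra K (UqGl2 a) :=
    { carrier := {x | ∀ w ∈ monomSpan a, x * w ∈ monomSpan a}
      mul_mem' := fun {x y} hx hy w hw => by rw [mul_assoc]; exact hx _ (hy w hw)
      add_mem' := fun {x y} hx hy w hw => by rw [add_mul]; exact add_mem (hx w hw) (hy w hw)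
      algebraMap_mem' := fun k w hw => by
        rw [← Algebra.smul_def]; exact Submodule.smul_mem _ k hw }
  have h1 : (1 : UqGl2 a) ∈ monomSpan a := by
    have := monom_mem_monomSpan a (0, 0, 0, 0)
    simpa [monom] using this
  refine induction S (fun x hx => by simpa using hx 1 h1) (fun g w hw => ?_) (fun x hx => ?_) x
  · cases g
    · exact J3_mul_mem hw
    · exact Jp_mul_mem hw
    · exact Jm_mul_mem hw
    · exact I_mul_mem hw
  · obtain ⟨y, hy, z, rfl⟩ := hx 1
    rw [pow_one]
    exact add_mem hy (hbar_smul_mem_monomSpan z)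

theorem eq_zero_of_hbar_smul_eq_zero {f : Idx → K} (h : hbar • f = 0) : f = 0 := by
  ext1 p
  exact (mul_eq_zero.1 (congrFun h p)).resolve_left PowerSeries.X_ne_zero

/-- Modulo `ℏ` the element is a combination of ordered monomials, and independence of their symbols
makes all its coefficients divisible by `ℏ`. -/
theorem exists_eq_hbar_smul {a : ℝ} {x : UqGl2 a} (h0 : symb a x = 0) : ∃ z, x = hbar • z := by
  obtain ⟨y, hy, _, ⟨z, rfl⟩, rfl⟩ := Submodule.mem_sup.1 (mem_monomSpan x)
  obtain ⟨c, rfl⟩ := (Finsupp.mem_span_range_iff_exists_finsupp).1 hy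
  have hc := coeff_eq_zero_of_symb a c fun p => by
    have := congrArg PowerSeries.constantCoeff (congrFun h0 p)
    rw [map_add, LinearMap.lsmul_apply, map_smul] at this
    simpa using this
  choose d hd using fun q => PowerSeries.X_dvd_iff.2 (hc q)
  refine ⟨∑ q ∈ c.support, d q • monom a q + z, ?_⟩
  change c.sum _ + hbar • z = _
  rw [smul_add, Finset.smul_sum, Finsupp.sum]
  congr 1
  refine Finset.sum_congr rfl fun q _ => ?_
  rw [smul_smul, ← hd]

/-- The space of functions has no `ℏ`-torsion, so the quotient by `ℏ` again has zero symbol and the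
division can be repeated indefinitely. Separatedness of `U` finishes the proof. -/
theorem symb_injective (a : ℝ) : Function.Injective (symb a) := by
  rw [injective_iff_map_eq_zero]
  have key : ∀ (n : ℕ) (x : UqGl2 a), symb a x = 0 → ∃ z, symb a z = 0 ∧ x = hbar ^ n • z := by
    intro n
    induction n with
    | zero => exact fun x hx => ⟨x, hx, by simp⟩
    | succ n ih =>
      intro x hx
      obtain ⟨z, rfl⟩ := exists_eq_hbar_smul hx
      obtain ⟨w, hw, rfl⟩ := ih z (eq_zero_of_hbar_smul_eq_zero (by rw [← map_smul, hx]))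
      exact ⟨w, hw, by rw [smul_smul, ← pow_succ']⟩
  refine fun x hx => HComplete.sep x fun n => ?_
  obtain ⟨z, _, hz⟩ := key n x hx
  exact ⟨z, hz⟩

theorem torsion_free {a : ℝ} (x : UqGl2 a) (hx : hbar • x = 0) : x = 0 :=
  symb_injective a <| (eq_zero_of_hbar_smul_eq_zero (by rw [← map_smul, hx, map_zero])).trans
    (map_zero _).symm

instance (a : ℝ) : Module.IsTorsionFree K (HAdic (UqGl2 a ⊗[K] UqGl2 a)) :=
  isTorsionFree (HAdic.torsionFree (tensor_torsionFree torsion_free torsion_free))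

instance (a : ℝ) : Module.IsTorsionFree K (UqGl2 a) := isTorsionFree torsion_free

end UqGl2

theorem smodEq_iff {M : Type*} [AddCommGroup M] [Module K M] {n : ℕ} {x y : M} :
    x ≡ y [SMOD ((Ideal.span {hbar}) ^ n • ⊤ : Submodule K M)] ↔ ∃ z, x - y = hbar ^ n • z := by
  rw [SModEq.sub_mem, Ideal.span_singleton_pow, Submodule.ideal_span_singleton_smul,
    Submodule.mem_smul_pointwise_iff_exists]
  simp [eq_comm]

/-- A Cauchy sequence is its initial value plus the telescoping series of its increments. -/
theorem HComplete.isAdicComplete (M : Type*) [AddCommGroup M] [Module K M] [HComplete M] :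
    IsAdicComplete (Ideal.span {hbar}) M where
  haus' x h := HComplete.sep x fun n => by
    obtain ⟨z, hz⟩ := smodEq_iff.1 (h n)
    exact ⟨z, by rwa [sub_zero] at hz⟩
  prec' f hf := by
    choose z hz using fun n => smodEq_iff.1 (hf (Nat.le_succ n))
    refine ⟨f 0 + hlim fun n => -z n, fun n => smodEq_iff.2 ?_⟩
    obtain ⟨w, hw⟩ := hlim_spec (fun n => -z n) n
    refine ⟨-w, ?_⟩
    have : ∑ i ∈ Finset.range n, hbar ^ i • -z i = f n - f 0 := by
      rw [← Finset.sum_range_sub]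
      refine Finset.sum_congr rfl fun i _ => ?_
      rw [smul_neg, ← hz, neg_sub]
    rw [hw, this, smul_neg]
    abel

/-! ### The coproduct on generators -/

section Coprod

variable {C D : Type*} [Ring C] [Algebra K C] [HComplete C] [Ring D] [Algebra K D] [HComplete D]

/-- The element `exp (ℏ (s J₃ + t I) / 2)` for a family of elements of a complete algebra. -/
noncomputable def cexp (v : Gen → C) (s t : ℝ) : C :=
  hExp ((PowerSeries.C (s / 2) : K) • v .J3 + (PowerSeries.C (t / 2) : K) • v .I)

/-- The coproduct of the generators, for a pair of families of elements. -/
noncomputable def coprodGen (a b : ℝ) (u v : Gen → C) : Gen → C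
  | .J3 => v .J3 + u .J3
  | .I => v .I + u .I
  | .Jp => cexp u a (-b) * v .Jp + u .Jp * cexp v (-a) b
  | .Jm => cexp u a b * v .Jm + u .Jm * cexp v (-a) (-b)

theorem map_cexp (f : C →ₐ[K] D) (v : Gen → C) (s t : ℝ) :
    f (cexp v s t) = cexp (fun g => f (v g)) s t := by
  simp [cexp, map_hExp]

theorem map_coprodGen (f : C →ₐ[K] D) (a b : ℝ) (u v : Gen → C) (g : Gen) :
    f (coprodGen a b u v g) = coprodGen a b (fun g => f (u g)) (fun g => f (v g)) g := by
  cases g <;> simp [coprodGen, map_cexp]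

theorem commute_cexp {v : Gen → C} {x : C} (h3 : Commute x (v .J3)) (hI : Commute x (v .I))
    (s t : ℝ) : Commute x (cexp v s t) :=
  commute_hExp ((h3.smul_right _).add_right (hI.smul_right _))

theorem cexp_mul_cexp {v : Gen → C} (h : Commute (v .I) (v .J3)) (s t s' t' : ℝ) :
    cexp v s t * cexp v s' t' = cexp v (s + s') (t + t') := by
  rw [cexp, cexp, cexp, ← hExp_add]
  · simp only [add_div, map_add, add_smul]
    congr 1
    abel
  · exact ((((Commute.refl _).smul_right _).smul_left _).add_right
      ((h.symm.smul_right _).smul_left _)).add_left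
      (((h.smul_right _).smul_left _).add_right (((Commute.refl _).smul_right _).smul_left _))

theorem cexp_zero_zero (v : Gen → C) : cexp v 0 0 = 1 := by
  simp [cexp, hExp_zero]

variable {a : ℝ} {u v w : Gen → C}

namespace IsRep

theorem I_J3 (h : IsRep a v) : Commute (v .I) (v .J3) := h.I_comm _

/-- `J₊` shifts `J₃` by `-2` and commutes with `I`, so the exponent changes by the scalar `-s`; the
parameter `t` plays no role. -/
theorem cexp_Jp (h : IsRep a v) (s t : ℝ) :
    v .Jp * cexp v s t = expSeries (-s) • (cexp v s t * v .Jp) := by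
  have h1 : SemiconjBy (v .Jp) ((PowerSeries.C (s / 2) : K) • v .J3 +
      (PowerSeries.C (t / 2) : K) • v .I) (((PowerSeries.C (s / 2) : K) • v .J3 +
      (PowerSeries.C (t / 2) : K) • v .I) + (PowerSeries.C (-s) : K) • (1 : C)) := by
    have h3 : v .Jp * v .J3 = v .J3 * v .Jp - 2 * v .Jp := by rw [← h.J3_Jp]; abel
    have hs : (PowerSeries.C (-s) : K) = -(PowerSeries.C (s / 2) * 2) := by
      rw [← map_ofNat (PowerSeries.C : ℝ →+* K) 2, ← map_mul, ← map_neg]; congr 1; ring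
    rw [SemiconjBy, mul_add, mul_smul_comm, mul_smul_comm, h3, ← h.I_comm, add_mul, add_mul,
      smul_mul_assoc, smul_mul_assoc, smul_mul_assoc, one_mul, hs, smul_sub, neg_smul, mul_smul,
      two_smul, two_mul]
    abel
  rw [cexp, (semiconj_hExp h1).eq, hExp_add_smul_one, smul_mul_assoc]

theorem cexp_Jm (h : IsRep a v) (s t : ℝ) :
    v .Jm * cexp v s t = expSeries s • (cexp v s t * v .Jm) := by
  have h1 : SemiconjBy (v .Jm) ((PowerSeries.C (s / 2) : K) • v .J3 +
      (PowerSeries.C (t / 2) : K) • v .I) (((PowerSeries.C (s / 2) : K) • v .J3 +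
      (PowerSeries.C (t / 2) : K) • v .I) + (PowerSeries.C s : K) • (1 : C)) := by
    have h3 : v .Jm * v .J3 = v .J3 * v .Jm + 2 * v .Jm := by
      rw [← sub_eq_iff_eq_add', ← neg_inj, ← h.J3_Jm]; abel
    have hs : (PowerSeries.C s : K) = PowerSeries.C (s / 2) * 2 := by
      rw [← map_ofNat (PowerSeries.C : ℝ →+* K) 2, ← map_mul]; congr 1; ring
    rw [SemiconjBy, mul_add, mul_smul_comm, mul_smul_comm, h3, ← h.I_comm, add_mul, add_mul,
      smul_mul_assoc, smul_mul_assoc, smul_mul_assoc, one_mul, hs, smul_add, mul_smul,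
      two_smul, two_mul]
    abel
  rw [cexp, (semiconj_hExp h1).eq, hExp_add_smul_one, smul_mul_assoc]

/-- The existence of the coproduct. It is stated for any two commuting families, so that it does not
depend on the tensor square in which they live. -/
theorem coprod [Module.IsTorsionFree K C] (ha : a ≠ 0) (b : ℝ) (hu : IsRep a u) (hv : IsRep a v)
    (h : ∀ g g', Commute (u g) (v g')) : IsRep a (coprodGen a b u v) := by
  have hu' : ∀ g s t, Commute (u g) (cexp v s t) := fun g s t => commute_cexp (h _ _) (h _ _) s t
  have hv' : ∀ g s t, Commute (cexp u s t) (v g) := fun g s t =>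
    (commute_cexp (h _ _).symm (h _ _).symm s t).symm
  have huv : ∀ s t s' t', Commute (cexp u s t) (cexp v s' t') := fun s t s' t' =>
    commute_cexp (hv' _ s t) (hv' _ s t) s' t'
  have huI : ∀ g, Commute (u .I) (u g) := hu.I_comm
  have hvI : ∀ g, Commute (v .I) (v g) := hv.I_comm
  have huu3 : ∀ s t, Commute (u .J3) (cexp u s t) := fun s t =>
    commute_cexp (Commute.refl _) (huI _).symm s t
  have hvv3 : ∀ s t, Commute (v .J3) (cexp v s t) := fun s t =>
    commute_cexp (Commute.refl _) (hvI _).symm s t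
  -- The weight relations for `J₊` (`k = 2`) and `J₋` (`k = -2`) at once: the Cartan factors commute
  -- with `J₃`, and each summand contains exactly one factor of weight `k`.
  have key : ∀ (A A' up vp : C) (k : ℤ), Commute A (v .J3) → Commute (u .J3) A →
      Commute (u .J3) vp → Commute (v .J3) A' → Commute up (v .J3) → Commute (u .J3) A' →
      u .J3 * up - up * u .J3 = k * up → v .J3 * vp - vp * v .J3 = k * vp →
      (v .J3 + u .J3) * (A * vp + up * A') - (A * vp + up * A') * (v .J3 + u .J3) =
        k * (A * vp + up * A') := by
    intro A A' up vp k h1 h2 h3 h4 h5 h6 h7 h8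
    have e1 : v .J3 * (A * vp) - (A * vp) * v .J3 = k * (A * vp) := by
      rw [← mul_assoc, ← h1.eq, mul_assoc, mul_assoc, ← mul_sub, h8, (Int.cast_commute k A).left_comm]
    have e2 : u .J3 * (A * vp) - (A * vp) * u .J3 = 0 := by
      rw [(h2.mul_right h3).eq, sub_self]
    have e3 : v .J3 * (up * A') - (up * A') * v .J3 = 0 := by
      rw [(h5.symm.mul_right h4).eq, sub_self]
    have e4 : u .J3 * (up * A') - (up * A') * u .J3 = k * (up * A') := by
      rw [mul_assoc up, ← h6.eq, ← mul_assoc, ← mul_assoc, ← sub_mul, h7, mul_assoc]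
    rw [show (v .J3 + u .J3) * (A * vp + up * A') - (A * vp + up * A') * (v .J3 + u .J3) =
      (v .J3 * (A * vp) - (A * vp) * v .J3) + (u .J3 * (A * vp) - (A * vp) * u .J3) +
      (v .J3 * (up * A') - (up * A') * v .J3) + (u .J3 * (up * A') - (up * A') * u .J3) by
        noncomm_ring, e1, e2, e3, e4]
    noncomm_ring
  refine ⟨?_, ?_, ?_, ?_⟩
  · have := key (cexp u a (-b)) (cexp v (-a) b) (u .Jp) (v .Jp) 2 (hv' _ _ _) (huu3 _ _) (h _ _)
      (hvv3 _ _) (h _ _) (hu' _ _ _) (by simpa using hu.J3_Jp) (by simpa using hv.J3_Jp)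
    simpa [coprodGen] using this
  · have := key (cexp u a b) (cexp v (-a) (-b)) (u .Jm) (v .Jm) (-2) (hv' _ _ _) (huu3 _ _) (h _ _)
      (hvv3 _ _) (h _ _) (hu' _ _ _) (by simpa using hu.J3_Jm) (by simpa using hv.J3_Jm)
    simpa [coprodGen] using this
  · simp only [coprodGen]
    set A := cexp u a (-b) with hA
    set A' := cexp v (-a) b with hA'
    set B := cexp u a b with hB
    set B' := cexp v (-a) (-b) with hB'
    have hAB : Commute A B := by
      rw [Commute, SemiconjBy, hA, hB, cexp_mul_cexp (huI _), cexp_mul_cexp (huI _), add_comm b]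
    have hAB' : Commute A' B' := by
      rw [Commute, SemiconjBy, hA', hB', cexp_mul_cexp (hvI _), cexp_mul_cexp (hvI _), add_comm b]
    -- In `A B` the contributions of `b` cancel, leaving `exp(aℏJ₃)` in the first family; `e2` is
    -- the mirror image. Together they form the left side of `hSinhDiv_add`.
    have e1 : A * v .Jp * (B * v .Jm) - B * v .Jm * (A * v .Jp) =
        hExp ((PowerSeries.C a : K) • u .J3) * hSinhDiv a (v .J3) := by
      rw [mul_assoc A, ← (hv' .Jp a b).left_comm, mul_assoc B, ← (hv' .Jm a (-b)).left_comm,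
        ← mul_assoc, ← mul_assoc B, hAB.eq, ← mul_sub, hv.Jp_Jm, hA, hB, cexp_mul_cexp (huI _)]
      simp [cexp]
    have e2 : u .Jp * A' * (u .Jm * B') - u .Jm * B' * (u .Jp * A') =
        hSinhDiv a (u .J3) * hExp (-((PowerSeries.C a : K) • v .J3)) := by
      rw [mul_assoc, ← (hu' .Jm (-a) b).left_comm, mul_assoc (u .Jm),
        ← (hu' .Jp (-a) (-b)).left_comm, ← mul_assoc, ← mul_assoc (u .Jm), hAB'.eq, ← sub_mul,
        hu.Jp_Jm, hA', hB', cexp_mul_cexp (hvI _)]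
      simp [cexp]
    -- The mixed terms commute: exchanging `A` with `J₋` and `B'` with `J₊` produces the same factor
    -- `exp(aℏ)` on both sides. In `e4` the factor is `exp(-aℏ)`.
    have e3 : A * v .Jp * (u .Jm * B') = u .Jm * B' * (A * v .Jp) := by
      have h1 := hu.cexp_Jm a (-b)
      have h2 := hv.cexp_Jp (-a) (-b)
      rw [mul_assoc, (h .Jm .Jp).symm.left_comm, h2, mul_assoc (u .Jm), (huv _ _ _ _).symm.left_comm,
        ← mul_assoc (u .Jm), h1, neg_neg, mul_smul_comm, mul_smul_comm, smul_mul_assoc, mul_assoc A]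
    have e4 : u .Jp * A' * (B * v .Jm) = B * v .Jm * (u .Jp * A') := by
      have h1 := hu.cexp_Jp a b
      have h2 := hv.cexp_Jm (-a) b
      rw [mul_assoc B, (h .Jp .Jm).symm.left_comm, h2, mul_assoc (u .Jp),
        (huv _ _ _ _).symm.left_comm, ← mul_assoc (u .Jp), h1, mul_smul_comm, mul_smul_comm,
        smul_mul_assoc, mul_assoc B]
    rw [add_comm (v .J3), ← hSinhDiv_add ha (h .J3 .J3), ← e1, ← e2, add_mul, mul_add, mul_add,
      add_mul, mul_add, mul_add, e3, e4]
    abel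
  · have hI : ∀ g, Commute (v .I + u .I) (u g) := fun g => (h _ _).symm.add_left (huI g)
    have hI' : ∀ g, Commute (v .I + u .I) (v g) := fun g => (hvI g).add_left (h _ _)
    intro g
    change Commute (v .I + u .I) _
    cases g
    · exact (hI' _).add_right (hI _)
    · exact ((commute_cexp (hI _) (hI _) _ _).mul_right (hI' _)).add_right
        ((hI _).mul_right (commute_cexp (hI' _) (hI' _) _ _))
    · exact ((commute_cexp (hI _) (hI _) _ _).mul_right (hI' _)).add_right
        ((hI _).mul_right (commute_cexp (hI' _) (hI' _) _ _))
    · exact (hI' _).add_right (hI _)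

end IsRep

/-- The Cartan exponentials are group-like because `J₃` and `I` are primitive and the two families
commute. -/
theorem cexp_coprodGen (b s t : ℝ)
    (h : ∀ g g', Commute (u g) (v g')) :
    cexp (coprodGen a b u v) s t = cexp u s t * cexp v s t := by
  rw [cexp, cexp, cexp, ← hExp_add]
  · simp only [coprodGen, smul_add]
    congr 1
    abel
  · exact ((((h _ _).smul_right _).smul_left _).add_right (((h _ _).smul_right _).smul_left _)).add_left
      ((((h _ _).smul_right _).smul_left _).add_right (((h _ _).smul_right _).smul_left _))

/-- Coassociativity in terms of three families. Once the Cartan exponentials are group-like, both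
sides have the same three terms. -/
theorem coprodGen_assoc (b : ℝ) (huv : ∀ g g', Commute (u g) (v g'))
    (hvw : ∀ g g', Commute (v g) (w g')) (g : Gen) :
    coprodGen a b (coprodGen a b u v) w g = coprodGen a b u (coprodGen a b v w) g := by
  cases g
  · simp only [coprodGen, add_assoc]
  · change cexp (coprodGen a b u v) a (-b) * w .Jp + coprodGen a b u v .Jp * cexp w (-a) b =
      cexp u a (-b) * coprodGen a b v w .Jp + u .Jp * cexp (coprodGen a b v w) (-a) b
    rw [cexp_coprodGen b _ _ huv, cexp_coprodGen b _ _ hvw]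
    simp only [coprodGen]
    noncomm_ring
  · change cexp (coprodGen a b u v) a b * w .Jm + coprodGen a b u v .Jm * cexp w (-a) (-b) =
      cexp u a b * coprodGen a b v w .Jm + u .Jm * cexp (coprodGen a b v w) (-a) (-b)
    rw [cexp_coprodGen b _ _ huv, cexp_coprodGen b _ _ hvw]
    simp only [coprodGen]
    noncomm_ring
  · simp only [coprodGen, add_assoc]

theorem coprodGen_zero_left (b : ℝ) (g : Gen) : coprodGen a b (fun _ => (0 : C)) v g = v g := by
  cases g <;> simp [coprodGen, cexp, hExp_zero]

theorem coprodGen_zero_right (b : ℝ) (g : Gen) : coprodGen a b u (fun _ => (0 : C)) g = u g := by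
  cases g <;> simp [coprodGen, cexp, hExp_zero]

theorem hSinhDiv_zero (c : ℝ) : hSinhDiv c (0 : C) = 0 := by
  refine (eq_hlim fun n => ⟨0, ?_⟩).symm
  simp

theorem hExp_op (x : C) : hExp (MulOpposite.op x) = MulOpposite.op (hExp x) :=
  ((map_hlim (MulOpposite.opLinearEquiv K (M := C)).toLinearMap _).trans (by simp [hExp])).symm

theorem hSinhDiv_op (c : ℝ) (x : C) :
    hSinhDiv c (MulOpposite.op x) = MulOpposite.op (hSinhDiv c x) :=
  ((map_hlim (MulOpposite.opLinearEquiv K (M := C)).toLinearMap _).trans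
    (by simp [hSinhDiv, apply_ite MulOpposite.op])).symm

end Coprod

/-! ### The Hopf algebra structure -/

theorem IsRep.map {C D : Type*} [Ring C] [Algebra K C] [HComplete C] [Ring D] [Algebra K D]
    [HComplete D] {a : ℝ} {v : Gen → C} (h : IsRep a v) (f : C →ₐ[K] D) :
    IsRep a fun g => f (v g) where
  J3_Jp := by simpa only [map_sub, map_mul, map_ofNat] using congrArg f h.J3_Jp
  J3_Jm := by simpa only [map_sub, map_mul, map_ofNat, map_neg] using congrArg f h.J3_Jm
  Jp_Jm := by simpa only [map_sub, map_mul, map_hSinhDiv] using congrArg f h.Jp_Jm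
  I_comm g := by simpa only [map_mul] using congrArg f (h.I_comm g)

theorem HAdic.of_tmul {A B : Type*} [Ring A] [Algebra K A] [Ring B] [Algebra K B] (x : A) (y : B) :
    HAdic.of (x ⊗ₜ[K] y) = HAdic.inl A B (HAdic.of x) * HAdic.inr A B (HAdic.of y) := by
  rw [HAdic.inl_mul_inr, HAdic.tmul_of]

/-! ### The two copies of the generators in the completed tensor square -/

section TensorSquare

variable {U : Type*} [Ring U] [Algebra K U]

/-- A family of elements in the first tensor factor. -/
noncomputable def genL (v : Gen → U) (g : Gen) : HAdic (U ⊗[K] U) :=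
  HAdic.inl U U (HAdic.of (v g))

/-- A family of elements in the second tensor factor. -/
noncomputable def genR (v : Gen → U) (g : Gen) : HAdic (U ⊗[K] U) :=
  HAdic.inr U U (HAdic.of (v g))

theorem commute_genL_genR (v : Gen → U) (g g' : Gen) : Commute (genL v g) (genR v g') :=
  HAdic.commute_inl_inr _ _

variable [HComplete U] {a : ℝ} {v : Gen → U}

theorem isRep_genL (h : IsRep a v) : IsRep a (genL v) :=
  (h.map HAdic.of).map (HAdic.inl U U)

theorem isRep_genR (h : IsRep a v) : IsRep a (genR v) :=
  (h.map HAdic.of).map (HAdic.inr U U)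

theorem inl_of_cexp (v : Gen → U) (s t : ℝ) :
    HAdic.inl U U (HAdic.of (cexp v s t)) = cexp (genL v) s t := by
  rw [map_cexp, map_cexp]; rfl

theorem inr_of_cexp (v : Gen → U) (s t : ℝ) :
    HAdic.inr U U (HAdic.of (cexp v s t)) = cexp (genR v) s t := by
  rw [map_cexp, map_cexp]; rfl

theorem coprodGen_genL_genR (a b : ℝ) (v : Gen → U) (g : Gen) :
    coprodGen a b (genL v) (genR v) g = match g with
    | .J3 => HAdic.of (1 ⊗ₜ v .J3 + v .J3 ⊗ₜ 1)
    | .I => HAdic.of (1 ⊗ₜ v .I + v .I ⊗ₜ 1)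
    | .Jp => HAdic.of (cexp v a (-b) ⊗ₜ v .Jp + v .Jp ⊗ₜ cexp v (-a) b)
    | .Jm => HAdic.of (cexp v a b ⊗ₜ v .Jm + v .Jm ⊗ₜ cexp v (-a) (-b)) := by
  cases g <;> simp only [coprodGen, map_add, HAdic.of_tmul, map_one, one_mul, mul_one,
    inl_of_cexp, inr_of_cexp] <;> rfl

end TensorSquare

theorem UqGl2.cartanExp_eq_cexp (a s t : ℝ) :
    UqGl2.cartanExp a s t = cexp (UqGl2.gen a) s t := UqGl2.cartanExp_eq a s t

/-- The coproduct. -/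
noncomputable def comulHom {a : ℝ} (ha : a ≠ 0) (b : ℝ) :
    UqGl2 a →ₐ[K] HAdic (UqGl2 a ⊗[K] UqGl2 a) :=
  UqGl2.lift ((isRep_genL (UqGl2.isRep_gen a)).coprod ha b (isRep_genR (UqGl2.isRep_gen a))
    (commute_genL_genR (UqGl2.gen a)))

theorem comulHom_gen {a : ℝ} (ha : a ≠ 0) (b : ℝ) (g : Gen) :
    comulHom ha b (UqGl2.gen a g) = coprodGen a b (genL (UqGl2.gen a)) (genR (UqGl2.gen a)) g :=
  UqGl2.lift_gen _ g

theorem isRep_zero (a : ℝ) (C : Type*) [Ring C] [Algebra K C] [HComplete C] :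
    IsRep a fun _ : Gen => (0 : C) := by
  constructor <;> simp [hSinhDiv_zero]

/-- The counit. -/
noncomputable def counitHom (a : ℝ) : UqGl2 a →ₐ[K] K := UqGl2.lift (isRep_zero a K)

theorem counitHom_gen (a : ℝ) (g : Gen) : counitHom a (UqGl2.gen a g) = 0 := UqGl2.lift_gen _ g

/-- The antipode of the generators. -/
noncomputable def antipodeGen (a : ℝ) : Gen → UqGl2 a
  | .J3 => -UqGl2.gen a .J3
  | .I => -UqGl2.gen a .I
  | .Jp => -(expSeries (-a) • UqGl2.gen a .Jp)
  | .Jm => -(expSeries a • UqGl2.gen a .Jm)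

/-- The antipode axiom forces `S(J₊) = -E⁻¹ J₊ E` with `E` the Cartan factor of the coproduct, which
by the exchange relation is `-exp(-aℏ) J₊`, independent of `b`; similarly for `J₋`. In the
commutator of `S(J₊)` and `S(J₋)` the scalars cancel. -/
theorem isRep_antipodeGen (a : ℝ) : IsRep a fun g => MulOpposite.op (antipodeGen a g) where
  J3_Jp := by
    have := (UqGl2.isRep_gen a).J3_Jp
    apply MulOpposite.unop_injective
    simp only [MulOpposite.unop_sub, MulOpposite.unop_mul, MulOpposite.unop_op, antipodeGen,
      neg_mul_neg, smul_mul_assoc, mul_smul_comm, ← smul_sub]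
    rw [← neg_sub, this]
    simp [two_mul, mul_two]
  J3_Jm := by
    have := (UqGl2.isRep_gen a).J3_Jm
    apply MulOpposite.unop_injective
    simp only [MulOpposite.unop_sub, MulOpposite.unop_mul, MulOpposite.unop_op, antipodeGen,
      neg_mul_neg, smul_mul_assoc, mul_smul_comm, ← smul_sub]
    rw [← neg_sub, this]
    simp [two_mul]
  Jp_Jm := by
    have := (UqGl2.isRep_gen a).Jp_Jm
    apply MulOpposite.unop_injective
    rw [hSinhDiv_op]
    simp only [MulOpposite.unop_sub, MulOpposite.unop_mul, MulOpposite.unop_op, antipodeGen,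
      neg_mul_neg, smul_mul_assoc, mul_smul_comm, smul_smul, ← expSeries_add,
      add_neg_cancel, neg_add_cancel, expSeries_zero, one_smul]
    rw [← neg_sub, this, hSinhDiv_neg]
  I_comm g := by
    have := UqGl2.I_mul a
    apply MulOpposite.unop_injective
    cases g <;> simp [antipodeGen, this]

/-- The antipode as a homomorphism to the opposite algebra. -/
noncomputable def antipodeHom (a : ℝ) : UqGl2 a →ₐ[K] (UqGl2 a)ᵐᵒᵖ :=
  UqGl2.lift (isRep_antipodeGen a)

/-- The antipode. -/
noncomputable def antipodeLin (a : ℝ) : UqGl2 a →ₗ[K] UqGl2 a :=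
  (MulOpposite.opLinearEquiv K).symm.toLinearMap ∘ₗ (antipodeHom a).toLinearMap

theorem antipodeLin_apply {a : ℝ} (x : UqGl2 a) : antipodeLin a x = (antipodeHom a x).unop := rfl

theorem antipodeLin_mul {a : ℝ} (x y : UqGl2 a) :
    antipodeLin a (x * y) = antipodeLin a y * antipodeLin a x := by
  simp [antipodeLin_apply]

theorem antipodeLin_one {a : ℝ} : antipodeLin a 1 = 1 := by
  simp [antipodeLin_apply]

theorem antipodeLin_gen (a : ℝ) (g : Gen) : antipodeLin a (UqGl2.gen a g) = antipodeGen a g := by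
  rw [antipodeLin_apply, antipodeHom, UqGl2.lift_gen, MulOpposite.unop_op]

theorem antipodeLin_cartanExp (a s t : ℝ) :
    antipodeLin a (UqGl2.cartanExp a s t) = UqGl2.cartanExp a (-s) (-t) := by
  rw [antipodeLin_apply, UqGl2.cartanExp_eq_cexp, map_cexp, UqGl2.cartanExp_eq_cexp]
  simp only [antipodeHom, UqGl2.lift_gen, cexp, ← MulOpposite.op_smul, ← MulOpposite.op_add,
    hExp_op, MulOpposite.unop_op, antipodeGen, smul_neg, neg_div, map_neg, neg_smul]

/-! ### Multiplicativity of the antipode axiom and uniqueness of the antipode -/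

section Axioms

variable {U : Type*} [Ring U] [Algebra K U]

theorem map_mul'_left_mul (S : U →ₗ[K] U) (hS : ∀ x y, S (x * y) = S y * S x) (u v : U)
    (X : HAdic (U ⊗[K] U)) :
    HAdic.map (LinearMap.mul' K U ∘ₗ TensorProduct.map S LinearMap.id)
      (X * HAdic.of (u ⊗ₜ v)) = HAdic.of (S u) *
        HAdic.map (LinearMap.mul' K U ∘ₗ TensorProduct.map S LinearMap.id) X * HAdic.of v := by
  have : HAdic.map (LinearMap.mul' K U ∘ₗ TensorProduct.map S LinearMap.id) ∘ₗ
      LinearMap.mulRight K (HAdic.of (u ⊗ₜ v)) = LinearMap.mulRight K (HAdic.of v) ∘ₗ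
      LinearMap.mulLeft K (HAdic.of (S u)) ∘ₗ
        HAdic.map (LinearMap.mul' K U ∘ₗ TensorProduct.map S LinearMap.id) :=
    HAdic.hom_ext_tensor fun a b => by
      simp [← map_mul, hS, mul_assoc]
  exact LinearMap.congr_fun this X

theorem map_mul'_right_mul (S : U →ₗ[K] U) (hS : ∀ x y, S (x * y) = S y * S x) (u v : U)
    (Y : HAdic (U ⊗[K] U)) :
    HAdic.map (LinearMap.mul' K U ∘ₗ TensorProduct.map LinearMap.id S)
      (HAdic.of (u ⊗ₜ v) * Y) = HAdic.of u *
        HAdic.map (LinearMap.mul' K U ∘ₗ TensorProduct.map LinearMap.id S) Y * HAdic.of (S v) := by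
  have : HAdic.map (LinearMap.mul' K U ∘ₗ TensorProduct.map LinearMap.id S) ∘ₗ
      LinearMap.mulLeft K (HAdic.of (u ⊗ₜ v)) = LinearMap.mulRight K (HAdic.of (S v)) ∘ₗ
      LinearMap.mulLeft K (HAdic.of u) ∘ₗ
        HAdic.map (LinearMap.mul' K U ∘ₗ TensorProduct.map LinearMap.id S) :=
    HAdic.hom_ext_tensor fun a b => by
      simp [← map_mul, hS, mul_assoc]
  exact LinearMap.congr_fun this Y

/-- For an anti-homomorphism, `S(x₁y₁) x₂y₂ = S(y₁) (S(x₁) x₂) y₂`, and the inner factor is a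
scalar, which can be pulled out. Hence the antipode axiom passes to products. -/
theorem antipode_left_mul (S : U →ₗ[K] U) (hS : ∀ x y, S (x * y) = S y * S x)
    {X : HAdic (U ⊗[K] U)} {k : K}
    (hX : HAdic.map (LinearMap.mul' K U ∘ₗ TensorProduct.map S LinearMap.id) X =
      algebraMap K _ k) (Y : HAdic (U ⊗[K] U)) :
    HAdic.map (LinearMap.mul' K U ∘ₗ TensorProduct.map S LinearMap.id) (X * Y) =
      k • HAdic.map (LinearMap.mul' K U ∘ₗ TensorProduct.map S LinearMap.id) Y := by
  have : HAdic.map (LinearMap.mul' K U ∘ₗ TensorProduct.map S LinearMap.id) ∘ₗ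
      LinearMap.mulLeft K X =
      k • HAdic.map (LinearMap.mul' K U ∘ₗ TensorProduct.map S LinearMap.id) :=
    HAdic.hom_ext_tensor fun u v => by
      rw [LinearMap.comp_apply, LinearMap.mulLeft_apply, map_mul'_left_mul S hS, hX,
        ← Algebra.commutes, mul_assoc, ← Algebra.smul_def, ← map_mul]
      rfl
  exact LinearMap.congr_fun this Y

theorem antipode_right_mul (S : U →ₗ[K] U) (hS : ∀ x y, S (x * y) = S y * S x)
    {Y : HAdic (U ⊗[K] U)} {k : K}
    (hY : HAdic.map (LinearMap.mul' K U ∘ₗ TensorProduct.map LinearMap.id S) Y =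
      algebraMap K _ k) (X : HAdic (U ⊗[K] U)) :
    HAdic.map (LinearMap.mul' K U ∘ₗ TensorProduct.map LinearMap.id S) (X * Y) =
      k • HAdic.map (LinearMap.mul' K U ∘ₗ TensorProduct.map LinearMap.id S) X := by
  have : HAdic.map (LinearMap.mul' K U ∘ₗ TensorProduct.map LinearMap.id S) ∘ₗ
      LinearMap.mulRight K Y =
      k • HAdic.map (LinearMap.mul' K U ∘ₗ TensorProduct.map LinearMap.id S) :=
    HAdic.hom_ext_tensor fun u v => by
      rw [LinearMap.comp_apply, LinearMap.mulRight_apply, map_mul'_right_mul S hS, hY,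
        ← Algebra.commutes, mul_assoc, ← Algebra.smul_def, ← map_mul]
      rfl
  exact LinearMap.congr_fun this X

/-- Uniqueness of convolution inverses: `L` computes `S(x₁) x₂ S'(x₃)`. The axiom for `S'` contracts
the last two factors to give `S`, the axiom for `S` contracts the first two to give `S'`, and
coassociativity identifies the two computations. -/
theorem HAdicHopf.antipode_unique [HComplete U] (H H' : HAdicHopf U) (hc : H.comul = H'.comul)
    (he : H.counit = H'.counit) : H.antipode = H'.antipode := by
  let L : HAdic (U ⊗[K] (U ⊗[K] U)) →ₗ[K] HAdic U :=
    HAdic.map (LinearMap.mul' K U ∘ₗ TensorProduct.map H.antipode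
      (LinearMap.mul' K U ∘ₗ TensorProduct.map LinearMap.id H'.antipode))
  have h1 : L ∘ₗ HAdic.tensorMap HAdic.of.toLinearMap H.comul.toLinearMap =
      HAdic.map H.antipode ∘ₗ HAdic.map ((TensorProduct.rid K U).toLinearMap ∘ₗ
        TensorProduct.map LinearMap.id H.counit.toLinearMap) := by
    refine HAdic.hom_ext_tensor fun x y => ?_
    have : L ∘ₗ HAdic.tmul (HAdic.of x) = LinearMap.mulLeft K (HAdic.of (H.antipode x)) ∘ₗ
        HAdic.map (LinearMap.mul' K U ∘ₗ TensorProduct.map LinearMap.id H'.antipode) :=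
      HAdic.hom_ext_tensor fun y z => by simp [L, ← map_mul]
    have h2 := LinearMap.congr_fun this (H'.comul y)
    rw [LinearMap.comp_apply, LinearMap.comp_apply, H'.antipode_right] at h2
    rw [LinearMap.comp_apply, HAdic.tensorMap_of]
    simp only [hc, AlgHom.toLinearMap_apply, he]
    refine h2.trans ?_
    simp [← Algebra.commutes, ← Algebra.smul_def]
  have h2 : L ∘ₗ HAdic.map (TensorProduct.assoc K U U U).toLinearMap ∘ₗ
        HAdic.tensorMap H.comul.toLinearMap HAdic.of.toLinearMap =
      HAdic.map H'.antipode ∘ₗ HAdic.map ((TensorProduct.lid K U).toLinearMap ∘ₗ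
        TensorProduct.map H.counit.toLinearMap LinearMap.id) := by
    refine HAdic.hom_ext_tensor fun x y => ?_
    have : L ∘ₗ HAdic.map (TensorProduct.assoc K U U U).toLinearMap ∘ₗ
        HAdic.tmul.flip (HAdic.of y) = LinearMap.mulRight K (HAdic.of (H'.antipode y)) ∘ₗ
        HAdic.map (LinearMap.mul' K U ∘ₗ TensorProduct.map H.antipode LinearMap.id) :=
      HAdic.hom_ext_tensor fun x z => by simp [L, ← map_mul, mul_assoc]
    have h2 := LinearMap.congr_fun this (H.comul x)
    rw [LinearMap.comp_apply, LinearMap.comp_apply, LinearMap.comp_apply, H.antipode_left] at h2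
    rw [LinearMap.comp_apply, LinearMap.comp_apply, HAdic.tensorMap_of]
    refine h2.trans ?_
    simp [← Algebra.smul_def]
  ext x
  apply HAdic.of_injective
  have e1 := LinearMap.congr_fun h1 (H.comul x)
  have e2 := LinearMap.congr_fun h2 (H.comul x)
  simp only [LinearMap.comp_apply, H.coassoc, H.counit_left, H.counit_right] at e1 e2
  exact e1.symm.trans e2

theorem HAdicHopf.eq_of [HComplete U] {H H' : HAdicHopf U} (hc : H.comul = H'.comul)
    (he : H.counit = H'.counit) : H = H' := by
  have hs := HAdicHopf.antipode_unique H H' hc he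
  cases H
  cases H'
  simp only at hc he hs
  subst hc he hs
  rfl

end Axioms

/-! ### Coassociativity and counit axioms on generators -/

section Axioms

variable {U : Type*} [Ring U] [Algebra K U]

/-- The map of completions induced by the associator. -/
noncomputable def assocHom (U : Type*) [Ring U] [Algebra K U] :
    HAdic ((U ⊗[K] U) ⊗[K] U) →ₐ[K] HAdic (U ⊗[K] (U ⊗[K] U)) :=
  HAdic.mapAlg (Algebra.TensorProduct.assoc K K K U U U).toAlgHom

theorem assocHom_apply (x : HAdic ((U ⊗[K] U) ⊗[K] U)) :
    assocHom U x = HAdic.map (TensorProduct.assoc K U U U).toLinearMap x := rfl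

/-- The map of completions induced by `ε ⊗ id`. -/
noncomputable def counitLeftHom (ε : U →ₐ[K] K) : HAdic (U ⊗[K] U) →ₐ[K] HAdic U :=
  HAdic.mapAlg ((Algebra.TensorProduct.lid K U).toAlgHom.comp
    (Algebra.TensorProduct.map ε (AlgHom.id K U)))

theorem counitLeftHom_apply (ε : U →ₐ[K] K) (x : HAdic (U ⊗[K] U)) : counitLeftHom ε x =
    HAdic.map ((TensorProduct.lid K U).toLinearMap ∘ₗ
      TensorProduct.map ε.toLinearMap LinearMap.id) x := rfl

/-- The map of completions induced by `id ⊗ ε`. -/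
noncomputable def counitRightHom (ε : U →ₐ[K] K) : HAdic (U ⊗[K] U) →ₐ[K] HAdic U :=
  HAdic.mapAlg ((Algebra.TensorProduct.rid K K U).toAlgHom.comp
    (Algebra.TensorProduct.map (AlgHom.id K U) ε))

theorem counitRightHom_apply (ε : U →ₐ[K] K) (x : HAdic (U ⊗[K] U)) : counitRightHom ε x =
    HAdic.map ((TensorProduct.rid K U).toLinearMap ∘ₗ
      TensorProduct.map LinearMap.id ε.toLinearMap) x := rfl

theorem counitLeftHom_inl (ε : U →ₐ[K] K) (x : U) :
    counitLeftHom ε (HAdic.inl U U (HAdic.of x)) = HAdic.of (ε x • 1) := rfl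

theorem counitLeftHom_inr (ε : U →ₐ[K] K) (x : U) :
    counitLeftHom ε (HAdic.inr U U (HAdic.of x)) = HAdic.of x := by
  have : counitLeftHom ε (HAdic.inr U U (HAdic.of x)) = HAdic.of (ε 1 • x) := rfl
  rw [this, map_one, one_smul]

theorem counitRightHom_inl (ε : U →ₐ[K] K) (x : U) :
    counitRightHom ε (HAdic.inl U U (HAdic.of x)) = HAdic.of x := by
  have : counitRightHom ε (HAdic.inl U U (HAdic.of x)) = HAdic.of (ε 1 • x) := rfl
  rw [this, map_one, one_smul]

theorem counitRightHom_inr (ε : U →ₐ[K] K) (x : U) :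
    counitRightHom ε (HAdic.inr U U (HAdic.of x)) = HAdic.of (ε x • 1) := rfl

/-- The embedding into the first tensor factor of the completed cube. -/
noncomputable def cube₁ (x : U) : HAdic (U ⊗[K] (U ⊗[K] U)) := HAdic.of (x ⊗ₜ (1 ⊗ₜ 1))

/-- The embedding into the second tensor factor of the completed cube. -/
noncomputable def cube₂ (x : U) : HAdic (U ⊗[K] (U ⊗[K] U)) := HAdic.of (1 ⊗ₜ (x ⊗ₜ 1))

/-- The embedding into the third tensor factor of the completed cube. -/
noncomputable def cube₃ (x : U) : HAdic (U ⊗[K] (U ⊗[K] U)) := HAdic.of (1 ⊗ₜ (1 ⊗ₜ x))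

theorem commute_cube₁_cube₂ (x y : U) : Commute (cube₁ x) (cube₂ y) := by
  simp [Commute, SemiconjBy, cube₁, cube₂, ← map_mul]

theorem commute_cube₁_cube₃ (x y : U) : Commute (cube₁ x) (cube₃ y) := by
  simp [Commute, SemiconjBy, cube₁, cube₃, ← map_mul]

theorem commute_cube₂_cube₃ (x y : U) : Commute (cube₂ x) (cube₃ y) := by
  simp [Commute, SemiconjBy, cube₃, cube₂, ← map_mul]

theorem assocHom_inr (x : U) :
    assocHom U (HAdic.inr (U ⊗[K] U) U (HAdic.of x)) = cube₃ x := rfl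

variable (Δ : U →ₐ[K] HAdic (U ⊗[K] U))

/-- The map `Δ ⊗ id`, followed by the associator. -/
noncomputable def comulLeft : HAdic (U ⊗[K] U) →ₐ[K] HAdic (U ⊗[K] (U ⊗[K] U)) :=
  (assocHom U).comp (HAdic.tensorAlg Δ HAdic.of)

/-- The map `id ⊗ Δ`. -/
noncomputable def comulRight : HAdic (U ⊗[K] U) →ₐ[K] HAdic (U ⊗[K] (U ⊗[K] U)) :=
  HAdic.tensorAlg HAdic.of Δ

theorem comulLeft_inl (x : U) :
    comulLeft Δ (HAdic.inl U U (HAdic.of x)) = assocHom U (HAdic.inl _ U (Δ x)) := by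
  rw [comulLeft, AlgHom.comp_apply, HAdic.tensorAlg_inl, HAdic.extendAlg_of]

theorem comulLeft_inr (x : U) : comulLeft Δ (HAdic.inr U U (HAdic.of x)) = cube₃ x := by
  rw [comulLeft, AlgHom.comp_apply, HAdic.tensorAlg_inr, HAdic.extendAlg_of, assocHom_inr]

theorem comulRight_inl (x : U) : comulRight Δ (HAdic.inl U U (HAdic.of x)) = cube₁ x := by
  rw [comulRight, HAdic.tensorAlg_inl, HAdic.extendAlg_of]; rfl

theorem comulRight_inr (x : U) :
    comulRight Δ (HAdic.inr U U (HAdic.of x)) = HAdic.inr U _ (Δ x) := by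
  rw [comulRight, HAdic.tensorAlg_inr, HAdic.extendAlg_of]

/-- Both iterated coproducts are the coproduct formulas applied twice to the three commuting copies
of the generators in the completed cube, so `coprodGen_assoc` applies. -/
theorem coassoc_gen [HComplete U] {a b : ℝ} {v : Gen → U}
    (h : ∀ g, Δ (v g) = coprodGen a b (genL v) (genR v) g) (g : Gen) :
    comulLeft Δ (Δ (v g)) = comulRight Δ (Δ (v g)) := by
  have e1 : (fun g => comulLeft Δ (genL v g)) =
      coprodGen a b (fun g => cube₁ (v g)) fun g => cube₂ (v g) := by
    ext1 g
    rw [genL, comulLeft_inl, h, map_coprodGen, map_coprodGen]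
    rfl
  have e2 : (fun g => comulLeft Δ (genR v g)) = fun g => cube₃ (v g) :=
    funext fun g => comulLeft_inr Δ _
  have e3 : (fun g => comulRight Δ (genL v g)) = fun g => cube₁ (v g) :=
    funext fun g => comulRight_inl Δ _
  have e4 : (fun g => comulRight Δ (genR v g)) =
      coprodGen a b (fun g => cube₂ (v g)) fun g => cube₃ (v g) := by
    ext1 g
    rw [genR, comulRight_inr, h, map_coprodGen]
    rfl
  rw [h, map_coprodGen, map_coprodGen, e1, e2, e3, e4]
  exact coprodGen_assoc b (fun _ _ => commute_cube₁_cube₂ _ _)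
    (fun _ _ => commute_cube₂_cube₃ _ _) g

theorem counit_left_gen [HComplete U] {a b : ℝ} {v : Gen → U} (ε : U →ₐ[K] K)
    (hε : ∀ g, ε (v g) = 0) (g : Gen) : counitLeftHom ε (coprodGen a b (genL v) (genR v) g) = HAdic.of (v g) := by
  have e1 : (fun g => counitLeftHom ε (genL v g)) = fun _ => 0 := funext fun g => by
    rw [genL, counitLeftHom_inl, hε, zero_smul, map_zero]
  have e2 : (fun g => counitLeftHom ε (genR v g)) = fun g => HAdic.of (v g) :=
    funext fun g => counitLeftHom_inr ε _
  rw [map_coprodGen, e1, e2, coprodGen_zero_left]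

theorem counit_right_gen [HComplete U] {a b : ℝ} {v : Gen → U} (ε : U →ₐ[K] K)
    (hε : ∀ g, ε (v g) = 0) (g : Gen) : counitRightHom ε (coprodGen a b (genL v) (genR v) g) = HAdic.of (v g) := by
  have e1 : (fun g => counitRightHom ε (genR v g)) = fun _ => 0 := funext fun g => by
    rw [genR, counitRightHom_inr, hε, zero_smul, map_zero]
  have e2 : (fun g => counitRightHom ε (genL v g)) = fun g => HAdic.of (v g) :=
    funext fun g => counitRightHom_inl ε _
  rw [map_coprodGen, e1, e2, coprodGen_zero_right]

end Axioms

/-- The elements satisfying the axiom form a subalgebra by `hmul`, and the axiom is a closed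
condition. -/
theorem antipode_of_gen {a : ℝ} (Δ : UqGl2 a →ₐ[K] HAdic (UqGl2 a ⊗[K] UqGl2 a))
    (ε : UqGl2 a →ₐ[K] K) (hε : ∀ g, ε (UqGl2.gen a g) = 0)
    (T : HAdic (UqGl2 a ⊗[K] UqGl2 a) →ₗ[K] HAdic (UqGl2 a)) (h1 : T 1 = 1)
    (hmul : ∀ X Y k l, T X = algebraMap K _ k → T Y = algebraMap K _ l →
      T (X * Y) = algebraMap K _ (k * l))
    (hgen : ∀ g, T (Δ (UqGl2.gen a g)) = 0) (x : UqGl2 a) :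
    T (Δ x) = HAdic.of (algebraMap K (UqGl2 a) (ε x)) := by
  let S : Subalgebra K (UqGl2 a) :=
    { carrier := {x | T (Δ x) = algebraMap K _ (ε x)}
      mul_mem' := fun {x y} hx hy => by
        change T (Δ (x * y)) = _
        rw [map_mul Δ, map_mul ε]
        exact hmul _ _ _ _ hx hy
      add_mem' := fun {x y} hx hy => by
        change T (Δ (x + y)) = _
        rw [map_add, map_add, map_add, map_add, hx, hy]
      algebraMap_mem' := fun k => by
        change T (Δ (algebraMap K _ k)) = _
        rw [AlgHom.commutes, AlgHom.commutes, Algebra.algebraMap_eq_smul_one, map_smul, h1,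
          Algebra.algebraMap_self_apply, ← Algebra.algebraMap_eq_smul_one] }
  exact UqGl2.induction_eq (f := T ∘ₗ Δ.toLinearMap)
    (g := (HAdic.of.comp ((Algebra.ofId K (UqGl2 a)).comp ε)).toLinearMap) S
    (fun x hx => hx) (fun g => by
      change T (Δ _) = _
      rw [hgen, hε, map_zero]) x

theorem IsUab.comul_gen {a b : ℝ} {H : HAdicHopf (UqGl2 a)} (h : IsUab a b H) (g : Gen) :
    H.comul (UqGl2.gen a g) = coprodGen a b (genL (UqGl2.gen a)) (genR (UqGl2.gen a)) g := by
  rw [coprodGen_genL_genR]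
  simp only [← UqGl2.cartanExp_eq_cexp]
  cases g
  · exact h.comul_J3
  · exact h.comul_Jp
  · exact h.comul_Jm
  · exact h.comul_I

theorem antipode_left_aux {a : ℝ} (b : ℝ) (g : Gen) :
    HAdic.map (LinearMap.mul' K (UqGl2 a) ∘ₗ TensorProduct.map (antipodeLin a) LinearMap.id)
      (coprodGen a b (genL (UqGl2.gen a)) (genR (UqGl2.gen a)) g) = 0 := by
  have hJp := (UqGl2.isRep_gen a).cexp_Jp
  have hJm := (UqGl2.isRep_gen a).cexp_Jm
  rw [coprodGen_genL_genR]
  simp only [← UqGl2.cartanExp_eq_cexp] at *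
  cases g <;>
    simp only [map_add, HAdic.map_of, LinearMap.comp_apply, TensorProduct.map_tmul,
      LinearMap.mul'_apply, LinearMap.id_apply, antipodeLin_cartanExp, antipodeLin_gen, antipodeGen,
      antipodeLin_one, hJp, hJm, smul_smul, ← expSeries_add, neg_mul, smul_mul_assoc, neg_neg,
      map_neg, one_mul, mul_one, neg_add_cancel, add_neg_cancel,
      expSeries_zero, one_smul]

theorem antipode_right_aux {a : ℝ} (b : ℝ) (g : Gen) :
    HAdic.map (LinearMap.mul' K (UqGl2 a) ∘ₗ TensorProduct.map LinearMap.id (antipodeLin a))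
      (coprodGen a b (genL (UqGl2.gen a)) (genR (UqGl2.gen a)) g) = 0 := by
  have hJp := (UqGl2.isRep_gen a).cexp_Jp
  have hJm := (UqGl2.isRep_gen a).cexp_Jm
  rw [coprodGen_genL_genR]
  simp only [← UqGl2.cartanExp_eq_cexp] at *
  cases g <;>
    simp only [map_add, HAdic.map_of, LinearMap.comp_apply, TensorProduct.map_tmul,
      LinearMap.mul'_apply, LinearMap.id_apply, antipodeLin_cartanExp, antipodeLin_gen, antipodeGen,
      antipodeLin_one, hJp, hJm, mul_neg, mul_smul_comm, neg_neg, map_neg, one_mul, mul_one,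
      neg_add_cancel]

/-- The Hopf algebra `U_{a,b}(gl(2))`. -/
noncomputable def hopfUab {a : ℝ} (ha : a ≠ 0) (b : ℝ) : HAdicHopf (UqGl2 a) where
  comul := comulHom ha b
  counit := counitHom a
  antipode := antipodeLin a
  coassoc x := by
    have : (comulLeft (comulHom ha b)).comp (comulHom ha b) =
        (comulRight (comulHom ha b)).comp (comulHom ha b) :=
      UqGl2.algHom_ext fun g => coassoc_gen _ (comulHom_gen ha b) g
    have := AlgHom.congr_fun this x
    simp only [AlgHom.comp_apply, comulLeft, comulRight, HAdic.tensorAlg_apply,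
      assocHom_apply] at this
    exact this
  counit_left x := by
    have : (counitLeftHom (counitHom a)).comp (comulHom ha b) = HAdic.of :=
      UqGl2.algHom_ext fun g => by
        rw [AlgHom.comp_apply, comulHom_gen]
        exact counit_left_gen _ (counitHom_gen a) g
    exact AlgHom.congr_fun this x
  counit_right x := by
    have : (counitRightHom (counitHom a)).comp (comulHom ha b) = HAdic.of :=
      UqGl2.algHom_ext fun g => by
        rw [AlgHom.comp_apply, comulHom_gen]
        exact counit_right_gen _ (counitHom_gen a) g
    exact AlgHom.congr_fun this x
  antipode_left x := by
    refine antipode_of_gen _ _ (counitHom_gen a) _ ?_ (fun X Y k l hX hY => ?_) (fun g => ?_) x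
    · rw [← map_one HAdic.of, HAdic.map_of]
      exact congrArg HAdic.of ((mul_one _).trans antipodeLin_one)
    · rw [antipode_left_mul _ antipodeLin_mul hX, hY, map_mul, Algebra.smul_def]
    · rw [comulHom_gen, antipode_left_aux]
  antipode_right x := by
    refine antipode_of_gen _ _ (counitHom_gen a) _ ?_ (fun X Y k l hX hY => ?_) (fun g => ?_) x
    · rw [← map_one HAdic.of, HAdic.map_of]
      exact congrArg HAdic.of ((one_mul _).trans antipodeLin_one)
    · rw [antipode_right_mul _ antipodeLin_mul hY, hX, mul_comm k, map_mul, Algebra.smul_def]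
    · rw [comulHom_gen, antipode_right_aux]

theorem isUab_hopfUab {a : ℝ} (ha : a ≠ 0) (b : ℝ) : IsUab a b (hopfUab ha b) := by
  have h : ∀ g, (hopfUab ha b).comul (UqGl2.gen a g) =
      coprodGen a b (genL (UqGl2.gen a)) (genR (UqGl2.gen a)) g := comulHom_gen ha b
  simp only [coprodGen_genL_genR, ← UqGl2.cartanExp_eq_cexp] at h
  exact ⟨h .I, h .J3, h .Jp, h .Jm, counitHom_gen a⟩

/-- Coproduct and counit are determined on generators, and the antipode is then determined by them.
-/
theorem existsUnique_hopf {a : ℝ} (ha : a ≠ 0) (b : ℝ) :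
    ∃! H : HAdicHopf (UqGl2 a), IsUab a b H :=
  ⟨hopfUab ha b, isUab_hopfUab ha b, fun H hH => HAdicHopf.eq_of
    (UqGl2.algHom_ext fun g => by rw [hH.comul_gen, (isUab_hopfUab ha b).comul_gen])
    (UqGl2.algHom_ext fun g => by rw [hH.counit_gen, (isUab_hopfUab ha b).counit_gen])⟩

/-! ### The classical limit -/

/-- The enveloping algebra `U(gl(2))`. -/
def ClassicalU : Type := UniversalEnvelopingAlgebra ℝ Gl2

noncomputable instance : Ring ClassicalU :=
  inferInstanceAs (Ring (UniversalEnvelopingAlgebra ℝ Gl2))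

noncomputable instance : Algebra ℝ ClassicalU :=
  inferInstanceAs (Algebra ℝ (UniversalEnvelopingAlgebra ℝ Gl2))

noncomputable instance : Algebra K ClassicalU :=
  Algebra.compHom ClassicalU (PowerSeries.constantCoeff : K →+* ℝ)

theorem HComplete.of_hbar_smul {M : Type*} [AddCommGroup M] [Module K M]
    (h : ∀ x : M, hbar • x = 0) : HComplete M where
  sep x hx := by
    obtain ⟨z, hz⟩ := hx 1
    rw [hz, pow_one, h]
  compl c := by
    refine ⟨c 0, fun n => ?_⟩
    cases n with
    | zero => exact ⟨c 0, by simp⟩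
    | succ n =>
      refine ⟨0, ?_⟩
      rw [Finset.sum_range_succ', Finset.sum_eq_zero fun i _ => by rw [pow_succ', mul_smul, h]]
      simp

theorem ClassicalU.smul_def (k : K) (x : ClassicalU) :
    k • x = PowerSeries.constantCoeff k • x := rfl

theorem ClassicalU.hbar_smul (x : ClassicalU) : hbar • x = 0 := by
  rw [ClassicalU.smul_def, PowerSeries.constantCoeff_X, zero_smul]

instance : HComplete ClassicalU := .of_hbar_smul ClassicalU.hbar_smul

section

attribute [local instance 100] LieRing.ofAssociativeRing

/-- The image of an element of `gl(2)` in the enveloping algebra. -/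
noncomputable def ClassicalU.ι : Gl2 →ₗ[ℝ] ClassicalU :=
  show Gl2 →ₗ[ℝ] UniversalEnvelopingAlgebra ℝ Gl2 from
    LieHom.toLinearMap (UniversalEnvelopingAlgebra.ι ℝ)

theorem ClassicalU.lie (x y : Gl2) : ClassicalU.ι ⁅x, y⁆ =
    ClassicalU.ι x * ClassicalU.ι y - ClassicalU.ι y * ClassicalU.ι x :=
  (LieHom.map_lie (UniversalEnvelopingAlgebra.ι ℝ) x y).trans
    (LieRing.of_associative_ring_bracket _ _)

theorem ClassicalU.exists_lift {A : Type*} [Ring A] [Algebra ℝ A] (f : Gl2 →ₗ[ℝ] A)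
    (hf : ∀ x y, f ⁅x, y⁆ = f x * f y - f y * f x) :
    ∃ F : ClassicalU →ₐ[ℝ] A, ∀ x, F (ClassicalU.ι x) = f x :=
  ⟨UniversalEnvelopingAlgebra.lift ℝ { f with
    map_lie' := fun {x y} => (hf x y).trans (LieRing.of_associative_ring_bracket _ _).symm },
    UniversalEnvelopingAlgebra.lift_ι_apply ℝ _⟩

/-- The universal property gives a homomorphism into `S`; followed by the inclusion it agrees with
the identity on `gl(2)`, hence everywhere. -/
theorem ClassicalU.mem_of_ι_mem (S : Subalgebra ℝ ClassicalU)
    (hS : ∀ x, ClassicalU.ι x ∈ S) (x : ClassicalU) : x ∈ S := by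
  obtain ⟨F, hF⟩ := ClassicalU.exists_lift (A := S) (ClassicalU.ι.codRestrict S.toSubmodule hS)
    fun x y => Subtype.ext (ClassicalU.lie x y)
  have : S.val.comp F = AlgHom.id ℝ ClassicalU :=
    UniversalEnvelopingAlgebra.hom_ext ℝ (LieHom.ext fun x => congrArg Subtype.val (hF x))
  have := AlgHom.congr_fun this x
  rw [AlgHom.id_apply] at this
  rw [← this]
  exact (F x).2

end

/-- The generators of the enveloping algebra. -/
noncomputable def ClassicalU.gen (g : Gen) : ClassicalU := ClassicalU.ι (Gen.mat ℝ g)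

theorem lie_J3_Jp : ⁅Gen.mat ℝ .J3, Gen.mat ℝ .Jp⁆ = (2 : ℝ) • Gen.mat ℝ .Jp := by
  rw [LieRing.of_associative_ring_bracket]
  ext i j
  fin_cases i <;> fin_cases j <;> norm_num [Gen.mat, Matrix.mul_apply, Fin.sum_univ_two]

theorem lie_J3_Jm : ⁅Gen.mat ℝ .J3, Gen.mat ℝ .Jm⁆ = -((2 : ℝ) • Gen.mat ℝ .Jm) := by
  rw [LieRing.of_associative_ring_bracket]
  ext i j
  fin_cases i <;> fin_cases j <;> norm_num [Gen.mat, Matrix.mul_apply, Fin.sum_univ_two]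

theorem lie_Jp_Jm : ⁅Gen.mat ℝ .Jp, Gen.mat ℝ .Jm⁆ = Gen.mat ℝ .J3 := by
  rw [LieRing.of_associative_ring_bracket]
  ext i j
  fin_cases i <;> fin_cases j <;> norm_num [Gen.mat, Matrix.mul_apply, Fin.sum_univ_two]

theorem lie_I (x : Gl2) : ⁅Gen.mat ℝ .I, x⁆ = 0 := by
  rw [LieRing.of_associative_ring_bracket, Gen.mat, one_mul, mul_one, sub_self]

/-- `ℏ` acts as zero on `ClassicalU`, so this algebra is trivially complete and `sinh(aℏJ₃)/(aℏ)` is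
`J₃` there. -/
theorem isRep_classical (a : ℝ) : IsRep a ClassicalU.gen where
  J3_Jp := by
    have := (ClassicalU.lie (Gen.mat ℝ .J3) (Gen.mat ℝ .Jp)).symm
    rw [lie_J3_Jp, map_smul, two_smul, ← two_mul] at this
    exact this
  J3_Jm := by
    have := (ClassicalU.lie (Gen.mat ℝ .J3) (Gen.mat ℝ .Jm)).symm
    rw [lie_J3_Jm, map_neg, map_smul, two_smul, ← two_mul] at this
    exact this
  Jp_Jm := by
    have := (ClassicalU.lie (Gen.mat ℝ .Jp) (Gen.mat ℝ .Jm)).symm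
    rw [lie_Jp_Jm] at this
    obtain ⟨z, hz⟩ := hSinhDiv_eq_add a (ClassicalU.gen .J3)
    rw [hz, ClassicalU.hbar_smul, add_zero]
    exact this
  I_comm g := by
    have := (ClassicalU.lie (Gen.mat ℝ .I) (Gen.mat ℝ g)).symm
    rw [lie_I, map_zero, sub_eq_zero] at this
    exact this

/-- The classical limit `U → U(gl(2))`. -/
noncomputable def classicalLimit (a : ℝ) : UqGl2 a →ₐ[K] ClassicalU :=
  UqGl2.lift (isRep_classical a)

theorem classicalLimit_gen (a : ℝ) (g : Gen) :
    classicalLimit a (UqGl2.gen a g) = ClassicalU.gen g := UqGl2.lift_gen _ g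

theorem classicalLimit_hbar_smul {a : ℝ} (x : UqGl2 a) : classicalLimit a (hbar • x) = 0 := by
  rw [map_smul, ClassicalU.hbar_smul]

/-- The bracket of `gl(2)` in the coordinates `J₃, I, J₊, J₋`, inside any algebra satisfying the
undeformed relations. -/
theorem gl2_commutator {R C : Type*} [CommRing R] [Ring C] [Algebra R C] {e f h i : C}
    (h1 : h * e = e * h + (2 : R) • e) (h2 : h * f = f * h - (2 : R) • f) (h3 : e * f = f * e + h)
    (h4 : i * h = h * i) (h5 : i * e = e * i) (h6 : i * f = f * i) (p q p' q' r s r' s' : R) :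
    (r * s' - s * r') • h + (0 : R) • i + (2 * (p * s) - 2 * (q * r)) • e +
        (2 * (q * r') - 2 * (p * s')) • f =
      (p • h + p' • i + r • e + r' • f) * (q • h + q' • i + s • e + s' • f) -
        (q • h + q' • i + s • e + s' • f) * (p • h + p' • i + r • e + r' • f) := by
  simp only [mul_add, add_mul, smul_mul_smul_comm, h1, h2, h3, h4, h5, h6]
  module

/-! ### Linear extension from the generators to `gl(2)`, and the reduction modulo `ℏ` -/

section LinGen

variable {C D : Type*} [Ring C] [Algebra K C] [Ring D] [Algebra K D]

/-- The linear combination of a family of elements with the coordinates of a matrix. -/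
noncomputable def linGen (v : Gen → C) : Gl2 →+ C where
  toFun x := (PowerSeries.C ((x 0 0 - x 1 1) / 2) : K) • v .J3 +
    (PowerSeries.C ((x 0 0 + x 1 1) / 2) : K) • v .I +
    (PowerSeries.C (x 0 1) : K) • v .Jp + (PowerSeries.C (x 1 0) : K) • v .Jm
  map_zero' := by simp
  map_add' x y := by
    simp only [Matrix.add_apply, map_add, add_smul]
    rw [show (x 0 0 + y 0 0 - (x 1 1 + y 1 1)) / 2 = (x 0 0 - x 1 1) / 2 + (y 0 0 - y 1 1) / 2 by
      ring, show (x 0 0 + y 0 0 + (x 1 1 + y 1 1)) / 2 = (x 0 0 + x 1 1) / 2 + (y 0 0 + y 1 1) / 2 by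
      ring]
    simp only [map_add, add_smul]
    abel

theorem linGen_apply (v : Gen → C) (x : Gl2) : linGen v x =
    (PowerSeries.C ((x 0 0 - x 1 1) / 2) : K) • v .J3 +
    (PowerSeries.C ((x 0 0 + x 1 1) / 2) : K) • v .I +
    (PowerSeries.C (x 0 1) : K) • v .Jp + (PowerSeries.C (x 1 0) : K) • v .Jm := rfl

theorem linGen_mat (v : Gen → C) (g : Gen) : linGen v (Gen.mat ℝ g) = v g := by
  cases g <;> simp [linGen_apply, Gen.mat]

theorem linGen_smul (v : Gen → C) (r : ℝ) (x : Gl2) :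
    linGen v (r • x) = (PowerSeries.C r : K) • linGen v x := by
  simp only [linGen_apply, Matrix.smul_apply, smul_eq_mul, smul_add, smul_smul, ← map_mul]
  rw [show (r * x 0 0 - r * x 1 1) / 2 = r * ((x 0 0 - x 1 1) / 2) by ring,
    show (r * x 0 0 + r * x 1 1) / 2 = r * ((x 0 0 + x 1 1) / 2) by ring]

theorem map_linGen (f : C →ₗ[K] D) (v : Gen → C) (x : Gl2) :
    f (linGen v x) = linGen (fun g => f (v g)) x := by
  simp [linGen_apply]

theorem linGen_lie {a : ℝ} {v : Gen → C} [HComplete C] (h : IsRep a v)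
    (hC : ∀ x : C, hbar • x = 0) (x y : Gl2) :
    linGen v ⁅x, y⁆ = linGen v x * linGen v y - linGen v y * linGen v x := by
  have h1 : v .J3 * v .Jp = v .Jp * v .J3 + (2 : K) • v .Jp := by
    rw [two_smul, ← two_mul, ← h.J3_Jp]; abel
  have h2 : v .J3 * v .Jm = v .Jm * v .J3 - (2 : K) • v .Jm := by
    rw [two_smul, ← two_mul, sub_eq_add_neg, ← h.J3_Jm]; abel
  have h3 : v .Jp * v .Jm = v .Jm * v .Jp + v .J3 := by
    obtain ⟨z, hz⟩ := hSinhDiv_eq_add a (v .J3)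
    rw [← sub_eq_iff_eq_add', h.Jp_Jm, hz, hC, add_zero]
  have h4 := h.I_comm
  rw [LieRing.of_associative_ring_bracket]
  simp only [linGen_apply]
  rw [show ((x * y - y * x) 0 0 - (x * y - y * x) 1 1) / 2 = x 0 1 * y 1 0 - y 0 1 * x 1 0 by
      simp only [Matrix.sub_apply, Matrix.mul_apply, Fin.sum_univ_two]; ring,
    show ((x * y - y * x) 0 0 + (x * y - y * x) 1 1) / 2 = 0 by
      simp only [Matrix.sub_apply, Matrix.mul_apply, Fin.sum_univ_two]; ring,
    show (x * y - y * x) 0 1 =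
        2 * ((x 0 0 - x 1 1) / 2 * y 0 1) - 2 * ((y 0 0 - y 1 1) / 2 * x 0 1) by
      simp only [Matrix.sub_apply, Matrix.mul_apply, Fin.sum_univ_two]; ring,
    show (x * y - y * x) 1 0 =
        2 * ((y 0 0 - y 1 1) / 2 * x 1 0) - 2 * ((x 0 0 - x 1 1) / 2 * y 1 0) by
      simp only [Matrix.sub_apply, Matrix.mul_apply, Fin.sum_univ_two]; ring]
  generalize (x 0 0 - x 1 1) / 2 = p
  generalize (y 0 0 - y 1 1) / 2 = q
  generalize (x 0 0 + x 1 1) / 2 = p'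
  generalize (y 0 0 + y 1 1) / 2 = q'
  simp only [map_sub, map_mul, map_zero, map_ofNat]
  exact gl2_commutator h1 h2 h3 (h4 _) (h4 _) (h4 _) _ _ _ _ _ _ _ _

end LinGen

theorem classicalLimit_linGen (a : ℝ) (x : Gl2) :
    classicalLimit a (linGen (UqGl2.gen a) x) = ClassicalU.ι x := by
  have h := map_linGen (classicalLimit a).toLinearMap (UqGl2.gen a) x
  refine h.trans ?_
  simp only [AlgHom.toLinearMap_apply, classicalLimit_gen, linGen_apply, ClassicalU.smul_def,
    PowerSeries.constantCoeff_C, ClassicalU.gen, ← map_smul, ← map_add]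
  congr 1
  ext i j
  fin_cases i <;> fin_cases j <;> simp [Gen.mat] <;> ring

/-- The reduction of `U` modulo `ℏ`. -/
abbrev UMod (a : ℝ) : Type := (modPow (UqGl2 a) 1).Quotient

/-- The quotient map to the reduction modulo `ℏ`. -/
noncomputable def toUMod (a : ℝ) : UqGl2 a →ₐ[K] UMod a := (modPow (UqGl2 a) 1).mkₐ (α := K)

theorem toUMod_surjective (a : ℝ) : Function.Surjective (toUMod a) := RingCon.mkₐ_surjective _

theorem toUMod_eq_zero {a : ℝ} {x : UqGl2 a} (h : toUMod a x = 0) : ∃ z, x = hbar • z := by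
  have : (x : UMod a) = 0 := h
  simpa only [pow_one] using HAdic.eq_zero_iff.1 this

theorem hbar_smul_UMod {a : ℝ} (x : UMod a) : hbar • x = 0 := by
  obtain ⟨x, rfl⟩ := toUMod_surjective a x
  rw [← map_smul]
  exact HAdic.eq_zero_iff.2 ⟨x, by rw [pow_one]⟩

instance (a : ℝ) : HComplete (UMod a) := .of_hbar_smul hbar_smul_UMod

theorem smul_UMod {a : ℝ} (k : K) (x : UMod a) :
    k • x = (PowerSeries.C (PowerSeries.constantCoeff k) : K) • x := by
  have : (PowerSeries.X : K) ∣ k - PowerSeries.C (PowerSeries.constantCoeff k) := by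
    rw [PowerSeries.X_dvd_iff]; simp
  obtain ⟨z, hz⟩ := this
  rw [← sub_eq_zero, ← sub_smul, hz, mul_comm, mul_smul, hbar_smul_UMod, smul_zero]

theorem FreeSeries.smul_eq (r : ℝ) (x : FreeSeries) : r • x = (PowerSeries.C r : K) • x := by
  ext n
  rw [Algebra.smul_def (PowerSeries.C r : K), FreeSeries.algebraMap_eq, PowerSeries.map_C,
    PowerSeries.coeff_C_mul, PowerSeries.coeff_smul, Algebra.smul_def]

/-- The generators satisfy the undeformed relations in `U / ℏU`, so the universal property of the
enveloping algebra yields the inverse of the classical limit. -/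
theorem exists_section (a : ℝ) : ∃ F : ClassicalU →ₐ[K] UMod a,
    ∀ x, F (ClassicalU.ι x) = linGen (fun g => toUMod a (UqGl2.gen a g)) x := by
  -- The real scalars that the quotient inherits from power series over the free algebra act as the
  -- constants of `K`.
  have hsm : ∀ (r : ℝ) (x : UMod a), r • x = (PowerSeries.C r : K) • x := fun r x => by
    obtain ⟨x, rfl⟩ := toUMod_surjective a x
    obtain ⟨x, rfl⟩ := UqGl2.mk_surjective a x
    exact congrArg (fun y => toUMod a (UqGl2.mk a y)) (FreeSeries.smul_eq r x)
  obtain ⟨F, hF⟩ := ClassicalU.exists_lift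
    ({ linGen (fun g => toUMod a (UqGl2.gen a g)) with
      map_smul' := fun r x => (linGen_smul _ r x).trans (hsm _ _).symm } : Gl2 →ₗ[ℝ] UMod a)
    fun x y => linGen_lie ((UqGl2.isRep_gen a).map (toUMod a)) hbar_smul_UMod x y
  refine ⟨AlgHom.ofLinearMap { F with map_smul' := fun k x => ?_ } (map_one F) (map_mul F), hF⟩
  change F (k • x) = k • F x
  rw [ClassicalU.smul_def, map_smul, smul_UMod, hsm]

/-- The classical limit followed by the map of `exists_section` is reduction modulo `ℏ`, since both
agree on generators. No basis of `U(gl(2))` is needed. -/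
theorem classicalLimit_eq_zero_iff {a : ℝ} (u : UqGl2 a) :
    classicalLimit a u = 0 ↔ ∃ v, u = hbar • v := by
  refine ⟨fun h => ?_, fun ⟨v, hv⟩ => by rw [hv, classicalLimit_hbar_smul]⟩
  obtain ⟨F, hF⟩ := exists_section a
  have : F.comp (classicalLimit a) = toUMod a := UqGl2.algHom_ext fun g => by
    rw [AlgHom.comp_apply, classicalLimit_gen, ClassicalU.gen, hF, linGen_mat]
  apply toUMod_eq_zero
  rw [← this, AlgHom.comp_apply, h, map_zero]

theorem classicalLimit_surjective (a : ℝ) : Function.Surjective (classicalLimit a) := by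
  let S : Subalgebra ℝ ClassicalU :=
    { (classicalLimit a).range.toSubsemiring with
      algebraMap_mem' := fun r => ⟨algebraMap K _ (PowerSeries.C r), by
        change classicalLimit a _ = _
        rw [AlgHom.commutes, Algebra.algebraMap_eq_smul_one, ClassicalU.smul_def,
          PowerSeries.constantCoeff_C, Algebra.algebraMap_eq_smul_one]⟩ }
  exact fun x => ClassicalU.mem_of_ι_mem S (fun x => ⟨_, classicalLimit_linGen a x⟩) x

theorem exists_eq_linGen_add {a : ℝ} {x : Gl2} {u : UqGl2 a}
    (h : classicalLimit a u = ClassicalU.ι x) :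
    ∃ v, u = linGen (UqGl2.gen a) x + hbar • v := by
  have : classicalLimit a (u - linGen (UqGl2.gen a) x) = 0 := by
    rw [map_sub, h, classicalLimit_linGen, sub_self]
  obtain ⟨v, hv⟩ := (classicalLimit_eq_zero_iff _).1 this
  exact ⟨v, by rw [← hv, add_sub_cancel]⟩

/-! ### The semiclassical expansion of the coproduct -/

section Expansion

variable {U : Type*} [Ring U] [Algebra K U]

/-- The exponent of a Cartan exponential. -/
noncomputable def cartanLin (v : Gen → U) (s t : ℝ) : U :=
  (PowerSeries.C (s / 2) : K) • v .J3 + (PowerSeries.C (t / 2) : K) • v .I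

/-- The linear term in `ℏ` of the coproduct of the generators. -/
noncomputable def coprodLin (a b : ℝ) (v : Gen → U) : Gen → U ⊗[K] U
  | .J3 => 0
  | .I => 0
  | .Jp => cartanLin v a (-b) ⊗ₜ v .Jp + v .Jp ⊗ₜ cartanLin v (-a) b
  | .Jm => cartanLin v a b ⊗ₜ v .Jm + v .Jm ⊗ₜ cartanLin v (-a) (-b)

theorem cexp_eq_add [HComplete U] (v : Gen → U) (s t : ℝ) :
    ∃ z, cexp v s t = 1 + hbar • cartanLin v s t + hbar ^ 2 • z := hExp_eq_add _

theorem tmul_add_tmul_expand {x y c d z w : U} :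
    (1 + hbar • c + hbar ^ 2 • z) ⊗ₜ[K] x + y ⊗ₜ[K] (1 + hbar • d + hbar ^ 2 • w) =
      (y ⊗ₜ 1 + 1 ⊗ₜ x) + hbar • (c ⊗ₜ x + y ⊗ₜ d) + hbar ^ 2 • (z ⊗ₜ x + y ⊗ₜ w) := by
  simp only [TensorProduct.add_tmul, TensorProduct.tmul_add, TensorProduct.tmul_smul,
    smul_add, ← TensorProduct.smul_tmul']
  abel

/-- Only the Cartan exponentials depend on `ℏ`, and they are expanded to second order. -/
theorem coprodGen_expand [HComplete U] (a b : ℝ) (v : Gen → U) (g : Gen) :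
    ∃ t, coprodGen a b (genL v) (genR v) g = HAdic.of (v g ⊗ₜ 1 + 1 ⊗ₜ v g) +
      hbar • HAdic.of (coprodLin a b v g) + hbar ^ 2 • t := by
  rw [coprodGen_genL_genR]
  cases g
  · exact ⟨0, by simp only [coprodLin, map_zero, smul_zero, add_zero]; rw [add_comm]⟩
  · obtain ⟨z, hz⟩ := cexp_eq_add v a (-b)
    obtain ⟨w, hw⟩ := cexp_eq_add v (-a) b
    simp only [hz, hw, tmul_add_tmul_expand]
    exact ⟨HAdic.of (z ⊗ₜ v .Jp + v .Jp ⊗ₜ w), by rw [map_add, map_add, map_smul, map_smul]; rfl⟩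
  · obtain ⟨z, hz⟩ := cexp_eq_add v a b
    obtain ⟨w, hw⟩ := cexp_eq_add v (-a) (-b)
    simp only [hz, hw, tmul_add_tmul_expand]
    exact ⟨HAdic.of (z ⊗ₜ v .Jm + v .Jm ⊗ₜ w), by rw [map_add, map_add, map_smul, map_smul]; rfl⟩
  · exact ⟨0, by simp only [coprodLin, map_zero, smul_zero, add_zero]; rw [add_comm]⟩

/-- The flip on the completed tensor square. -/
noncomputable def flipHom (U : Type*) [Ring U] [Algebra K U] :
    HAdic (U ⊗[K] U) →ₐ[K] HAdic (U ⊗[K] U) :=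
  HAdic.mapAlg (Algebra.TensorProduct.comm K U U).toAlgHom

theorem flipHom_apply (x : HAdic (U ⊗[K] U)) :
    flipHom U x = HAdic.map (TensorProduct.comm K U U).toLinearMap x := rfl

theorem flipHom_of (x : U ⊗[K] U) :
    flipHom U (HAdic.of x) = HAdic.of (TensorProduct.comm K U U x) := rfl

/-- The additive map `x ⊗ y ↦ x ⊗ y` from the tensor square of `gl(2)`. -/
noncomputable def linGenTensor (v : Gen → U) : Gl2 ⊗[ℝ] Gl2 →+ U ⊗[K] U :=
  TensorProduct.liftAddHom
    { toFun := fun x =>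
        { toFun := fun y => linGen v x ⊗ₜ linGen v y
          map_zero' := by rw [map_zero, TensorProduct.tmul_zero]
          map_add' := fun y z => by rw [map_add, TensorProduct.tmul_add] }
      map_zero' := by ext y; simp
      map_add' := fun x y => by ext z; simp [TensorProduct.add_tmul] }
    fun r x y => by simp [linGen_smul, TensorProduct.smul_tmul]

theorem linGenTensor_tmul (v : Gen → U) (x y : Gl2) :
    linGenTensor v (x ⊗ₜ y) = linGen v x ⊗ₜ linGen v y := rfl

theorem linGenTensor_smul (v : Gen → U) (r : ℝ) (t : Gl2 ⊗[ℝ] Gl2) :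
    linGenTensor v (r • t) = (PowerSeries.C r : K) • linGenTensor v t := by
  induction t using TensorProduct.induction_on with
  | zero => simp
  | tmul x y =>
    rw [TensorProduct.smul_tmul', linGenTensor_tmul, linGenTensor_tmul, linGen_smul,
      TensorProduct.smul_tmul']
  | add x y hx hy => rw [smul_add, map_add, map_add, smul_add, hx, hy]

theorem linGenTensor_wedge (v : Gen → U) (g g' : Gen) :
    linGenTensor v (wedge (Gen.mat ℝ g) (Gen.mat ℝ g')) = wedge (v g) (v g') := by
  rw [wedge, map_sub, linGenTensor_tmul, linGenTensor_tmul, linGen_mat, linGen_mat, wedge]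

theorem linGenTensor_cocomm (a b : ℝ) (v : Gen → U) (x : Gl2) :
    linGenTensor v (cocomm a b x) =
      (PowerSeries.C (x 0 1) : K) • ((PowerSeries.C a : K) • wedge (v .J3) (v .Jp) +
        (PowerSeries.C b : K) • wedge (v .Jp) (v .I)) +
      (PowerSeries.C (x 1 0) : K) • ((PowerSeries.C a : K) • wedge (v .J3) (v .Jm) -
        (PowerSeries.C b : K) • wedge (v .Jm) (v .I)) := by
  simp only [cocomm, LinearMap.add_apply, LinearMap.smulRight_apply, map_add, map_sub,
    linGenTensor_smul, linGenTensor_wedge, Matrix.entryLinearMap_apply]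

/-- Each Cartan exponent carries a factor `½`; the two summands of the coproduct contribute equally
to the antisymmetrisation, which restores the coefficients `a` and `b` of the cocommutator. -/
theorem coprodLin_sub_flip (a b : ℝ) (v : Gen → U) (x : Gl2) :
    linGen (fun g => HAdic.of (coprodLin a b v g)) x -
      flipHom U (linGen (fun g => HAdic.of (coprodLin a b v g)) x) =
      HAdic.of (linGenTensor v (cocomm a b x)) := by
  have half : ∀ r : ℝ, (PowerSeries.C r : K) = PowerSeries.C (r / 2) + PowerSeries.C (r / 2) :=
    fun r => by rw [← map_add]; congr 1; ring
  rw [linGenTensor_cocomm, half a, half b]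
  simp only [linGen_apply, coprodLin, map_add, map_smul, flipHom_of, map_zero, smul_zero, zero_add,
    TensorProduct.comm_tmul, cartanLin, wedge, TensorProduct.add_tmul, TensorProduct.tmul_add,
    TensorProduct.tmul_smul, ← TensorProduct.smul_tmul', map_sub, neg_div, map_neg,
    smul_add, smul_sub, neg_smul, smul_neg, add_smul, TensorProduct.neg_tmul, TensorProduct.tmul_neg]
  abel

theorem exists_tensor_eq {v : Gen → U} {n : ℕ} {y z : Fin n → Gl2} {p q : Fin n → U}
    (hp : ∀ i, ∃ w, p i = linGen v (y i) + hbar • w)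
    (hq : ∀ i, ∃ w, q i = linGen v (z i) + hbar • w) :
    ∃ t, ∑ i, p i ⊗ₜ[K] q i = linGenTensor v (∑ i, y i ⊗ₜ z i) + hbar • t := by
  choose p' hp' using hp
  choose q' hq' using hq
  refine ⟨∑ i, (linGen v (y i) ⊗ₜ q' i + p' i ⊗ₜ q i), ?_⟩
  rw [map_sum, Finset.smul_sum, ← Finset.sum_add_distrib]
  refine Finset.sum_congr rfl fun i _ => ?_
  rw [linGenTensor_tmul, smul_add, ← TensorProduct.tmul_smul, TensorProduct.smul_tmul', ← add_assoc,
    ← TensorProduct.tmul_add, ← hq', ← TensorProduct.add_tmul, ← hp']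

theorem smul_expand_four {R M : Type*} [CommRing R] [AddCommGroup M] [Module R M]
    (h c₁ c₂ c₃ c₄ : R) (x₁ x₂ x₃ x₄ y₁ y₂ y₃ y₄ z₁ z₂ z₃ z₄ : M) :
    c₁ • (x₁ + h • y₁ + h ^ 2 • z₁) + c₂ • (x₂ + h • y₂ + h ^ 2 • z₂) +
      c₃ • (x₃ + h • y₃ + h ^ 2 • z₃) + c₄ • (x₄ + h • y₄ + h ^ 2 • z₄) =
    (c₁ • x₁ + c₂ • x₂ + c₃ • x₃ + c₄ • x₄) + h • (c₁ • y₁ + c₂ • y₂ + c₃ • y₃ + c₄ • y₄) +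
      h ^ 2 • (c₁ • z₁ + c₂ • z₂ + c₃ • z₃ + c₄ • z₄) := by
  module

variable {Δ : U →ₐ[K] HAdic (U ⊗[K] U)}

theorem comul_linGen_of {a b : ℝ} {v : Gen → U} {t : Gen → HAdic (U ⊗[K] U)}
    (h : ∀ g, Δ (v g) = HAdic.of (v g ⊗ₜ 1 + 1 ⊗ₜ v g) + hbar • HAdic.of (coprodLin a b v g) +
      hbar ^ 2 • t g) (x : Gl2) :
    Δ (linGen v x) = HAdic.of (linGen v x ⊗ₜ 1 + 1 ⊗ₜ linGen v x) +
      hbar • linGen (fun g => HAdic.of (coprodLin a b v g)) x + hbar ^ 2 • linGen t x := by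
  refine (map_linGen Δ.toLinearMap v x).trans ?_
  have e := map_linGen (HAdic.of.toLinearMap ∘ₗ (TensorProduct.mk K U U).flip 1 +
    HAdic.of.toLinearMap ∘ₗ TensorProduct.mk K U U 1) v x
  simp only [LinearMap.add_apply, LinearMap.comp_apply, LinearMap.flip_apply,
    TensorProduct.mk_apply, AlgHom.toLinearMap_apply, ← map_add] at e
  rw [e]
  simp only [AlgHom.toLinearMap_apply, h]
  simp only [linGen_apply]
  exact smul_expand_four _ _ _ _ _ _ _ _ _ _ _ _ _ _ _ _ _

/-- The elements whose coproduct is cocommutative modulo `ℏ`. -/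
noncomputable def cocommMod (Δ : U →ₐ[K] HAdic (U ⊗[K] U)) : Subalgebra K U where
  carrier := {u | ∃ t, Δ u - flipHom U (Δ u) = hbar • t}
  mul_mem' := fun {x y} ⟨s, hs⟩ ⟨t, ht⟩ => by
    refine ⟨s * Δ y + flipHom U (Δ x) * t, ?_⟩
    rw [smul_add, ← smul_mul_assoc, ← mul_smul_comm, ← hs, ← ht, map_mul Δ,
      map_mul (flipHom U), sub_mul, mul_sub]
    abel
  add_mem' := fun {x y} ⟨s, hs⟩ ⟨t, ht⟩ => by
    refine ⟨s + t, ?_⟩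
    rw [smul_add, ← hs, ← ht, map_add Δ, map_add (flipHom U)]
    abel
  algebraMap_mem' := fun k => ⟨0, by
    rw [AlgHom.commutes, AlgHom.commutes, sub_self, smul_zero]⟩

theorem mem_cocommMod_of_expand {u : U} {t : HAdic (U ⊗[K] U)}
    (h : Δ u = HAdic.of (u ⊗ₜ 1 + 1 ⊗ₜ u) + hbar • t) : u ∈ cocommMod Δ := by
  refine ⟨t - flipHom U t, ?_⟩
  rw [h, map_add (flipHom U), map_smul (flipHom U), flipHom_of,
    map_add (TensorProduct.comm K U U), TensorProduct.comm_tmul, TensorProduct.comm_tmul,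
    smul_sub, add_comm ((1 : U) ⊗ₜ[K] u)]
  abel

theorem add_hbar_smul_mem_cocommMod {y z : U} (h : y ∈ cocommMod Δ) :
    y + hbar • z ∈ cocommMod Δ := by
  obtain ⟨t, ht⟩ := h
  refine ⟨t + (Δ z - flipHom U (Δ z)), ?_⟩
  rw [map_add Δ, map_add (flipHom U), smul_add, ← ht, map_smul Δ, map_smul (flipHom U), smul_sub]
  abel

theorem comul_add_hbar_smul {l v : U} {A t : HAdic (U ⊗[K] U)}
    (hl : Δ l = HAdic.of (l ⊗ₜ 1 + 1 ⊗ₜ l) + hbar • A + hbar ^ 2 • t) :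
    ∃ s, Δ (l + hbar • v) =
      HAdic.of ((l + hbar • v) ⊗ₜ 1 + 1 ⊗ₜ (l + hbar • v)) + hbar • s := by
  refine ⟨A + hbar • t + (Δ v - HAdic.of (v ⊗ₜ 1 + 1 ⊗ₜ v)), ?_⟩
  simp only [map_add, hl, map_smul, TensorProduct.add_tmul, TensorProduct.tmul_add,
    TensorProduct.tmul_smul, ← TensorProduct.smul_tmul', smul_add, smul_sub, pow_two, mul_smul]
  abel

theorem comul_sub_flip {l v : U} {A t s : HAdic (U ⊗[K] U)}
    (hl : Δ l = HAdic.of (l ⊗ₜ 1 + 1 ⊗ₜ l) + hbar • A + hbar ^ 2 • t)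
    (hs : Δ v - flipHom U (Δ v) = hbar • s) :
    Δ (l + hbar • v) - flipHom U (Δ (l + hbar • v)) =
      hbar • (A - flipHom U A) + hbar ^ 2 • (t - flipHom U t + s) := by
  have hs' : flipHom U (Δ v) = Δ v - hbar • s := by rw [← hs, sub_sub_cancel]
  rw [map_add Δ, map_smul Δ, map_add (flipHom U), map_smul (flipHom U), hl, map_add (flipHom U),
    map_add (flipHom U), map_smul (flipHom U), map_smul (flipHom U), flipHom_of,
    map_add (TensorProduct.comm K U U), TensorProduct.comm_tmul, TensorProduct.comm_tmul,
    add_comm ((1 : U) ⊗ₜ[K] l), hs']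
  simp only [smul_add, smul_sub, pow_two, mul_smul]
  abel

end Expansion

/-! ### The quantization property -/

section Quantization

variable {a b : ℝ} {H : HAdicHopf (UqGl2 a)}

theorem IsUab.comul_linGen (h : IsUab a b H) (x : Gl2) :
    ∃ t, H.comul (linGen (UqGl2.gen a) x) =
      HAdic.of (linGen (UqGl2.gen a) x ⊗ₜ 1 + 1 ⊗ₜ linGen (UqGl2.gen a) x) +
      hbar • linGen (fun g => HAdic.of (coprodLin a b (UqGl2.gen a) g)) x + hbar ^ 2 • t := by
  choose t ht using fun g => coprodGen_expand a b (UqGl2.gen a) g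
  exact ⟨linGen t x, comul_linGen_of (fun g => (h.comul_gen g).trans (ht g)) x⟩

/-- This makes the semiclassical limit independent of the lift: changing `u` by `ℏ v` changes `Δ -
Δᵒᵖ` by `ℏ` times something already divisible by `ℏ`. -/
theorem IsUab.cocomm_mod (h : IsUab a b H) (u : UqGl2 a) : u ∈ cocommMod H.comul := by
  refine UqGl2.induction (cocommMod H.comul) ?_ (fun g => ?_) (fun x hx => ?_) u
  · exact fun x hx => hx
  · obtain ⟨t, ht⟩ := coprodGen_expand a b (UqGl2.gen a) g
    refine mem_cocommMod_of_expand
      (t := HAdic.of (coprodLin a b (UqGl2.gen a) g) + hbar • t) ((h.comul_gen g).trans ?_)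
    rw [ht, pow_two, mul_smul, smul_add, add_assoc]
  · obtain ⟨y, hy, z, rfl⟩ := hx 1
    rw [pow_one]
    exact add_hbar_smul_mem_cocommMod hy

theorem IsUab.isQuantization (h : IsUab a b H) :
    IsQuantization H (cocomm a b) (classicalLimit a : UqGl2 a →+* ClassicalU) where
  complete := HComplete.isAdicComplete _
  torsion_free := UqGl2.torsion_free
  map_scalar c := by
    refine ((classicalLimit a).commutes c).trans ?_
    rfl
  surjective := classicalLimit_surjective a
  ker := classicalLimit_eq_zero_iff
  comul_mod x u hu := by
    obtain ⟨v, rfl⟩ := exists_eq_linGen_add hu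
    obtain ⟨t, ht⟩ := h.comul_linGen x
    exact comul_add_hbar_smul ht
  counit_mod x u hu := by
    obtain ⟨v, rfl⟩ := exists_eq_linGen_add hu
    refine ⟨H.counit v, ?_⟩
    have e := map_linGen H.counit.toLinearMap (UqGl2.gen a) x
    rw [map_add, map_smul, smul_eq_mul]
    refine (congrArg (· + _) e).trans ?_
    simp [linGen_apply, h.counit_gen]
  semiclassical x u n y z v w hu hv hw hδ := by
    obtain ⟨u', rfl⟩ := exists_eq_linGen_add hu
    obtain ⟨t, ht⟩ := h.comul_linGen x
    obtain ⟨s, hs⟩ := h.cocomm_mod u'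
    obtain ⟨r, hr⟩ := exists_tensor_eq (fun i => exists_eq_linGen_add (hv i))
      fun i => exists_eq_linGen_add (hw i)
    have hl := coprodLin_sub_flip a b (UqGl2.gen a) x
    rw [hδ] at hl
    refine ⟨t - flipHom (UqGl2 a) t + s - HAdic.of r, ?_⟩
    refine (comul_sub_flip ht hs).trans ?_
    rw [hr, hl, map_add HAdic.of, map_smul HAdic.of]
    simp only [smul_add, smul_sub, pow_two, mul_smul]
    abel

end Quantization

/-! ### The Lie bialgebra -/

theorem gl2_ext {M : Type*} [AddCommGroup M] [Module ℝ M] {f g : Gl2 →ₗ[ℝ] M}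
    (h : ∀ x, f (Gen.mat ℝ x) = g (Gen.mat ℝ x)) : f = g := by
  ext1 x
  have hx : x = ((x 0 0 - x 1 1) / 2) • Gen.mat ℝ .J3 + ((x 0 0 + x 1 1) / 2) • Gen.mat ℝ .I +
      x 0 1 • Gen.mat ℝ .Jp + x 1 0 • Gen.mat ℝ .Jm := by
    ext i j
    fin_cases i <;> fin_cases j <;> simp [Gen.mat] <;> ring
  rw [hx]
  simp only [map_add, map_smul, h]

theorem lie_Jp_J3 : ⁅Gen.mat ℝ .Jp, Gen.mat ℝ .J3⁆ = -((2 : ℝ) • Gen.mat ℝ .Jp) := by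
  rw [← lie_skew, lie_J3_Jp]

theorem lie_Jm_J3 : ⁅Gen.mat ℝ .Jm, Gen.mat ℝ .J3⁆ = (2 : ℝ) • Gen.mat ℝ .Jm := by
  rw [← lie_skew, lie_J3_Jm, neg_neg]

theorem lie_Jm_Jp : ⁅Gen.mat ℝ .Jm, Gen.mat ℝ .Jp⁆ = -Gen.mat ℝ .J3 := by
  rw [← lie_skew, lie_Jp_Jm]

theorem lie_I_right (x : Gl2) : ⁅x, Gen.mat ℝ .I⁆ = 0 := by
  rw [← lie_skew, lie_I, neg_zero]

/-- The action of a Lie algebra on a fixed element of a module. -/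
def lieRight {M : Type*} [AddCommGroup M] [Module ℝ M] [LieRingModule Gl2 M] [LieModule ℝ Gl2 M]
    (t : M) : Gl2 →ₗ[ℝ] M where
  toFun x := ⁅x, t⁆
  map_add' x y := add_lie x y t
  map_smul' r x := smul_lie r x t

theorem lieRight_apply {M : Type*} [AddCommGroup M] [Module ℝ M] [LieRingModule Gl2 M]
    [LieModule ℝ Gl2 M] (t : M) (x : Gl2) : lieRight t x = ⁅x, t⁆ := rfl

theorem lie_smul_tensor (r : ℝ) (x : Gl2) (t : Gl2 ⊗[ℝ] Gl2) : ⁅x, r • t⁆ = r • ⁅x, t⁆ :=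
  lie_smul r x t

theorem lie_smul_tensor₃ (r : ℝ) (x : Gl2) (t : Gl2 ⊗[ℝ] (Gl2 ⊗[ℝ] Gl2)) :
    ⁅x, r • t⁆ = r • ⁅x, t⁆ :=
  lie_smul r x t

theorem cocomm_eq_lie (a b : ℝ) (x : Gl2) : cocomm a b x = ⁅x, rMatrix a b⁆ := by
  have : cocomm a b = lieRight (rMatrix a b) := by
    refine gl2_ext fun g => ?_
    rw [lieRight_apply]
    cases g <;>
    simp only [cocomm, rMatrix, LinearMap.add_apply, LinearMap.smulRight_apply,
      Matrix.entryLinearMap_apply, wedge, lie_sub, lie_smul_tensor, TensorProduct.LieModule.lie_tmul_right,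
      lie_I, lie_I_right, lie_J3_Jp, lie_J3_Jm, lie_Jp_Jm, lie_Jp_J3, lie_Jm_J3, lie_Jm_Jp, lie_self,
      TensorProduct.tmul_zero, TensorProduct.zero_tmul, TensorProduct.neg_tmul,
      TensorProduct.tmul_neg, TensorProduct.tmul_smul, ← TensorProduct.smul_tmul'] <;>
    simp [Gen.mat] <;> module
  exact LinearMap.congr_fun this x

theorem dualBracket_cocomm (a b : ℝ) (φ ψ : Module.Dual ℝ Gl2) (x : Gl2) :
    dualBracket (cocomm a b) φ ψ x =
      x 0 1 * (a * (φ (Gen.mat ℝ .J3) * ψ (Gen.mat ℝ .Jp) - φ (Gen.mat ℝ .Jp) * ψ (Gen.mat ℝ .J3)) +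
        b * (φ (Gen.mat ℝ .Jp) * ψ (Gen.mat ℝ .I) - φ (Gen.mat ℝ .I) * ψ (Gen.mat ℝ .Jp))) +
      x 1 0 * (a * (φ (Gen.mat ℝ .J3) * ψ (Gen.mat ℝ .Jm) - φ (Gen.mat ℝ .Jm) * ψ (Gen.mat ℝ .J3)) -
        b * (φ (Gen.mat ℝ .Jm) * ψ (Gen.mat ℝ .I) - φ (Gen.mat ℝ .I) * ψ (Gen.mat ℝ .Jm))) := by
  simp only [dualBracket, LinearMap.comp_apply, cocomm, LinearMap.add_apply,
    LinearMap.smulRight_apply, Matrix.entryLinearMap_apply, wedge, map_add, map_sub, map_smul,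
    TensorProduct.dualDistrib_apply, smul_eq_mul]

/-- A coboundary is a cocycle, by the module identity `lie_lie`; the dual axioms are polynomial
identities in the values of the functionals on the basis. -/
theorem isLieBialgebra_cocomm (a b : ℝ) : IsLieBialgebra (cocomm a b) where
  cocycle x y := by
    rw [cocomm_eq_lie, cocomm_eq_lie, cocomm_eq_lie, lie_lie]
  dual_self φ := by
    ext1 x
    rw [dualBracket_cocomm, LinearMap.zero_apply]
    ring
  dual_jacobi φ ψ χ := by
    ext1 x
    simp only [LinearMap.add_apply, LinearMap.zero_apply, dualBracket_cocomm]
    simp [Gen.mat]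
    ring

/-- The totally antisymmetric tensor `x ∧ y ∧ z`. -/
noncomputable def wedge₃ {M : Type*} [AddCommGroup M] [Module ℝ M] (x y z : M) :
    M ⊗[ℝ] (M ⊗[ℝ] M) :=
  x ⊗ₜ (y ⊗ₜ z) - x ⊗ₜ (z ⊗ₜ y) - y ⊗ₜ (x ⊗ₜ z) + z ⊗ₜ (x ⊗ₜ y) + y ⊗ₜ (z ⊗ₜ x) - z ⊗ₜ (y ⊗ₜ x)

/-- In `M₂(ℝ)` the central generator is the identity matrix, so the part of `r` with coefficient `p`
contains only `h` and `1`. Its contributions cancel, and only the square of the coefficient of `e ∧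
f` survives. -/
theorem wedge₃_aux {A : Type*} [Ring A] [Algebra ℝ A] {h e f : A} (he : h * e = e)
    (eh : e * h = -e) (hf : h * f = -f) (fh : f * h = f) (ee : e * e = 0) (ff : f * f = 0)
    (ef : e * f = f * e + h) (p q : ℝ) :
    let r12 : A ⊗[ℝ] (A ⊗[ℝ] A) :=
      p • (h ⊗ₜ (1 ⊗ₜ 1) - 1 ⊗ₜ (h ⊗ₜ 1)) - q • (e ⊗ₜ (f ⊗ₜ 1) - f ⊗ₜ (e ⊗ₜ 1))
    let r13 : A ⊗[ℝ] (A ⊗[ℝ] A) :=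
      p • (h ⊗ₜ (1 ⊗ₜ 1) - 1 ⊗ₜ (1 ⊗ₜ h)) - q • (e ⊗ₜ (1 ⊗ₜ f) - f ⊗ₜ (1 ⊗ₜ e))
    let r23 : A ⊗[ℝ] (A ⊗[ℝ] A) :=
      p • (1 ⊗ₜ (h ⊗ₜ 1) - 1 ⊗ₜ (1 ⊗ₜ h)) - q • (1 ⊗ₜ (e ⊗ₜ f) - 1 ⊗ₜ (f ⊗ₜ e))
    (r12 * r13 - r13 * r12) + (r12 * r23 - r23 * r12) + (r13 * r23 - r23 * r13) =
      q ^ 2 • wedge₃ h e f := by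
  simp only [mul_sub, sub_mul, smul_mul_assoc, mul_smul_comm, smul_sub, smul_smul,
    Algebra.TensorProduct.tmul_mul_tmul, mul_one, one_mul, he, eh, hf, fh, ee, ff, ef, wedge₃,
    TensorProduct.tmul_zero, TensorProduct.zero_tmul, TensorProduct.neg_tmul,
    TensorProduct.tmul_neg, TensorProduct.tmul_add, TensorProduct.add_tmul]
  module

theorem schouten_rMatrix (a b : ℝ) : schouten (rMatrix a b) =
    a ^ 2 • wedge₃ (Gen.mat ℝ .J3) (Gen.mat ℝ .Jp) (Gen.mat ℝ .Jm) := by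
  refine Eq.trans ?_ (wedge₃_aux (A := Gl2) (h := Gen.mat ℝ .J3) (e := Gen.mat ℝ .Jp)
    (f := Gen.mat ℝ .Jm) ?_ ?_ ?_ ?_ ?_ ?_ ?_ (-(b / 2)) a)
  rotate_left
  iterate 7
    · ext i j
      fin_cases i <;> fin_cases j <;> simp [Gen.mat, Matrix.mul_apply, Fin.sum_univ_two]
  simp only [schouten, rMatrix, wedge, TensorProduct.tmul_sub, TensorProduct.sub_tmul, map_sub,
    map_smul, TensorProduct.tmul_smul, ← TensorProduct.smul_tmul', TensorProduct.assoc_tmul,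
    TensorProduct.leftComm_tmul]
  rfl

/-- `J₃ ∧ J₊ ∧ J₋` is a volume element of `sl(2)`, on which the adjoint action has trace zero. -/
theorem lie_schouten (a b : ℝ) (x : Gl2) : ⁅x, schouten (rMatrix a b)⁆ = 0 := by
  have : lieRight (wedge₃ (Gen.mat ℝ .J3) (Gen.mat ℝ .Jp) (Gen.mat ℝ .Jm)) = 0 := by
    refine gl2_ext fun g => ?_
    rw [lieRight_apply, LinearMap.zero_apply]
    cases g <;>
    simp only [wedge₃, lie_sub, lie_add, TensorProduct.LieModule.lie_tmul_right,
      lie_I, lie_J3_Jp, lie_J3_Jm, lie_Jp_Jm, lie_Jp_J3, lie_Jm_J3, lie_Jm_Jp, lie_self,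
      TensorProduct.tmul_zero, TensorProduct.zero_tmul, TensorProduct.neg_tmul,
      TensorProduct.tmul_neg, TensorProduct.tmul_smul, ← TensorProduct.smul_tmul',
      TensorProduct.tmul_add] <;>
    module
  rw [schouten_rMatrix, lie_smul_tensor₃]
  exact (congrArg _ (LinearMap.congr_fun this x)).trans (smul_zero _)

theorem schouten_ne_zero {a : ℝ} (ha : a ≠ 0) (b : ℝ) : schouten (rMatrix a b) ≠ 0 := by
  intro h
  rw [schouten_rMatrix] at h
  -- Pairing with the matrix entries `(0,0)`, `(0,1)`, `(1,0)` picks out the single term `J₃ ⊗ J₊ ⊗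
  -- J₋`, with value `a²`.
  have h' := congrArg (TensorProduct.dualDistrib ℝ Gl2 (Gl2 ⊗[ℝ] Gl2)
    (Matrix.entryLinearMap ℝ ℝ 0 0 ⊗ₜ TensorProduct.dualDistrib ℝ Gl2 Gl2
      (Matrix.entryLinearMap ℝ ℝ 0 1 ⊗ₜ Matrix.entryLinearMap ℝ ℝ 1 0))) h
  simp only [wedge₃, map_smul, map_add, map_sub, TensorProduct.dualDistrib_apply,
    Matrix.entryLinearMap_apply] at h'
  simp [Gen.mat, ha] at h'

/-! ### The Casimir -/

/-- The commutator of `ef + fe` with `e` is `-([e,f] e + e [e,f])`, and `A [e,f] = X - Y`. Moving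
`X` and `Y` to the left of `e` reduces the claim to `(q + q')(1 - q'²) = (q - q')(1 + q'²)` and its
counterpart with `q` and `q'` exchanged. -/
theorem commute_of_exchange {R C : Type*} [CommRing R] [Ring C] [Algebra R C] {q q' A : R}
    {e f X Y : C} (hq : q * q' = 1) (hX : e * X = q' ^ 2 • (X * e)) (hY : e * Y = q ^ 2 • (Y * e))
    (hef : A • (e * f - f * e) = X - Y) :
    Commute ((q + q') • (X + Y - (2 : R) • 1) + ((q - q') * A) • (e * f + f * e)) e := by
  have h1 : ((q - q') * A) • (e * f + f * e) * e =
      ((q - q') * A) • (e * (e * f + f * e)) - (q - q') • ((X - Y) * e + e * (X - Y)) := by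
    rw [← hef]
    simp only [mul_smul, smul_mul_assoc, mul_smul_comm, ← smul_add, ← smul_sub]
    congr 2
    noncomm_ring
  rw [Commute, SemiconjBy, add_mul, h1]
  simp only [mul_sub, sub_mul, mul_add, add_mul, hX, hY, smul_mul_assoc, mul_smul_comm, mul_one,
    one_mul]
  match_scalars
  · linear_combination (-2 * q') * hq
  · linear_combination (-2 * q) * hq
  all_goals ring

variable {C D : Type*} [Ring C] [Algebra K C] [HComplete C] [Ring D] [Algebra K D] [HComplete D]

/-- The Casimir of a family of elements. -/
noncomputable def casimirGen (a : ℝ) (v : Gen → C) : C :=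
  coshSeries a • hSinhDiv (a / 2) (v .J3) ^ 2 +
    (2 * sinhDiv a (1 : ℝ) : K) • (v .Jp * v .Jm + v .Jm * v .Jp)

theorem casimir_eq (a : ℝ) : casimir a = casimirGen a (UqGl2.gen a) := by
  rw [casimir, casimirGen, map_sinhDiv]
  rfl

theorem map_casimirGen (f : C →ₐ[K] D) (a : ℝ) (v : Gen → C) :
    f (casimirGen a v) = casimirGen a fun g => f (v g) := by
  simp only [casimirGen, map_add, map_smul, map_pow, map_mul, map_hSinhDiv]

/-- Clears the denominators `aℏ`, so that the Casimir takes the form of `commute_of_exchange` with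
`q = exp(aℏ)`, `X = exp(aℏJ₃)`, `Y = exp(-aℏJ₃)` and `A = 2aℏ`. -/
theorem smul_casimirGen (a : ℝ) (v : Gen → C) (hI : Commute (v .I) (v .J3)) :
    (2 * (PowerSeries.C a * hbar) ^ 2 : K) • casimirGen a v =
      (expSeries a + expSeries (-a)) •
        (cexp v (2 * a) 0 + cexp v (-(2 * a)) 0 - (2 : K) • 1) +
      ((expSeries a - expSeries (-a)) * (2 * (PowerSeries.C a * hbar))) •
        (v .Jp * v .Jm + v .Jm * v .Jp) := by
  have h1 : ((PowerSeries.C a : K) * hbar) • hSinhDiv (a / 2) (v .J3) =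
      cexp v a 0 - cexp v (-a) 0 := by
    have := hbar_smul_hSinhDiv (a / 2) (v .J3)
    rw [mul_div_cancel₀ _ (two_ne_zero' ℝ)] at this
    rw [this, cexp, cexp, zero_div, map_zero, zero_smul, add_zero, add_zero, neg_div, map_neg,
      neg_smul]
  have h2 : ((PowerSeries.C a : K) * hbar) ^ 2 • hSinhDiv (a / 2) (v .J3) ^ 2 =
      cexp v (2 * a) 0 + cexp v (-(2 * a)) 0 - (2 : K) • 1 := by
    rw [← smul_pow, h1, pow_two, mul_sub, sub_mul, sub_mul, cexp_mul_cexp hI, cexp_mul_cexp hI,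
      cexp_mul_cexp hI, cexp_mul_cexp hI, add_neg_cancel, neg_add_cancel, add_zero, cexp_zero_zero,
      two_smul, two_mul, neg_add]
    abel
  have h3 : (2 * (PowerSeries.C a * hbar) * sinhDiv a (1 : ℝ) : K) =
      expSeries a - expSeries (-a) := by
    rw [← hbar_mul_sinhDiv, map_mul, map_ofNat]
    ring
  rw [← h2, ← two_mul_coshSeries, ← h3, casimirGen, smul_add, smul_smul, smul_smul, smul_smul]
  congr 2 <;> ring

namespace IsRep

variable {a : ℝ} {v : Gen → C}

theorem smul_Jp_Jm (h : IsRep a v) :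
    (2 * (PowerSeries.C a * hbar) : K) • (v .Jp * v .Jm - v .Jm * v .Jp) =
      cexp v (2 * a) 0 - cexp v (-(2 * a)) 0 := by
  have := hbar_smul_hSinhDiv a (v .J3)
  rw [map_mul, map_ofNat, mul_assoc] at this
  rw [h.Jp_Jm, this, cexp, cexp, zero_div, map_zero, zero_smul, add_zero, add_zero, neg_div,
    map_neg, neg_smul, show 2 * a / 2 = a by ring]

theorem commute_J3_mul (h : IsRep a v) :
    Commute (v .J3) (v .Jp * v .Jm) ∧ Commute (v .J3) (v .Jm * v .Jp) := by
  have h1 := h.J3_Jp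
  have h2 := h.J3_Jm
  rw [sub_eq_iff_eq_add] at h1 h2
  constructor
  · rw [Commute, SemiconjBy, ← mul_assoc, h1, add_mul, mul_assoc (v .Jp), h2]
    noncomm_ring
  · rw [Commute, SemiconjBy, ← mul_assoc, h2, add_mul, mul_assoc (v .Jm), h1]
    noncomm_ring

theorem commute_casimirGen [Module.IsTorsionFree K C] (h : IsRep a v) (ha : a ≠ 0) (g : Gen) :
    Commute (casimirGen a v) (v g) := by
  have hI := h.I_J3
  have hne : (2 * (PowerSeries.C a * hbar) ^ 2 : K) ≠ 0 := by
    have h := mul_ne_zero (C_mul_hbar_ne_zero (mul_ne_zero two_ne_zero ha)) (C_mul_hbar_ne_zero ha)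
    rwa [map_mul, map_ofNat, mul_assoc (2 : K), mul_assoc (2 : K), ← pow_two] at h
  suffices Commute ((2 * (PowerSeries.C a * hbar) ^ 2 : K) • casimirGen a v) (v g) by
    refine smul_cancel hne ?_
    rw [← smul_mul_assoc, ← mul_smul_comm]
    exact this
  rw [smul_casimirGen a v hI]
  have hq : expSeries a * expSeries (-a) = 1 := by
    rw [← expSeries_add, add_neg_cancel, expSeries_zero]
  have hq2 : ∀ r : ℝ, expSeries (2 * r) = expSeries r ^ 2 := fun r => by
    rw [two_mul, expSeries_add, pow_two]
  have hcart : ∀ {x : C}, Commute x (v .J3) → Commute x (v .I) →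
      Commute x (v .Jp * v .Jm + v .Jm * v .Jp) →
      Commute ((expSeries a + expSeries (-a)) •
        (cexp v (2 * a) 0 + cexp v (-(2 * a)) 0 - (2 : K) • 1) +
      ((expSeries a - expSeries (-a)) * (2 * (PowerSeries.C a * hbar))) •
        (v .Jp * v .Jm + v .Jm * v .Jp)) x := fun h1 h2 h3 =>
    (((((commute_cexp h1 h2 _ _).add_right (commute_cexp h1 h2 _ _)).sub_right
      ((Commute.one_right _).smul_right _)).smul_right _).add_right (h3.smul_right _)).symm
  have hIc : ∀ g, Commute (v .I) (v g) := h.I_comm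
  cases g
  · exact hcart (.refl _) hI.symm (h.commute_J3_mul.1.add_right h.commute_J3_mul.2)
  · refine commute_of_exchange hq ?_ ?_ h.smul_Jp_Jm
    · rw [h.cexp_Jp, ← hq2, mul_neg]
    · rw [h.cexp_Jp, ← hq2, neg_neg]
  -- The case of `J₋` is that of `J₊` with the roles of `e, f` and of `X, Y` exchanged.
  · have := commute_of_exchange (e := v .Jm) (f := v .Jp) (X := cexp v (-(2 * a)) 0)
      (Y := cexp v (2 * a) 0) (A := 2 * (PowerSeries.C a * hbar)) hq
      (by rw [h.cexp_Jm, ← hq2, mul_neg]) (by rw [h.cexp_Jm, ← hq2])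
      (by rw [← neg_sub, smul_neg, h.smul_Jp_Jm, neg_sub])
    rwa [add_comm (cexp v (-(2 * a)) 0), add_comm (v .Jm * v .Jp)] at this
  · exact hcart hI (.refl _) (((hIc _).mul_right (hIc _)).add_right ((hIc _).mul_right (hIc _)))

end IsRep

theorem casimir_central {a : ℝ} (ha : a ≠ 0) (x : UqGl2 a) : casimir a * x = x * casimir a := by
  refine UqGl2.induction_eq (f := LinearMap.mulLeft K (casimir a))
    (g := LinearMap.mulRight K (casimir a)) (Subalgebra.centralizer K {casimir a})
    (fun x hx => ?_) (fun g => ?_) x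
  · exact hx _ rfl
  · rintro _ rfl
    rw [casimir_eq]
    exact (UqGl2.isRep_gen a).commute_casimirGen ha g

theorem constantCoeff_coshSeries (c : ℝ) : PowerSeries.constantCoeff (coshSeries c) = 1 := by
  rw [← PowerSeries.coeff_zero_eq_constantCoeff_apply, coshSeries, PowerSeries.coeff_mk]
  simp

theorem constantCoeff_sinhDiv (c : ℝ) : PowerSeries.constantCoeff (sinhDiv c (1 : ℝ)) = 1 := by
  rw [← PowerSeries.coeff_zero_eq_constantCoeff_apply, sinhDiv, PowerSeries.coeff_mk]
  simp

theorem classicalLimit_casimir (a : ℝ) : classicalLimit a (casimir a) =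
    classicalLimit a (UqGl2.gen a .J3 ^ 2 + 2 * (UqGl2.gen a .Jp * UqGl2.gen a .Jm) +
      2 * (UqGl2.gen a .Jm * UqGl2.gen a .Jp)) := by
  obtain ⟨z, hz⟩ := hSinhDiv_eq_add (a / 2) (UqGl2.gen a .J3)
  rw [casimir_eq, casimirGen, hz, map_add, map_smul, map_smul, map_pow, map_add, map_smul,
    ClassicalU.hbar_smul, ClassicalU.smul_def, ClassicalU.smul_def, map_mul,
    constantCoeff_coshSeries, constantCoeff_sinhDiv, map_ofNat, mul_one, one_smul, add_zero,
    ofNat_smul_eq_nsmul, nsmul_eq_mul]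
  simp only [map_add, map_mul, map_pow, map_ofNat, mul_add, add_assoc]
  rfl

/-! ### The Reshetikhin twist -/

section TwistGen

variable {C D : Type*} [Ring C] [Algebra K C] [HComplete C] [Ring D] [Algebra K D] [HComplete D]

/-- The exponent `J₃ ∧ I` of the twist, for a pair of families. -/
def twistExponent {C : Type*} [Ring C] (u v : Gen → C) : C := u .J3 * v .I - u .I * v .J3

/-- The twist element for a pair of families. -/
noncomputable def twistGen (r : ℝ) (u v : Gen → C) : C :=
  hExp ((PowerSeries.C r : K) • twistExponent u v)

theorem commute_twistExponent {C : Type*} [Ring C] {u v : Gen → C} {x : C}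
    (h1 : Commute x (u .J3)) (h2 : Commute x (u .I)) (h3 : Commute x (v .J3))
    (h4 : Commute x (v .I)) : Commute x (twistExponent u v) :=
  (h1.mul_right h4).sub_right (h2.mul_right h3)

theorem map_twistGen (f : C →ₐ[K] D) (r : ℝ) (u v : Gen → C) :
    f (twistGen r u v) = twistGen r (fun g => f (u g)) fun g => f (v g) := by
  simp only [twistGen, twistExponent, map_hExp, map_smul, map_sub, map_mul]

variable {u v w : Gen → C}

theorem commute_twistGen {x : C} (r : ℝ) (h1 : Commute x (u .J3)) (h2 : Commute x (u .I))
    (h3 : Commute x (v .J3)) (h4 : Commute x (v .I)) : Commute x (twistGen r u v) :=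
  commute_hExp ((commute_twistExponent h1 h2 h3 h4).smul_right _)

/-- All exponents are polynomials in commuting elements, and both sides exponentiate the same sum of
`J₃ ∧ I` over the three pairs of factors. -/
theorem twistGen_cocycle (r : ℝ) (hu : Commute (u .J3) (u .I)) (hv : Commute (v .J3) (v .I))
    (hw : Commute (w .J3) (w .I)) (huv : ∀ g g', Commute (u g) (v g'))
    (huw : ∀ g g', Commute (u g) (w g')) (hvw : ∀ g g', Commute (v g) (w g')) :
    twistGen r u v * twistGen r (fun g => v g + u g) w =
      twistGen r v w * twistGen r u fun g => w g + v g := by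
  have e : ∀ x : C, Commute x (u .J3) → Commute x (u .I) → Commute x (v .J3) → Commute x (v .I) →
      Commute x (w .J3) → Commute x (w .I) → Commute x (twistExponent u v) ∧
      Commute x (twistExponent (fun g => v g + u g) w) ∧ Commute x (twistExponent v w) ∧
      Commute x (twistExponent u fun g => w g + v g) := fun x h1 h2 h3 h4 h5 h6 =>
    ⟨commute_twistExponent h1 h2 h3 h4,
      commute_twistExponent (h3.add_right h1) (h4.add_right h2) h5 h6,
      commute_twistExponent h3 h4 h5 h6,
      commute_twistExponent h1 h2 (h5.add_right h3) (h6.add_right h4)⟩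
  have c1 := e _ (.refl _) hu (huv _ _) (huv _ _) (huw _ _) (huw _ _)
  have c2 := e _ hu.symm (.refl _) (huv _ _) (huv _ _) (huw _ _) (huw _ _)
  have c3 := e _ (huv _ _).symm (huv _ _).symm (.refl _) hv (hvw _ _) (hvw _ _)
  have c4 := e _ (huv _ _).symm (huv _ _).symm hv.symm (.refl _) (hvw _ _) (hvw _ _)
  have c5 := e _ (huw _ _).symm (huw _ _).symm (hvw _ _).symm (hvw _ _).symm (.refl _) hw
  have c6 := e _ (huw _ _).symm (huw _ _).symm (hvw _ _).symm (hvw _ _).symm hw.symm (.refl _)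
  have h1 : Commute (twistExponent u v) (twistExponent (fun g => v g + u g) w) :=
    (commute_twistExponent c1.2.1.symm c2.2.1.symm c3.2.1.symm c4.2.1.symm).symm
  have h2 : Commute (twistExponent v w) (twistExponent u fun g => w g + v g) :=
    (commute_twistExponent c3.2.2.2.symm c4.2.2.2.symm c5.2.2.2.symm c6.2.2.2.symm).symm
  rw [twistGen, twistGen, twistGen, twistGen, ← hExp_add ((h1.smul_left _).smul_right _),
    ← hExp_add ((h2.smul_left _).smul_right _), ← smul_add, ← smul_add]
  congr 2
  simp only [twistExponent, add_mul, mul_add]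
  abel

theorem twistGen_zero_left (r : ℝ) : twistGen r (fun _ => (0 : C)) v = 1 := by
  simp [twistGen, twistExponent, hExp_zero]

theorem twistGen_zero_right (r : ℝ) : twistGen r u (fun _ => (0 : C)) = 1 := by
  simp [twistGen, twistExponent, hExp_zero]

theorem twistGen_swap (r : ℝ) (huv : ∀ g g', Commute (u g) (v g')) :
    twistGen r v u = twistGen r u v * hExp ((PowerSeries.C (-(2 * r)) : K) • twistExponent u v) := by
  rw [twistGen, twistGen, ← hExp_add (((Commute.refl _).smul_left _).smul_right _), ← add_smul,
    ← map_add, show r + -(2 * r) = -r by ring, map_neg, neg_smul, ← smul_neg, twistExponent,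
    twistExponent, neg_sub, (huv _ _).eq, (huv .J3 .I).eq]

/-- Moving `y`, of `J₃`-weight `2s` in the second factor, past the exponent shifts it by `(b/4)(2s)
= sb/2` times `I` of the first factor. For the first factor the sign is opposite, since `J₃ ∧ I` is
antisymmetric. -/
theorem mul_twistGen_right {b s : ℝ} {y : C}
    (hy : y * v .J3 = v .J3 * y - (PowerSeries.C (2 * s) : K) • y) (h3 : Commute y (u .J3))
    (hI : Commute y (u .I)) (hI' : Commute y (v .I)) (hu : Commute (u .J3) (u .I))
    (huv : ∀ g g', Commute (u g) (v g')) :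
    y * twistGen (b / 4) u v = twistGen (b / 4) u v * (cexp u 0 (s * b) * y) := by
  have h : SemiconjBy y ((PowerSeries.C (b / 4) : K) • twistExponent u v)
      ((PowerSeries.C (b / 4) : K) • twistExponent u v +
        (PowerSeries.C (s * b / 2) : K) • u .I) := by
    rw [SemiconjBy, twistExponent, mul_smul_comm, mul_sub, ← mul_assoc, ← mul_assoc, h3.eq, hI.eq,
      mul_assoc, hI'.eq, mul_assoc (u .I), hy, add_mul, smul_mul_assoc, sub_mul, smul_mul_assoc,
      mul_sub, mul_smul_comm, sub_sub_eq_add_sub, add_sub_right_comm, smul_add, smul_smul, ← map_mul,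
      mul_assoc, mul_assoc, show b / 4 * (2 * s) = s * b / 2 by ring]
  rw [twistGen, (semiconj_hExp h).eq, hExp_add, mul_assoc]
  · rw [cexp, zero_div, map_zero, zero_smul, zero_add]
  · exact (((commute_twistExponent hu.symm (.refl _) (huv _ _) (huv _ _)).smul_left _).smul_right _).symm

theorem mul_twistGen_left {b s : ℝ} {x : C}
    (hx : x * u .J3 = u .J3 * x - (PowerSeries.C (2 * s) : K) • x) (h3 : Commute x (v .J3))
    (hI : Commute x (v .I)) (hI' : Commute x (u .I)) (hv : Commute (v .J3) (v .I))
    (huv : ∀ g g', Commute (u g) (v g')) :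
    x * twistGen (b / 4) u v = twistGen (b / 4) u v * (cexp v 0 (-(s * b)) * x) := by
  have h : SemiconjBy x ((PowerSeries.C (b / 4) : K) • twistExponent u v)
      ((PowerSeries.C (b / 4) : K) • twistExponent u v +
        (PowerSeries.C (-(s * b) / 2) : K) • v .I) := by
    rw [SemiconjBy, twistExponent, mul_smul_comm, mul_sub, ← mul_assoc, ← mul_assoc, hx, hI'.eq,
      mul_assoc (u .I), h3.eq, sub_mul, mul_assoc, hI.eq, smul_mul_assoc, hI.eq, add_mul,
      smul_mul_assoc, sub_mul, smul_mul_assoc, sub_right_comm, smul_sub _ (_ - _), smul_smul,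
      ← map_mul, mul_assoc, mul_assoc, show b / 4 * (2 * s) = s * b / 2 by ring, neg_div, map_neg,
      neg_smul, ← sub_eq_add_neg]
  rw [twistGen, (semiconj_hExp h).eq, hExp_add, mul_assoc]
  · rw [cexp, zero_div, map_zero, zero_smul, zero_add]
  · exact (((commute_twistExponent (huv _ _).symm (huv _ _).symm hv.symm (.refl _)).smul_left
      _).smul_right _).symm

/-- The exponentials of `I` created by the twist cancel the `b`-dependent part of the Cartan
factors. `key` treats `J₊` with `s = 1` and `J₋` with `s = -1`; the primitive generators commute
with the twist. -/
theorem coprodGen_mul_twistGen {a : ℝ} (b : ℝ) (hu : IsRep a u) (hv : IsRep a v)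
    (huv : ∀ g g', Commute (u g) (v g')) (g : Gen) :
    coprodGen a b u v g * twistGen (b / 4) u v = twistGen (b / 4) u v * coprodGen a 0 u v g := by
  have hIu : ∀ g, Commute (u .I) (u g) := hu.I_comm
  have hIv : ∀ g, Commute (v .I) (v g) := hv.I_comm
  have hu3 := commute_twistGen (x := u .J3) (b / 4) (.refl _) (hIu _).symm (huv _ _) (huv _ _)
  have hv3 := commute_twistGen (x := v .J3) (b / 4) (huv _ _).symm (huv _ _).symm (.refl _)
    (hIv _).symm
  have huI := commute_twistGen (x := u .I) (b / 4) (hIu _) (.refl _) (huv _ _) (huv _ _)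
  have hvI := commute_twistGen (x := v .I) (b / 4) (huv _ _).symm (huv _ _).symm (hIv _) (.refl _)
  have hE : ∀ s t, cexp u s t * twistGen (b / 4) u v = twistGen (b / 4) u v * cexp u s t :=
    fun s t => (commute_cexp hu3.symm huI.symm s t).symm
  have hE' : ∀ s t, cexp v s t * twistGen (b / 4) u v = twistGen (b / 4) u v * cexp v s t :=
    fun s t => (commute_cexp hv3.symm hvI.symm s t).symm
  have hc : ∀ g s t, u g * cexp v s t = cexp v s t * u g :=
    fun g s t => commute_cexp (huv _ _) (huv _ _) s t
  have key : ∀ (s : ℝ) (g : Gen), (u g * u .J3 = u .J3 * u g - (PowerSeries.C (2 * s) : K) • u g) →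
      (v g * v .J3 = v .J3 * v g - (PowerSeries.C (2 * s) : K) • v g) →
      (cexp u a (-(s * b)) * v g + u g * cexp v (-a) (s * b)) * twistGen (b / 4) u v =
      twistGen (b / 4) u v * (cexp u a (-(s * 0)) * v g + u g * cexp v (-a) (s * 0)) := by
    intro s g h1 h2
    rw [add_mul, mul_add, mul_assoc, mul_twistGen_right h2 (huv _ _).symm (huv _ _).symm
      (hIv _).symm (hIu _).symm huv, ← mul_assoc, hE, mul_assoc, ← mul_assoc (cexp u a _),
      cexp_mul_cexp (hIu _), mul_assoc (u g), hE', ← mul_assoc (u g),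
      mul_twistGen_left h1 (huv _ _) (huv _ _) (hIu _).symm (hIv _).symm huv, ← hc, mul_assoc,
      mul_assoc, cexp_mul_cexp (hIv _)]
    congr 4 <;> ring
  have hp : ∀ {w : Gen → C}, IsRep a w →
      w .Jp * w .J3 = w .J3 * w .Jp - (PowerSeries.C (2 * 1) : K) • w .Jp := fun h => by
    rw [mul_one, map_ofNat, two_smul, ← two_mul, ← h.J3_Jp, sub_sub_cancel]
  have hm : ∀ {w : Gen → C}, IsRep a w →
      w .Jm * w .J3 = w .J3 * w .Jm - (PowerSeries.C (2 * (-1)) : K) • w .Jm := fun h => by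
    rw [mul_neg_one, map_neg, map_ofNat, neg_smul, two_smul, ← two_mul, ← h.J3_Jm, sub_sub_cancel]
  cases g
  · rw [coprodGen, coprodGen, add_mul, mul_add, hu3.eq, hv3.eq]
  · simpa only [coprodGen, one_mul, mul_zero, neg_zero] using key 1 .Jp (hp hu) (hp hv)
  · simpa only [coprodGen, neg_mul, one_mul, mul_zero, neg_zero, neg_neg] using
      key (-1) .Jm (hm hu) (hm hv)
  · rw [coprodGen, coprodGen, add_mul, mul_add, huI.eq, hvI.eq]

end TwistGen

/-! ### The twist axioms in the completed tensor square and cube -/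

section Cube

variable {U : Type*} [Ring U] [Algebra K U] {v : Gen → U}

theorem flipHom_twistGen (r : ℝ) :
    flipHom U (twistGen r (genL v) (genR v)) = twistGen r (genR v) (genL v) := by
  rw [map_twistGen]
  rfl

theorem counitLeftHom_twistGen (r : ℝ) (ε : U →ₐ[K] K) (hε : ∀ g, ε (v g) = 0) :
    counitLeftHom ε (twistGen r (genL v) (genR v)) = 1 := by
  have e1 : (fun g => counitLeftHom ε (genL v g)) = fun _ => 0 := funext fun g => by
    rw [genL, counitLeftHom_inl, hε, zero_smul, map_zero]
  rw [map_twistGen, e1, twistGen_zero_left]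

theorem counitRightHom_twistGen (r : ℝ) (ε : U →ₐ[K] K) (hε : ∀ g, ε (v g) = 0) :
    counitRightHom ε (twistGen r (genL v) (genR v)) = 1 := by
  have e1 : (fun g => counitRightHom ε (genR v g)) = fun _ => 0 := funext fun g => by
    rw [genR, counitRightHom_inr, hε, zero_smul, map_zero]
  rw [map_twistGen, e1, twistGen_zero_right]

theorem twistGen_congr {C : Type*} [Ring C] [Algebra K C] [HComplete C] (r : ℝ)
    {u u' w w' : Gen → C} (h3 : u .J3 = u' .J3) (hI : u .I = u' .I) (h3' : w .J3 = w' .J3)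
    (hI' : w .I = w' .I) : twistGen r u w = twistGen r u' w' := by
  rw [twistGen, twistGen, twistExponent, twistExponent, h3, hI, h3', hI']

/-- Only the primitivity of `J₃` and `I` enters, so the coproduct may have any parameter `b`. -/
theorem twistGen_cocycle_cube (r : ℝ) (Δ : U →ₐ[K] HAdic (U ⊗[K] U))
    (h3 : Δ (v .J3) = genR v .J3 + genL v .J3) (hI : Δ (v .I) = genR v .I + genL v .I)
    (hv : Commute (v .J3) (v .I)) :
    assocHom U (HAdic.inl _ U (twistGen r (genL v) (genR v))) *
      comulLeft Δ (twistGen r (genL v) (genR v)) =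
    HAdic.inr U _ (twistGen r (genL v) (genR v)) *
      comulRight Δ (twistGen r (genL v) (genR v)) := by
  have e1 : assocHom U (HAdic.inl _ U (twistGen r (genL v) (genR v))) =
      twistGen r (fun g => cube₁ (v g)) fun g => cube₂ (v g) := by
    rw [map_twistGen, map_twistGen]; rfl
  have e2 : HAdic.inr U _ (twistGen r (genL v) (genR v)) =
      twistGen r (fun g => cube₂ (v g)) fun g => cube₃ (v g) := by
    rw [map_twistGen]; rfl
  have e3 : comulLeft Δ (twistGen r (genL v) (genR v)) =
      twistGen r (fun g => cube₂ (v g) + cube₁ (v g)) fun g => cube₃ (v g) := by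
    rw [map_twistGen]
    have : ∀ g, Δ (v g) = genR v g + genL v g →
        comulLeft Δ (genL v g) = cube₂ (v g) + cube₁ (v g) := fun g h => by
      rw [genL, comulLeft_inl, h, map_add, map_add]; rfl
    exact twistGen_congr r (this _ h3) (this _ hI) (comulLeft_inr Δ _) (comulLeft_inr Δ _)
  have e4 : comulRight Δ (twistGen r (genL v) (genR v)) =
      twistGen r (fun g => cube₁ (v g)) fun g => cube₃ (v g) + cube₂ (v g) := by
    rw [map_twistGen]
    have : ∀ g, Δ (v g) = genR v g + genL v g →
        comulRight Δ (genR v g) = cube₃ (v g) + cube₂ (v g) := fun g h => by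
      rw [genR, comulRight_inr, h, map_add]; rfl
    exact twistGen_congr r (comulRight_inl Δ _) (comulRight_inl Δ _) (this _ h3) (this _ hI)
  have hc1 : Commute (cube₁ (v .J3)) (cube₁ (v .I)) := by
    simp [Commute, SemiconjBy, cube₁, ← map_mul, hv.eq]
  have hc2 : Commute (cube₂ (v .J3)) (cube₂ (v .I)) := by
    simp [Commute, SemiconjBy, cube₂, ← map_mul, hv.eq]
  have hc3 : Commute (cube₃ (v .J3)) (cube₃ (v .I)) := by
    simp [Commute, SemiconjBy, cube₃, ← map_mul, hv.eq]
  rw [e1, e2, e3, e4]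
  exact twistGen_cocycle r hc1 hc2 hc3 (fun _ _ => commute_cube₁_cube₂ _ _)
    (fun _ _ => commute_cube₁_cube₃ _ _) fun _ _ => commute_cube₂_cube₃ _ _

end Cube

/-- The elements on which `F` intertwines two homomorphisms. -/
def intertwiner {U C : Type*} [Ring U] [Algebra K U] [Ring C] [Algebra K C] (f g : U →ₐ[K] C)
    (F : C) : Subalgebra K U where
  carrier := {x | f x * F = F * g x}
  mul_mem' := fun {x y} (hx : f x * F = F * g x) (hy : f y * F = F * g y) => by
    change f (x * y) * F = F * g (x * y)
    rw [map_mul, map_mul, mul_assoc, hy, ← mul_assoc, hx, mul_assoc]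
  add_mem' := fun {x y} (hx : f x * F = F * g x) (hy : f y * F = F * g y) => by
    change f (x + y) * F = F * g (x + y)
    rw [map_add, map_add, add_mul, mul_add, hx, hy]
  algebraMap_mem' k := by
    change f (algebraMap K U k) * F = F * g (algebraMap K U k)
    rw [AlgHom.commutes, AlgHom.commutes, Algebra.commutes]

theorem intertwines_of_gen {a : ℝ} {C : Type*} [Ring C] [Algebra K C] [HComplete C]
    (f g : UqGl2 a →ₐ[K] C) (F : C)
    (h : ∀ i, f (UqGl2.gen a i) * F = F * g (UqGl2.gen a i)) (x : UqGl2 a) :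
    f x * F = F * g x :=
  UqGl2.induction_eq (f := LinearMap.mulRight K F ∘ₗ f.toLinearMap)
    (g := LinearMap.mulLeft K F ∘ₗ g.toLinearMap) (intertwiner f g F) (fun _ hx => hx) h x

theorem of_wedge {U : Type*} [Ring U] [Algebra K U] (v : Gen → U) :
    HAdic.of (wedge (v .J3) (v .I)) = twistExponent (genL v) (genR v) := by
  rw [wedge, map_sub, HAdic.of_tmul, HAdic.of_tmul]
  rfl

theorem twistElement_eq (a b : ℝ) : twistElement a b =
    twistGen (b / 4) (genL (UqGl2.gen a)) (genR (UqGl2.gen a)) := by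
  rw [twistElement, HAdic.hexp_eq, map_smul, of_wedge, twistGen]

theorem flip_twistElement (a b : ℝ) :
    HAdic.map (TensorProduct.comm K (UqGl2 a) (UqGl2 a)).toLinearMap (twistElement a b) =
      twistElement a b * HAdic.hexp ((PowerSeries.C (-(b / 2)) : K) •
        (wedge (UqGl2.gen a .J3) (UqGl2.gen a .I) : UqGl2 a ⊗[K] UqGl2 a)) := by
  rw [← flipHom_apply, twistElement_eq, flipHom_twistGen, HAdic.hexp_eq, map_smul, of_wedge,
    twistGen_swap _ (commute_genL_genR _), show 2 * (b / 4) = b / 2 by ring]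

theorem IsUab.isTwist {a b₀ : ℝ} {H : HAdicHopf (UqGl2 a)} (h : IsUab a b₀ H) (b : ℝ) :
    IsTwist H (twistElement a b) where
  isUnit := by
    rw [twistElement_eq]
    exact isUnit_hExp _
  cocycle := by
    have := twistGen_cocycle_cube (v := UqGl2.gen a) (b / 4) H.comul (h.comul_gen .J3)
      (h.comul_gen .I) ((UqGl2.isRep_gen a).I_comm .J3).symm
    rw [← twistElement_eq, comulLeft, comulRight, AlgHom.comp_apply, ← map_mul] at this
    rw [← HAdic.tensorAlg_apply, ← HAdic.tensorAlg_apply]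
    exact this
  counit_left := by
    have := counitLeftHom_twistGen (v := UqGl2.gen a) (b / 4) H.counit h.counit_gen
    rwa [← twistElement_eq, counitLeftHom_apply] at this
  counit_right := by
    have := counitRightHom_twistGen (v := UqGl2.gen a) (b / 4) H.counit h.counit_gen
    rwa [← twistElement_eq, counitRightHom_apply] at this

theorem IsUab.counit_eq {a b b₀ : ℝ} {H H₀ : HAdicHopf (UqGl2 a)} (h : IsUab a b H)
    (h₀ : IsUab a b₀ H₀) : H.counit = H₀.counit :=
  UqGl2.algHom_ext fun g => by rw [h.counit_gen, h₀.counit_gen]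

theorem IsUab.comul_mul_twistElement {a b : ℝ} {H H₀ : HAdicHopf (UqGl2 a)} (h : IsUab a b H)
    (h₀ : IsUab a 0 H₀) (x : UqGl2 a) :
    H.comul x * twistElement a b = twistElement a b * H₀.comul x := by
  refine intertwines_of_gen H.comul H₀.comul (twistElement a b) (fun g => ?_) x
  rw [h.comul_gen, h₀.comul_gen, twistElement_eq]
  exact coprodGen_mul_twistGen b (isRep_genL (UqGl2.isRep_gen a)) (isRep_genR (UqGl2.isRep_gen a))
    (commute_genL_genR _) g

/-! ### The fundamental representation -/

section Diagonal

variable {n : Type*} [Fintype n] [DecidableEq n]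

theorem hExp_diagonal (r : n → ℝ) :
    hExp (Matrix.diagonal fun i => (PowerSeries.C (r i) : K)) =
      Matrix.diagonal fun i => expSeries (r i) := by
  have h1 := map_hExp (Matrix.diagonalAlgHom (n := n) K) fun i => (PowerSeries.C (r i) : K)
  refine h1.symm.trans (congrArg Matrix.diagonal (funext fun i => ?_))
  rw [expSeries_eq]
  exact map_hExp (Pi.evalAlgHom K (fun _ : n => K) i) _

theorem hSinhDiv_diagonal (c : ℝ) (r : n → ℝ) :
    hSinhDiv c (Matrix.diagonal fun i => (PowerSeries.C (r i) : K)) =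
      Matrix.diagonal fun i => sinhDiv c (r i) := by
  have h1 := map_hSinhDiv (Matrix.diagonalAlgHom (n := n) K) c fun i => (PowerSeries.C (r i) : K)
  refine h1.symm.trans (congrArg Matrix.diagonal (funext fun i => ?_))
  rw [sinhDiv_eq]
  exact map_hSinhDiv (Pi.evalAlgHom K (fun _ : n => K) i) c _

end Diagonal

theorem matrix_torsionFree {m n : Type*} (x : Matrix m n K) (hx : hbar • x = 0) : x = 0 := by
  ext1 i j
  have : hbar * x i j = 0 := congrFun (congrFun hx i) j
  exact (mul_eq_zero.1 this).resolve_left PowerSeries.X_ne_zero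

instance : Module.IsTorsionFree K (HAdic (M2 ⊗[K] M2)) :=
  isTorsionFree (HAdic.torsionFree (tensor_torsionFree matrix_torsionFree matrix_torsionFree))

/-- The generators in the fundamental representation. -/
noncomputable def fundGen (a : ℝ) : Gen → M2
  | .J3 => Gen.mat K .J3
  | .Jp => coshSeries (a / 2) • Gen.mat K .Jp
  | .Jm => sinhDiv (a / 2) (1 : ℝ) • Gen.mat K .Jm
  | .I => 1

theorem mat_J3_eq_diagonal :
    Gen.mat K .J3 = Matrix.diagonal fun i => (PowerSeries.C (![1, -1] i) : K) := by
  ext1 i j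
  fin_cases i <;> fin_cases j <;> simp [Gen.mat]

/-- The double-angle formula. It explains the normalisation of the fundamental representation: the
scalars of `D(J₊)` and `D(J₋)` must multiply to `sinh(aℏ)/(aℏ)`. -/
theorem coshSeries_mul_sinhDiv {a : ℝ} (ha : a ≠ 0) :
    coshSeries (a / 2) * sinhDiv (a / 2) (1 : ℝ) = sinhDiv a (1 : ℝ) := by
  refine mul_left_cancel₀ (C_mul_hbar_ne_zero (mul_ne_zero two_ne_zero ha)) ?_
  have h1 := hbar_mul_sinhDiv (a / 2)
  have h2 := two_mul_coshSeries (a / 2)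
  rw [show 2 * (a / 2) = a by ring] at h1
  rw [hbar_mul_sinhDiv, map_mul, map_ofNat]
  have h3 : ∀ x : ℝ, expSeries x = expSeries (x / 2) * expSeries (x / 2) := fun x => by
    rw [← expSeries_add, add_halves]
  rw [h3 a, h3 (-a), neg_div]
  linear_combination (2 * coshSeries (a / 2)) * h1 +
    (expSeries (a / 2) - expSeries (-(a / 2))) * h2

theorem hSinhDiv_mat_J3 (a : ℝ) :
    hSinhDiv a (Gen.mat K .J3) = sinhDiv a (1 : ℝ) • Gen.mat K .J3 := by
  rw [mat_J3_eq_diagonal, hSinhDiv_diagonal, ← Matrix.diagonal_smul]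
  congr 1
  ext1 i
  have h : sinhDiv a (-1 : ℝ) = -sinhDiv a (1 : ℝ) := by
    rw [sinhDiv_eq, sinhDiv_eq, map_neg, hSinhDiv_neg]
  fin_cases i <;> simp [h]

theorem isRep_fundGen {a : ℝ} (ha : a ≠ 0) : IsRep a (fundGen a) where
  J3_Jp := by
    rw [two_mul]
    ext1 i j
    fin_cases i <;> fin_cases j <;> simp [fundGen, Gen.mat]
  J3_Jm := by
    rw [two_mul]
    ext1 i j
    fin_cases i <;> fin_cases j <;> simp [fundGen, Gen.mat, sub_eq_add_neg]
  Jp_Jm := by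
    simp only [fundGen]
    rw [hSinhDiv_mat_J3, ← coshSeries_mul_sinhDiv ha, smul_mul_smul_comm, smul_mul_smul_comm,
      mul_comm (sinhDiv _ _), ← smul_sub]
    congr 1
    ext1 i j
    fin_cases i <;> fin_cases j <;> simp [Gen.mat]
  I_comm g := by simp only [fundGen, one_mul, mul_one]

theorem isFundamental_iff {a : ℝ} {D : UqGl2 a →ₐ[K] M2} :
    IsFundamental a D ↔ ∀ g, D (UqGl2.gen a g) = fundGen a g :=
  ⟨fun h g => by cases g <;> [exact h.map_J3; exact h.map_Jp; exact h.map_Jm; exact h.map_I],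
    fun h => ⟨h _, h _, h _, h _⟩⟩

theorem existsUnique_fundamental {a : ℝ} (ha : a ≠ 0) :
    ∃! D : UqGl2 a →ₐ[K] M2, IsFundamental a D :=
  ⟨UqGl2.lift (isRep_fundGen ha), isFundamental_iff.2 fun g => UqGl2.lift_gen _ g, fun D hD =>
    UqGl2.algHom_ext fun g => by rw [isFundamental_iff.1 hD, UqGl2.lift_gen]⟩

/-! ### The two-site Hamiltonian -/

/-- The two-site Hamiltonian as an identity between matrix units, with `p = exp(aℏ/2)` and `s =
exp(bℏ/2)`: `P, N` are the diagonal projections and `e, f` the spin flips. Everything is expanded in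
the pure tensors of these and compared coefficientwise. -/
theorem bond_identity {R A : Type*} [CommRing R] [Ring A] [Algebra R A] {P N e f : A}
    (h1 : 1 = P + N) (hPP : P * P = P) (hPN : P * N = 0) (hNP : N * P = 0) (hNN : N * N = N)
    (hPe : P * e = e) (heP : e * P = 0) (hNe : N * e = 0) (heN : e * N = e)
    (hPf : P * f = 0) (hfP : f * P = f) (hNf : N * f = f) (hfN : f * N = 0)
    (hef : e * f = P) (hfe : f * e = N)
    {p p' s s' ch sh : R} (hp : p * p' = 1) (hs : s * s' = 1)
    (hch : 2 * ch = p ^ 2 + p' ^ 2) (hsh : 2 * sh = p ^ 2 - p' ^ 2)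
    {Jp Jm : A ⊗[R] A}
    (hJp : Jp = ((p * s') • P + (p' * s') • N) ⊗ₜ e + e ⊗ₜ ((p' * s) • P + (p * s) • N))
    (hJm : Jm = ((p * s) • P + (p' * s) • N) ⊗ₜ f + f ⊗ₜ ((p' * s') • P + (p * s') • N)) :
    (p ^ 2 + p' ^ 2) • ((p ^ 2 • P + p' ^ 2 • N) ⊗ₜ (p ^ 2 • P + p' ^ 2 • N) +
      (p' ^ 2 • P + p ^ 2 • N) ⊗ₜ (p' ^ 2 • P + p ^ 2 • N) - (2 : R) • (1 ⊗ₜ 1)) +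
      (p ^ 2 - p' ^ 2) ^ 2 • (Jp * Jm + Jm * Jp) =
    (p ^ 2 - p' ^ 2) ^ 2 • ((3 * ch) • (1 ⊗ₜ[R] 1) + ch • ((P - N) ⊗ₜ[R] (P - N)) +
      sh • ((P - N) ⊗ₜ[R] (1 : A) - (1 : A) ⊗ₜ[R] (P - N)) +
      (2 * s ^ 2) • (e ⊗ₜ[R] f) + (2 * s' ^ 2) • (f ⊗ₜ[R] e)) := by
  rw [hJp, hJm, h1]
  simp only [TensorProduct.add_tmul, TensorProduct.tmul_add, TensorProduct.sub_tmul,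
    TensorProduct.tmul_sub, TensorProduct.tmul_smul, ← TensorProduct.smul_tmul', mul_add, add_mul,
    smul_mul_assoc, mul_smul_comm, Algebra.TensorProduct.tmul_mul_tmul, hPP, hPN, hNP, hNN, hPe,
    heP, hNe, heN, hPf, hfP, hNf, hfN, hef, hfe, TensorProduct.tmul_zero,
    TensorProduct.zero_tmul, smul_zero, add_zero, zero_add]
  match_scalars <;> grind

theorem cexp_fundGen (a s t : ℝ) : cexp (fundGen a) s t =
    (expSeries (s / 2) * expSeries (t / 2)) • (!![1, 0; 0, 0] : M2) +
      (expSeries (-s / 2) * expSeries (t / 2)) • (!![0, 0; 0, 1] : M2) := by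
  have h : (PowerSeries.C (s / 2) : K) • fundGen a .J3 + (PowerSeries.C (t / 2) : K) • fundGen a .I =
      Matrix.diagonal fun i => (PowerSeries.C (![s / 2 + t / 2, -s / 2 + t / 2] i) : K) := by
    ext1 i j
    fin_cases i <;> fin_cases j <;> simp [fundGen, Gen.mat, neg_div]
  rw [cexp, h, hExp_diagonal, ← expSeries_add, ← expSeries_add]
  ext1 i j
  fin_cases i <;> fin_cases j <;> simp

theorem smul_casimirGen_coprodGen {U : Type*} [Ring U] [Algebra K U] [HComplete U] (a b : ℝ)
    (v : Gen → U) (hv : Commute (v .I) (v .J3)) {X Y P M : U ⊗[K] U}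
    (hX : X = cexp v (2 * a) 0 ⊗ₜ cexp v (2 * a) 0)
    (hY : Y = cexp v (-(2 * a)) 0 ⊗ₜ cexp v (-(2 * a)) 0)
    (hP : P = cexp v a (-b) ⊗ₜ v .Jp + v .Jp ⊗ₜ cexp v (-a) b)
    (hM : M = cexp v a b ⊗ₜ v .Jm + v .Jm ⊗ₜ cexp v (-a) (-b)) :
    (2 * (PowerSeries.C a * hbar) ^ 2 : K) • casimirGen a (coprodGen a b (genL v) (genR v)) =
      HAdic.of ((expSeries a + expSeries (-a)) • (X + Y - (2 : K) • (1 ⊗ₜ 1)) +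
        ((expSeries a - expSeries (-a)) * (2 * (PowerSeries.C a * hbar))) • (P * M + M * P)) := by
  have hE : ∀ s, cexp (coprodGen a b (genL v) (genR v)) s 0 =
      HAdic.of (cexp v s 0 ⊗ₜ cexp v s 0) := fun s => by
    rw [cexp_coprodGen _ _ _ (commute_genL_genR _), ← inl_of_cexp, ← inr_of_cexp, ← HAdic.of_tmul]
  have hI : Commute (coprodGen a b (genL v) (genR v) .I) (coprodGen a b (genL v) (genR v) .J3) := by
    rw [coprodGen_genL_genR, coprodGen_genL_genR]
    simp [Commute, SemiconjBy, ← map_mul, mul_add, add_mul, hv.eq]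
    abel
  rw [smul_casimirGen _ _ hI, hE, hE, coprodGen_genL_genR, coprodGen_genL_genR, ← hX, ← hY]
  simp only [← hP, ← hM, map_add, map_sub, map_smul, map_mul]
  rfl

/-- Multiply by `2(aℏ)²` to remove the denominators, apply `bond_identity`, and cancel by
torsion-freeness. -/
theorem casimirGen_fundGen {a : ℝ} (ha : a ≠ 0) (b : ℝ) :
    casimirGen a (coprodGen a b (genL (fundGen a)) (genR (fundGen a))) =
      HAdic.of (xxzBond a b) := by
  have hne : (2 * (PowerSeries.C a * hbar) ^ 2 : K) ≠ 0 := by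
    have h := mul_ne_zero (C_mul_hbar_ne_zero (mul_ne_zero two_ne_zero ha)) (C_mul_hbar_ne_zero ha)
    rwa [map_mul, map_ofNat, mul_assoc (2 : K), mul_assoc (2 : K), ← pow_two] at h
  refine smul_cancel hne ?_
  have hc : (2 * (PowerSeries.C a * hbar) * sinhDiv a (1 : ℝ) : K) =
      expSeries a - expSeries (-a) := by
    rw [← hbar_mul_sinhDiv, map_mul, map_ofNat]
    ring
  have hsq : ∀ x : ℝ, expSeries x = expSeries (x / 2) ^ 2 := fun x => by
    rw [pow_two, ← expSeries_add, add_halves]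
  have hinv : ∀ x : ℝ, expSeries x * expSeries (-x) = 1 := fun x => by
    rw [← expSeries_add, add_neg_cancel, expSeries_zero]
  have key := bond_identity (R := K) (A := M2) (P := !![1, 0; 0, 0]) (N := !![0, 0; 0, 1])
    (e := Gen.mat K .Jp) (f := Gen.mat K .Jm) ?_ ?_ ?_ ?_ ?_ ?_ ?_ ?_ ?_ ?_ ?_ ?_ ?_ ?_ ?_
    (hinv (a / 2)) (hinv (b / 2)) (ch := coshSeries a) (sh := sinhSeries a) ?_ ?_ rfl rfl
  rotate_left
  iterate 15
    · ext1 i j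
      fin_cases i <;> fin_cases j <;> simp [Gen.mat]
  · rw [two_mul_coshSeries, hsq a, hsq (-a), neg_div]
  · rw [two_mul_sinhSeries, hsq a, hsq (-a), neg_div]
  rw [smul_casimirGen_coprodGen a b (fundGen a) (by simp [fundGen]) rfl rfl rfl rfl, ← map_smul]
  refine congrArg _ ?_
  have hJ3 : (!![1, 0; 0, 0] - !![0, 0; 0, 1] : M2) = Gen.mat K .J3 := by
    ext1 i j
    fin_cases i <;> fin_cases j <;> simp [Gen.mat]
  -- The scalars of `D(J₊)` and `D(J₋)` always occur as a product, which combines with the prefactor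
  -- `2aℏ` to a second factor `exp(aℏ) - exp(-aℏ)`.
  have hcc : ∀ x y x' y' : M2 ⊗[K] M2,
      ((expSeries a - expSeries (-a)) * (2 * (PowerSeries.C a * hbar)) : K) •
        ((coshSeries (a / 2) • x) * (sinhDiv (a / 2) (1 : ℝ) • y) +
          (sinhDiv (a / 2) (1 : ℝ) • y') * (coshSeries (a / 2) • x')) =
      (expSeries a - expSeries (-a)) ^ 2 • (x * y + y' * x') := fun x y x' y' => by
    rw [smul_mul_smul_comm, smul_mul_smul_comm, mul_comm (sinhDiv (a / 2) (1 : ℝ)),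
      coshSeries_mul_sinhDiv ha, ← smul_add, smul_smul, mul_assoc, hc, pow_two]
  rw [← neg_div, ← neg_div, ← hsq, ← hsq, ← hsq b, ← hsq (-b), hJ3] at key
  have hP : cexp (fundGen a) a (-b) ⊗ₜ[K] fundGen a .Jp + fundGen a .Jp ⊗ₜ cexp (fundGen a) (-a) b =
      coshSeries (a / 2) • (cexp (fundGen a) a (-b) ⊗ₜ[K] Gen.mat K .Jp +
        Gen.mat K .Jp ⊗ₜ cexp (fundGen a) (-a) b) := by
    rw [smul_add, ← TensorProduct.tmul_smul, TensorProduct.smul_tmul']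
    rfl
  have hM : cexp (fundGen a) a b ⊗ₜ[K] fundGen a .Jm + fundGen a .Jm ⊗ₜ cexp (fundGen a) (-a) (-b) =
      sinhDiv (a / 2) (1 : ℝ) • (cexp (fundGen a) a b ⊗ₜ[K] Gen.mat K .Jm +
        Gen.mat K .Jm ⊗ₜ cexp (fundGen a) (-a) (-b)) := by
    rw [smul_add, ← TensorProduct.tmul_smul, TensorProduct.smul_tmul']
    rfl
  rw [hP, hM, hcc]
  simp only [cexp_fundGen, neg_neg, zero_div, expSeries_zero, mul_one,
    mul_div_cancel_left₀ a (two_ne_zero' ℝ), show -(2 * a) / 2 = -a by ring]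
  refine key.trans ?_
  rw [xxzBond, smul_smul, show (2 * (PowerSeries.C a * hbar) ^ 2 * (2 * sinhDiv a (1 : ℝ) ^ 2) : K) =
    (2 * (PowerSeries.C a * hbar) * sinhDiv a (1 : ℝ)) ^ 2 by ring, hc]

/-! ### The closed chain -/

section Closed

variable {n : ℕ}

theorem siteOp_one (i : Fin n) : siteOp i (1 : M2) = 1 := by
  ext1 s t
  change (if ∀ j, j ≠ i → s j = t j then (1 : M2) (s i) (t i) else 0) = _
  by_cases hst : s = t
  · subst hst
    simp
  · rw [Matrix.one_apply_ne hst]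
    split_ifs with h
    · refine Matrix.one_apply_ne fun hi => hst (funext fun j => ?_)
      by_cases hj : j = i
      · rw [hj, hi]
      · exact h j hj
    · rfl

theorem bondOp_tmul (i j : Fin n) (A B : M2) : bondOp i j (A ⊗ₜ B) = siteOp i A * siteOp j B := rfl

/-- The eigenvalue of `σ₃` on a basis vector. -/
def spin (s : Fin 2) : ℝ := if s = 0 then 1 else -1

/-- The operator `exp (ℏ ∑ⱼ cⱼ σ₃ʲ)`. -/
noncomputable def gauge (c : Fin n → ℝ) : ChainOp n :=
  Matrix.diagonal fun s => expSeries (∑ j, c j * spin (s j))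

theorem isUnit_gauge (c : Fin n → ℝ) : IsUnit (gauge c) := by
  have h : ∀ c c' : Fin n → ℝ, c + c' = 0 → gauge c * gauge c' = 1 := fun c c' h => by
    rw [gauge, gauge, Matrix.diagonal_mul_diagonal, ← Matrix.diagonal_one]
    congr 1
    ext1 s
    rw [← expSeries_add, ← Finset.sum_add_distrib, ← expSeries_zero]
    congr 1
    refine Finset.sum_eq_zero fun j _ => ?_
    rw [← add_mul, show c j + c' j = 0 from congrFun h j, zero_mul]
  exact ⟨⟨gauge c, gauge (-c), h _ _ (add_neg_cancel c), h _ _ (neg_add_cancel c)⟩, rfl⟩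

/-- Configurations linked by a one-site operator differ only at that site, so the diagonal phases
differ by the change of spin there. -/
theorem gauge_mul_siteOp (c : Fin n → ℝ) (i : Fin n) (A : M2) (r : ℝ)
    (hA : ∀ p q, A p q ≠ 0 → c i * spin p = r + c i * spin q) :
    gauge c * siteOp i A = expSeries r • (siteOp i A * gauge c) := by
  ext1 s t
  rw [gauge, Matrix.diagonal_mul, Matrix.smul_apply, Matrix.mul_diagonal, smul_eq_mul]
  change _ * (if ∀ j, j ≠ i → s j = t j then A (s i) (t i) else 0) =
    _ * ((if ∀ j, j ≠ i → s j = t j then A (s i) (t i) else 0) * _)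
  split_ifs with h
  · by_cases h0 : A (s i) (t i) = 0
    · rw [h0, zero_mul, mul_zero, mul_zero]
    · have : ∑ j, c j * spin (s j) = r + ∑ j, c j * spin (t j) := by
        rw [← Finset.add_sum_erase _ _ (Finset.mem_univ i),
          ← Finset.add_sum_erase (a := i) _ (fun j => c j * spin (t j)) (Finset.mem_univ i),
          hA _ _ h0, add_assoc]
        congr 2
        exact Finset.sum_congr rfl fun j hj => by rw [h j (Finset.ne_of_mem_erase hj)]
      rw [this, expSeries_add]
      ring
  · rw [zero_mul, mul_zero, mul_zero]

theorem gauge_mul_J3 (c : Fin n → ℝ) (i : Fin n) :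
    gauge c * siteOp i (Gen.mat K .J3) = siteOp i (Gen.mat K .J3) * gauge c := by
  rw [gauge_mul_siteOp c i _ 0, expSeries_zero, one_smul]
  intro p q h
  fin_cases p <;> fin_cases q <;> simp_all [Gen.mat]

theorem gauge_mul_Jp (c : Fin n → ℝ) (i : Fin n) :
    gauge c * siteOp i (Gen.mat K .Jp) =
      expSeries (2 * c i) • (siteOp i (Gen.mat K .Jp) * gauge c) := by
  refine gauge_mul_siteOp c i _ _ ?_
  intro p q h
  fin_cases p <;> fin_cases q <;> simp_all [Gen.mat, spin]
  ring

theorem gauge_mul_Jm (c : Fin n → ℝ) (i : Fin n) :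
    gauge c * siteOp i (Gen.mat K .Jm) =
      expSeries (-(2 * c i)) • (siteOp i (Gen.mat K .Jm) * gauge c) := by
  refine gauge_mul_siteOp c i _ _ ?_
  intro p q h
  fin_cases p <;> fin_cases q <;> simp_all [Gen.mat, spin]
  ring

theorem bondOp_xxzBond (a b : ℝ) (i j : Fin n) : bondOp i j (xxzBond a b) =
    (2 * sinhDiv a (1 : ℝ) ^ 2 : K) •
    ((3 * coshSeries a) • (1 : ChainOp n) +
      coshSeries a • (siteOp i (Gen.mat K .J3) * siteOp j (Gen.mat K .J3)) +
      sinhSeries a • (siteOp i (Gen.mat K .J3) - siteOp j (Gen.mat K .J3)) +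
      (2 * expSeries b) • (siteOp i (Gen.mat K .Jp) * siteOp j (Gen.mat K .Jm)) +
      (2 * expSeries (-b)) • (siteOp i (Gen.mat K .Jm) * siteOp j (Gen.mat K .Jp))) := by
  simp only [xxzBond, map_smul, map_add, map_sub, bondOp_tmul, siteOp_one, one_mul, mul_one]

/-- The gauge multiplies the hopping terms by `exp(±2(cᵢ - cⱼ)ℏ)` and fixes the rest, so the phase
`φ` becomes `b`. The non-hermitian term `σ₃ⁱ - σ₃ʲ` is subtracted here, because it cancels only
after summation over the ring. -/
theorem gauge_mul_twistedBond (a b φ : ℝ) (c : Fin n → ℝ) (i j : Fin n)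
    (h : φ + 2 * (c i - c j) = b) :
    gauge c * ((2 * sinhDiv a (1 : ℝ) ^ 2 : K) • ((3 * coshSeries a) • (1 : ChainOp n) +
      coshSeries a • (siteOp i (Gen.mat K .J3) * siteOp j (Gen.mat K .J3)) +
      (2 * expSeries φ) • (siteOp i (Gen.mat K .Jp) * siteOp j (Gen.mat K .Jm)) +
      (2 * expSeries (-φ)) • (siteOp i (Gen.mat K .Jm) * siteOp j (Gen.mat K .Jp)))) =
    (bondOp i j (xxzBond a b) - (2 * sinhDiv a (1 : ℝ) ^ 2 * sinhSeries a : K) •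
      (siteOp i (Gen.mat K .J3) - siteOp j (Gen.mat K .J3))) * gauge c := by
  have h3 : gauge c * (siteOp i (Gen.mat K .J3) * siteOp j (Gen.mat K .J3)) =
      siteOp i (Gen.mat K .J3) * siteOp j (Gen.mat K .J3) * gauge c := by
    rw [← mul_assoc, gauge_mul_J3, mul_assoc, gauge_mul_J3, mul_assoc]
  have hp : gauge c * (siteOp i (Gen.mat K .Jp) * siteOp j (Gen.mat K .Jm)) =
      expSeries (2 * (c i - c j)) •
        (siteOp i (Gen.mat K .Jp) * siteOp j (Gen.mat K .Jm) * gauge c) := by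
    rw [← mul_assoc, gauge_mul_Jp, smul_mul_assoc, mul_assoc, gauge_mul_Jm, mul_smul_comm, smul_smul,
      ← expSeries_add, mul_assoc]
    congr 2
    ring
  have hm : gauge c * (siteOp i (Gen.mat K .Jm) * siteOp j (Gen.mat K .Jp)) =
      expSeries (-(2 * (c i - c j))) •
        (siteOp i (Gen.mat K .Jm) * siteOp j (Gen.mat K .Jp) * gauge c) := by
    rw [← mul_assoc, gauge_mul_Jm, smul_mul_assoc, mul_assoc, gauge_mul_Jp, mul_smul_comm, smul_smul,
      ← expSeries_add, mul_assoc]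
    congr 2
    ring
  have e1 : expSeries b = expSeries φ * expSeries (2 * (c i - c j)) := by rw [← expSeries_add, h]
  have e2 : expSeries (-b) = expSeries (-φ) * expSeries (-(2 * (c i - c j))) := by
    rw [← expSeries_add, ← neg_add, h]
  rw [bondOp_xxzBond, e1, e2]
  simp only [mul_smul_comm, mul_add, h3, hp, hm, mul_one, sub_mul, smul_mul_assoc, add_mul, one_mul,
    smul_add, smul_sub, smul_smul]
  simp only [mul_assoc]
  abel

theorem exists_conjugate (n : ℕ) (a b : ℝ) : ∃ S : ChainOp (n + 2), IsUnit S ∧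
    S * twistedXXZ n a ((n + 2 : ℕ) * b) = periodicChain n (xxzBond a b) * S := by
  -- The linear profile `cⱼ = -bj/2` gives `2(cᵢ - cᵢ₊₁) = b` inside the chain. At the closing bond
  -- it gives `-(N - 1)b`, which the boundary phase `Nb` corrects to `b`.
  refine ⟨gauge fun j => -(b / 2) * (j : ℕ), isUnit_gauge _, ?_⟩
  have htel : ∑ i : Fin (n + 2), (siteOp i (Gen.mat K .J3) - siteOp (i + 1) (Gen.mat K .J3)) =
      (0 : ChainOp (n + 2)) := by
    rw [Finset.sum_sub_distrib, sub_eq_zero]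
    exact (Equiv.sum_comp (Equiv.addRight (1 : Fin (n + 2)))
      fun i => siteOp (n := n + 2) i (Gen.mat K .J3)).symm
  have hper : periodicChain n (xxzBond a b) = ∑ i : Fin (n + 2), (bondOp i (i + 1) (xxzBond a b) -
      (2 * sinhDiv a (1 : ℝ) ^ 2 * sinhSeries a : K) •
        (siteOp i (Gen.mat K .J3) - siteOp (i + 1) (Gen.mat K .J3))) := by
    rw [Finset.sum_sub_distrib, ← Finset.smul_sum, htel, smul_zero, sub_zero, periodicChain]
  rw [hper, twistedXXZ, Finset.mul_sum, Finset.sum_mul]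
  refine Finset.sum_congr rfl fun i _ => ?_
  have e : ∀ φ : ℝ, (if i = Fin.last (n + 1) then expSeries φ else 1 : K) =
      expSeries (if i = Fin.last (n + 1) then φ else 0) := fun φ => by
    split_ifs
    · rfl
    · exact expSeries_zero.symm
  have e' : (if i = Fin.last (n + 1) then -((n + 2 : ℕ) * b) else 0) =
      -(if i = Fin.last (n + 1) then ((n + 2 : ℕ) * b) else 0) := by
    split_ifs <;> simp
  rw [e, e, e']
  refine gauge_mul_twistedBond a b _ _ i (i + 1) ?_
  split_ifs with hi
  · subst hi
    rw [Fin.last_add_one]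
    push_cast
    simp
    ring
  · rw [Fin.val_add_one_of_lt (lt_of_le_of_ne (Fin.le_last i) hi)]
    push_cast
    ring

end Closed

/-! ### The open chain -/

theorem appendSite_apply (n : ℕ) (A : ChainOp n) (B : M2) (s t : Fin (n + 1) → Fin 2) :
    appendSite n (A ⊗ₜ B) s t =
      A (fun i => s i.castSucc) (fun i => t i.castSucc) * B (s (Fin.last n)) (t (Fin.last n)) := rfl

theorem appendSite_mul (n : ℕ) (A A' : ChainOp n) (B B' : M2) :
    appendSite n ((A * A') ⊗ₜ (B * B')) = appendSite n (A ⊗ₜ B) * appendSite n (A' ⊗ₜ B') := by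
  ext1 s t
  rw [appendSite_apply, Matrix.mul_apply, Matrix.mul_apply, Matrix.mul_apply, Finset.sum_mul_sum,
    ← Finset.sum_product', Finset.univ_product_univ,
    ← Equiv.sum_comp ((Equiv.prodComm _ _).trans (Fin.snocEquiv fun _ : Fin (n + 1) => Fin 2))]
  refine Finset.sum_congr rfl fun x _ => ?_
  simp only [appendSite_apply, Equiv.trans_apply, Equiv.prodComm_apply, Fin.snocEquiv,
    Equiv.coe_fn_mk, Fin.snoc_castSucc, Fin.snoc_last, Prod.fst_swap, Prod.snd_swap]
  ring

theorem funext_castSucc_iff {n : ℕ} {s t : Fin (n + 1) → Fin 2} :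
    s = t ↔ (fun i : Fin n => s i.castSucc) = (fun i : Fin n => t i.castSucc) ∧
      s (Fin.last n) = t (Fin.last n) := by
  constructor
  · rintro rfl
    exact ⟨rfl, rfl⟩
  · rintro ⟨h, h'⟩
    exact funext fun i => Fin.lastCases h' (fun j => congrFun h j) i

theorem appendSite_one (n : ℕ) : appendSite n (1 ⊗ₜ 1) = 1 := by
  ext1 s t
  rw [appendSite_apply, Matrix.one_apply, Matrix.one_apply, Matrix.one_apply]
  simp only [funext_castSucc_iff (s := s), ite_and, mul_ite, mul_one, mul_zero]
  split_ifs <;> rfl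

/-- `appendSite` as an algebra homomorphism. -/
noncomputable def appendHom (n : ℕ) : ChainOp n ⊗[K] M2 →ₐ[K] ChainOp (n + 1) :=
  Algebra.TensorProduct.algHomOfLinearMapTensorProduct (appendSite n) (appendSite_mul n)
    (appendSite_one n)

theorem siteOp_apply {n : ℕ} (i : Fin n) (A : M2) (s t : Fin n → Fin 2) :
    siteOp i A s t = if ∀ j, j ≠ i → s j = t j then A (s i) (t i) else 0 := rfl

theorem siteOp_last (n : ℕ) (B : M2) : siteOp (Fin.last n) B = appendSite n (1 ⊗ₜ B) := by
  ext1 s t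
  rw [appendSite_apply, Matrix.one_apply, siteOp_apply, ite_mul, one_mul, zero_mul]
  congr 1
  refine propext ⟨fun h => funext fun i => h _ (Fin.castSucc_lt_last i).ne, fun h j hj => ?_⟩
  induction j using Fin.lastCases with
  | last => exact absurd rfl hj
  | cast i => exact congrFun h i

theorem siteOp_castSucc {n : ℕ} (i : Fin n) (A : M2) :
    siteOp i.castSucc A = appendSite n (siteOp i A ⊗ₜ 1) := by
  ext1 s t
  rw [appendSite_apply, Matrix.one_apply, siteOp_apply, siteOp_apply, mul_ite, mul_one, mul_zero,
    ← ite_and]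
  congr 1
  refine propext ⟨fun h => ⟨h _ (Fin.castSucc_lt_last i).ne', fun j hj =>
    h _ fun h' => hj (Fin.castSucc_injective _ h')⟩, fun h j hj => ?_⟩
  induction j using Fin.lastCases with
  | last => exact h.1
  | cast j => exact h.2 j fun h' => hj (congrArg _ h')

theorem bondOp_castSucc {n : ℕ} (i j : Fin n) (h : M2 ⊗[K] M2) :
    bondOp i.castSucc j.castSucc h = appendSite n (bondOp i j h ⊗ₜ 1) := by
  induction h using TensorProduct.induction_on with
  | zero => rw [map_zero, map_zero, TensorProduct.zero_tmul, map_zero]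
  | tmul A B =>
    rw [bondOp_tmul, bondOp_tmul, siteOp_castSucc, siteOp_castSucc, ← appendSite_mul, one_mul]
  | add x y hx hy => rw [map_add, map_add, TensorProduct.add_tmul, map_add, hx, hy]

theorem bondOp_last_tmul (n : ℕ) (A B : M2) :
    bondOp (Fin.last n).castSucc (Fin.last (n + 1)) (A ⊗ₜ B) =
      appendSite (n + 1) (appendSite n (1 ⊗ₜ A) ⊗ₜ B) := by
  rw [bondOp_tmul, siteOp_castSucc, siteOp_last (n + 1), ← appendSite_mul, siteOp_last, one_mul,
    mul_one]

/-- Isolates the last bond, the only one that touches the new site. -/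
theorem openChain_succ (N : ℕ) (h : M2 ⊗[K] M2) : openChain (N + 1) h =
    appendSite (N + 1) (openChain N h ⊗ₜ 1) +
      bondOp (Fin.last N).castSucc (Fin.last (N + 1)) h := by
  rw [openChain, Fin.sum_univ_castSucc, openChain, TensorProduct.sum_tmul, map_sum, Fin.succ_last]
  simp only [← Fin.castSucc_succ, bondOp_castSucc]

/-! ### Chain representations and the symmetry of the open chain -/

section Rep

variable {U : Type*} [Ring U] [Algebra K U]

/-- The representation on one more site. -/
noncomputable def appendRep {n : ℕ} (ρ : U →ₐ[K] ChainOp n) (D : U →ₐ[K] M2) :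
    HAdic (U ⊗[K] U) →ₐ[K] HAdic (ChainOp (n + 1)) :=
  HAdic.mapAlg ((appendHom n).comp (Algebra.TensorProduct.map ρ D))

theorem appendRep_of {n : ℕ} (ρ : U →ₐ[K] ChainOp n) (D : U →ₐ[K] M2) (x y : U) :
    appendRep ρ D (HAdic.of (x ⊗ₜ y)) = HAdic.of (appendSite n (ρ x ⊗ₜ D y)) := rfl

theorem commute_appendRep {n : ℕ} {ρ : U →ₐ[K] ChainOp n} {D : U →ₐ[K] M2} {X : ChainOp n}
    (h : ∀ x, Commute X (ρ x)) (Z : HAdic (U ⊗[K] U)) :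
    Commute (HAdic.of (appendSite n (X ⊗ₜ 1))) (appendRep ρ D Z) := by
  have : LinearMap.mulLeft K (HAdic.of (appendSite n (X ⊗ₜ 1))) ∘ₗ (appendRep ρ D).toLinearMap =
      LinearMap.mulRight K (HAdic.of (appendSite n (X ⊗ₜ 1))) ∘ₗ (appendRep ρ D).toLinearMap := by
    refine HAdic.hom_ext_tensor fun x y => ?_
    simp only [LinearMap.comp_apply, LinearMap.mulLeft_apply, LinearMap.mulRight_apply,
      AlgHom.toLinearMap_apply, appendRep_of, ← map_mul, ← appendSite_mul, one_mul, mul_one, (h x).eq]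
  exact LinearMap.congr_fun this Z

/-- The representation on two more sites. -/
noncomputable def appendRep₂ {n : ℕ} (ρ : U →ₐ[K] ChainOp n) (D : U →ₐ[K] M2) :
    HAdic (U ⊗[K] (U ⊗[K] U)) →ₐ[K] HAdic (ChainOp (n + 2)) :=
  HAdic.mapAlg (((appendHom (n + 1)).comp (Algebra.TensorProduct.map
    ((appendHom n).comp (Algebra.TensorProduct.map ρ D)) D)).comp
      (Algebra.TensorProduct.assoc K K K U U U).symm.toAlgHom)

theorem appendRep₂_of {n : ℕ} (ρ : U →ₐ[K] ChainOp n) (D : U →ₐ[K] M2) (x y z : U) :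
    appendRep₂ ρ D (HAdic.of (x ⊗ₜ (y ⊗ₜ z))) =
      HAdic.of (appendSite (n + 1) (appendSite n (ρ x ⊗ₜ D y) ⊗ₜ D z)) := rfl

theorem appendRep₂_assoc {n : ℕ} (ρ : U →ₐ[K] ChainOp n) (D : U →ₐ[K] M2)
    (Z : HAdic ((U ⊗[K] U) ⊗[K] U)) : appendRep₂ ρ D (assocHom U Z) =
      HAdic.mapAlg ((appendHom (n + 1)).comp (Algebra.TensorProduct.map
        ((appendHom n).comp (Algebra.TensorProduct.map ρ D)) D)) Z := by
  have : (appendRep₂ ρ D).toLinearMap ∘ₗ (assocHom U).toLinearMap =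
      (HAdic.mapAlg ((appendHom (n + 1)).comp (Algebra.TensorProduct.map
        ((appendHom n).comp (Algebra.TensorProduct.map ρ D)) D))).toLinearMap := by
    refine HAdic.hom_ext_tensor fun t z => ?_
    induction t using TensorProduct.induction_on with
    | zero => simp only [TensorProduct.zero_tmul, map_zero]
    | tmul x y => rfl
    | add s t hs ht => simp only [TensorProduct.add_tmul, map_add, hs, ht]
  exact LinearMap.congr_fun this Z

theorem HAdic.mapAlg_comp {A B P : Type*} [Ring A] [Algebra K A] [Ring B] [Algebra K B] [Ring P]
    [Algebra K P] (g : B →ₐ[K] P) (f : A →ₐ[K] B) (x : HAdic A) :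
    HAdic.mapAlg (g.comp f) x = HAdic.mapAlg g (HAdic.mapAlg f x) := by
  have : (HAdic.mapAlg (g.comp f)).toLinearMap =
      (HAdic.mapAlg g).toLinearMap ∘ₗ (HAdic.mapAlg f).toLinearMap := by
    refine HAdic.hom_ext fun a => ?_
    rfl
  exact LinearMap.congr_fun this x

theorem HAdic.mapAlg_tmul {A B P Q : Type*} [Ring A] [Algebra K A] [Ring B] [Algebra K B] [Ring P]
    [Algebra K P] [Ring Q] [Algebra K Q] (f : A →ₐ[K] P) (g : B →ₐ[K] Q) (x : HAdic A)
    (y : HAdic B) : HAdic.mapAlg (Algebra.TensorProduct.map f g) (HAdic.tmul x y) =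
      HAdic.tmul (HAdic.mapAlg f x) (HAdic.mapAlg g y) := by
  have h1 : ∀ a, (HAdic.mapAlg (Algebra.TensorProduct.map f g)).toLinearMap ∘ₗ
      HAdic.tmul (HAdic.of a) = HAdic.tmul (HAdic.of (f a)) ∘ₗ (HAdic.mapAlg g).toLinearMap := by
    intro a
    refine HAdic.hom_ext fun b => ?_
    rfl
  have h2 : (HAdic.mapAlg (Algebra.TensorProduct.map f g)).toLinearMap ∘ₗ HAdic.tmul.flip y =
      HAdic.tmul.flip (HAdic.mapAlg g y) ∘ₗ (HAdic.mapAlg f).toLinearMap := by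
    refine HAdic.hom_ext fun a => ?_
    exact LinearMap.congr_fun (h1 a) y
  exact LinearMap.congr_fun h2 x

/-- Unfolds the coproduct hidden in `ρ'`, so that the last two sites become visible as separate
tensor factors. -/
theorem appendRep_of_comul {n : ℕ} {ρ : U →ₐ[K] ChainOp n} {ρ' : U →ₐ[K] ChainOp (n + 1)}
    {D : U →ₐ[K] M2} {Δ : U →ₐ[K] HAdic (U ⊗[K] U)}
    (h : ∀ x, HAdic.of (ρ' x) = appendRep ρ D (Δ x)) (Z : HAdic (U ⊗[K] U)) :
    appendRep ρ' D Z = appendRep₂ ρ D (comulLeft Δ Z) := by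
  have : (appendRep ρ' D).toLinearMap =
      (appendRep₂ ρ D).toLinearMap ∘ₗ (comulLeft Δ).toLinearMap := by
    refine HAdic.hom_ext_tensor fun x y => ?_
    simp only [LinearMap.comp_apply, AlgHom.toLinearMap_apply, comulLeft, AlgHom.comp_apply,
      appendRep₂_assoc, HAdic.tensorAlg_of]
    have e : ∀ (W : HAdic (U ⊗[K] U)) (w : HAdic U), HAdic.mapAlg ((appendHom (n + 1)).comp
        (Algebra.TensorProduct.map ((appendHom n).comp (Algebra.TensorProduct.map ρ D)) D))
          (HAdic.tmul W w) =
        HAdic.mapAlg (appendHom (n + 1)) (HAdic.tmul (appendRep ρ D W) (HAdic.mapAlg D w)) := by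
      intro W w
      rw [appendRep, ← HAdic.mapAlg_tmul, HAdic.mapAlg_comp]
    rw [e, ← h, HAdic.mapAlg_of, HAdic.tmul_of]
    rfl
  exact LinearMap.congr_fun this Z

theorem appendRep₂_inr {n : ℕ} (ρ : U →ₐ[K] ChainOp n) (D : U →ₐ[K] M2) (Z : HAdic (U ⊗[K] U)) :
    appendRep₂ ρ D (HAdic.inr U _ Z) =
      HAdic.map (bondOp (Fin.last n).castSucc (Fin.last (n + 1)))
        (HAdic.map (TensorProduct.map D.toLinearMap D.toLinearMap) Z) := by
  have : (appendRep₂ ρ D).toLinearMap ∘ₗ (HAdic.inr U (U ⊗[K] U)).toLinearMap =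
      HAdic.map (bondOp (Fin.last n).castSucc (Fin.last (n + 1))) ∘ₗ
        HAdic.map (TensorProduct.map D.toLinearMap D.toLinearMap) := by
    refine HAdic.hom_ext_tensor fun x y => ?_
    simp only [LinearMap.comp_apply, AlgHom.toLinearMap_apply, HAdic.inr_of, appendRep₂_of,
      HAdic.map_of, TensorProduct.map_tmul, bondOp_last_tmul, map_one]
  exact LinearMap.congr_fun this Z

/-- `1 ⊗ c` with `c` central commutes with pure tensors, hence with the whole completed square, in
particular with every `Δ(x)`. -/
theorem commute_inr_of {c : U} (hc : ∀ x, c * x = x * c) (Z : HAdic (U ⊗[K] U)) :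
    Commute (HAdic.inr U U (HAdic.of c)) Z := by
  have : LinearMap.mulLeft K (HAdic.inr U U (HAdic.of c)) =
      LinearMap.mulRight K (HAdic.inr U U (HAdic.of c)) := by
    refine HAdic.hom_ext_tensor fun x y => ?_
    simp only [LinearMap.mulLeft_apply, LinearMap.mulRight_apply, HAdic.inr_of, ← map_mul,
      Algebra.TensorProduct.tmul_mul_tmul, one_mul, mul_one, hc]
  exact LinearMap.congr_fun this Z

/-- The bond is the image of `1 ⊗ c` under `id ⊗ Δ`. By coassociativity the symmetry operator is the
image of `Δ(x)` under the same homomorphism, and these two elements commute. -/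
theorem commute_bondOp_last {n : ℕ} {ρ : U →ₐ[K] ChainOp n} {ρ' : U →ₐ[K] ChainOp (n + 1)}
    {D : U →ₐ[K] M2} {Δ : U →ₐ[K] HAdic (U ⊗[K] U)}
    (h : ∀ x, HAdic.of (ρ' x) = appendRep ρ D (Δ x))
    (hΔ : ∀ x, comulLeft Δ (Δ x) = comulRight Δ (Δ x)) {c : U} (hc : ∀ x, c * x = x * c)
    {B : M2 ⊗[K] M2}
    (hB : HAdic.map (TensorProduct.map D.toLinearMap D.toLinearMap) (Δ c) = HAdic.of B) (x : U) :
    Commute (HAdic.of (bondOp (Fin.last n).castSucc (Fin.last (n + 1)) B))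
      (appendRep ρ' D (Δ x)) := by
  have e : HAdic.of (bondOp (Fin.last n).castSucc (Fin.last (n + 1)) B) =
      appendRep₂ ρ D (comulRight Δ (HAdic.inr U U (HAdic.of c))) := by
    rw [comulRight_inr, appendRep₂_inr, hB, HAdic.map_of]
  rw [e, appendRep_of_comul h, hΔ]
  exact ((commute_inr_of hc _).map _).map _

/-- Induction on the length: the earlier bonds act trivially on the new site and commute with each
`ρ(x) ⊗ D(y)` by hypothesis, while the last bond is `commute_bondOp_last`. -/
theorem commute_openChain {D : U →ₐ[K] M2} {Δ : U →ₐ[K] HAdic (U ⊗[K] U)}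
    {ρ : ∀ n : ℕ, U →ₐ[K] ChainOp n}
    (h : ∀ n x, HAdic.of (ρ (n + 1) x) = appendRep (ρ n) D (Δ x))
    (hΔ : ∀ x, comulLeft Δ (Δ x) = comulRight Δ (Δ x)) {c : U} (hc : ∀ x, c * x = x * c)
    {B : M2 ⊗[K] M2}
    (hB : HAdic.map (TensorProduct.map D.toLinearMap D.toLinearMap) (Δ c) = HAdic.of B)
    (N : ℕ) (x : U) : Commute (openChain N B) (ρ (N + 1) x) := by
  induction N generalizing x with
  | zero =>
    rw [openChain, Finset.univ_eq_empty, Finset.sum_empty]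
    exact Commute.zero_left _
  | succ N ih =>
    have key : Commute (HAdic.of (openChain (N + 1) B)) (HAdic.of (ρ (N + 1 + 1) x)) := by
      rw [openChain_succ, map_add, h]
      exact (commute_appendRep ih _).add_left (commute_bondOp_last (h N) hΔ hc hB x)
    refine HAdic.of_injective ?_
    rw [map_mul, map_mul]
    exact key.eq

/-- The representations on the chains. -/
noncomputable def chainRep (Δ : U →ₐ[K] HAdic (U ⊗[K] U)) (ε : U →ₐ[K] K) (D : U →ₐ[K] M2) :
    ∀ n : ℕ, U →ₐ[K] ChainOp n
  | 0 => (Algebra.ofId K (ChainOp 0)).comp ε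
  | n + 1 => ((HAdic.ofEquiv (ChainOp (n + 1))).symm.toAlgHom.comp
      (appendRep (chainRep Δ ε D n) D)).comp Δ

theorem of_chainRep_succ (Δ : U →ₐ[K] HAdic (U ⊗[K] U)) (ε : U →ₐ[K] K) (D : U →ₐ[K] M2) (n : ℕ)
    (x : U) : HAdic.of (chainRep Δ ε D (n + 1) x) = appendRep (chainRep Δ ε D n) D (Δ x) :=
  HAdic.of_ofEquiv_symm _

end Rep

theorem HAdicHopf.comulLeft_eq {U : Type*} [Ring U] [Algebra K U] (H : HAdicHopf U) (x : U) :
    comulLeft H.comul (H.comul x) = comulRight H.comul (H.comul x) := by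
  rw [comulLeft, comulRight, AlgHom.comp_apply, HAdic.tensorAlg_apply, HAdic.tensorAlg_apply]
  exact H.coassoc x

theorem map_mapAlg_comul {U : Type*} [Ring U] [Algebra K U] {D : U →ₐ[K] M2} {v : Gen → U}
    {d : Gen → M2} (hD : ∀ g, D (v g) = d g) :
    (fun g => HAdic.mapAlg (Algebra.TensorProduct.map D D) (genL v g)) = genL d ∧
    (fun g => HAdic.mapAlg (Algebra.TensorProduct.map D D) (genR v g)) = genR d := by
  constructor <;> ext1 g
  · change HAdic.of (D (v g) ⊗ₜ D 1) = HAdic.of (d g ⊗ₜ 1)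
    rw [hD, map_one]
  · change HAdic.of (D 1 ⊗ₜ D (v g)) = HAdic.of (1 ⊗ₜ d g)
    rw [hD, map_one]

/-- Homomorphisms commute with the formation of the Casimir, so the image of `Δ(C)` is the Casimir
of the two-site generators. -/
theorem map_comul_casimirGen {U : Type*} [Ring U] [Algebra K U] [HComplete U] {D : U →ₐ[K] M2}
    {v : Gen → U} {Δ : U →ₐ[K] HAdic (U ⊗[K] U)} {a b : ℝ} (ha : a ≠ 0)
    (hΔ : ∀ g, Δ (v g) = coprodGen a b (genL v) (genR v) g) (hD : ∀ g, D (v g) = fundGen a g) :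
    HAdic.map (TensorProduct.map D.toLinearMap D.toLinearMap) (Δ (casimirGen a v)) =
      HAdic.of (xxzBond a b) := by
  rw [← casimirGen_fundGen ha, map_casimirGen]
  change HAdic.mapAlg (Algebra.TensorProduct.map D D) _ = _
  rw [map_casimirGen]
  congr 1
  ext1 g
  rw [hΔ, map_coprodGen, (map_mapAlg_comul hD).1, (map_mapAlg_comul hD).2]

theorem IsUab.map_comul_casimir {a b : ℝ} (ha : a ≠ 0) {H : HAdicHopf (UqGl2 a)}
    {D : UqGl2 a →ₐ[K] M2} (h : IsUab a b H) (hD : IsFundamental a D) :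
    HAdic.map (TensorProduct.map D.toLinearMap D.toLinearMap) (H.comul (casimir a)) =
      HAdic.of (xxzBond a b) := by
  rw [casimir_eq]
  exact map_comul_casimirGen ha h.comul_gen (isFundamental_iff.1 hD)

/-- Matrix algebras over `K` are their own completions, so the iterated coproduct, though it takes
values in completed tensor powers, yields honest matrices at every length. -/
theorem IsUab.exists_chainRep {a b : ℝ} (ha : a ≠ 0) {H : HAdicHopf (UqGl2 a)}
    {D : UqGl2 a →ₐ[K] M2} (h : IsUab a b H) (hD : IsFundamental a D) :
    ∃ ρ : ∀ n : ℕ, UqGl2 a →ₐ[K] ChainOp n, IsChainRep H D ρ ∧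
      ∀ (N : ℕ) (x : UqGl2 a), Commute (openChain N (xxzBond a b)) (ρ (N + 1) x) :=
  ⟨chainRep H.comul H.counit D, ⟨fun _ => rfl, of_chainRep_succ H.comul H.counit D⟩,
    commute_openChain (of_chainRep_succ H.comul H.counit D) H.comulLeft_eq (casimir_central ha)
      (h.map_comul_casimir ha hD)⟩

end QuantumGL2

theorem mainTheorem7 (a b : ℝ) (ha : a ≠ 0) :
    (IsLieBialgebra (cocomm a b) ∧
      (∀ x : Gl2, cocomm a b x = ⁅x, rMatrix a b⁆) ∧
      (∀ x : Gl2, ⁅x, schouten (rMatrix a b)⁆ = 0) ∧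
      schouten (rMatrix a b) ≠ 0) ∧
    (∃! H : HAdicHopf (UqGl2 a), IsUab a b H) ∧
    (∃ π : UqGl2 a →+* UniversalEnvelopingAlgebra ℝ Gl2,
      (∀ g : Gen, π (UqGl2.gen a g) = UniversalEnvelopingAlgebra.ι ℝ (Gen.mat ℝ g)) ∧
      (∀ H : HAdicHopf (UqGl2 a), IsUab a b H → IsQuantization H (cocomm a b) π) ∧
      π (casimir a) = π (UqGl2.gen a .J3 ^ 2 + 2 * (UqGl2.gen a .Jp * UqGl2.gen a .Jm) +
        2 * (UqGl2.gen a .Jm * UqGl2.gen a .Jp))) ∧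
    (∀ x : UqGl2 a, casimir a * x = x * casimir a) ∧
    (∀ H H₀ : HAdicHopf (UqGl2 a), IsUab a b H → IsUab a 0 H₀ →
      IsTwist H₀ (twistElement a b) ∧
      HAdic.map (TensorProduct.comm K (UqGl2 a) (UqGl2 a)).toLinearMap (twistElement a b) =
        twistElement a b * HAdic.hexp ((PowerSeries.C (-(b / 2)) : K) •
          (wedge (UqGl2.gen a .J3) (UqGl2.gen a .I) : UqGl2 a ⊗[K] UqGl2 a)) ∧
      H.counit = H₀.counit ∧
      ∀ x : UqGl2 a, H.comul x * twistElement a b = twistElement a b * H₀.comul x) ∧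
    (∃! D : UqGl2 a →ₐ[K] M2, IsFundamental a D) ∧
    (∀ (H : HAdicHopf (UqGl2 a)) (D : UqGl2 a →ₐ[K] M2), IsUab a b H → IsFundamental a D →
      HAdic.map (TensorProduct.map D.toLinearMap D.toLinearMap) (H.comul (casimir a)) =
        HAdic.of (xxzBond a b) ∧
      ∃ ρ : ∀ n : ℕ, UqGl2 a →ₐ[K] ChainOp n, IsChainRep H D ρ ∧
        ∀ (N : ℕ) (x : UqGl2 a), Commute (openChain N (xxzBond a b)) (ρ (N + 1) x)) ∧
    (∀ n : ℕ, ∃ S : ChainOp (n + 2), IsUnit S ∧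
      S * twistedXXZ n a ((n + 2 : ℕ) * b) = periodicChain n (xxzBond a b) * S) :=
  ⟨⟨isLieBialgebra_cocomm a b, cocomm_eq_lie a b, lie_schouten a b, schouten_ne_zero ha b⟩,
    existsUnique_hopf ha b,
    ⟨(classicalLimit a : UqGl2 a →+* ClassicalU), classicalLimit_gen a,
      fun _ h => h.isQuantization, classicalLimit_casimir a⟩,
    casimir_central ha,
    fun _ _ h h₀ => ⟨h₀.isTwist b, flip_twistElement a b, h.counit_eq h₀,
      h.comul_mul_twistElement h₀⟩,
    existsUnique_fundamental ha,
    fun _ _ h hD => ⟨h.map_comul_casimir ha hD, h.exists_chainRep ha hD⟩,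
    fun n => exists_conjugate n a b⟩
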